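/- Let $I\subseteq\mathbb R$ be a non-empty open interval and let $p_1,p_2,q_1,q_2,r_1,r_2:I\to\mathbb R$ be smooth and nowhere zero. Consider the variable coefficient Davey--Stewartson (vcDS) system $$i\psi_t+p_1(t)\psi_{xx}+p_2(t)\psi_{yy}=q_1(t)|\psi|^2\psi+q_2(t)\psi w,\qquad w_{xx}+r_1(t)w_{yy}=r_2(t)(|\psi|^2)_{yy}$$ for complex $\psi$ and real $w$, and the following two sets of conditions, with real constants $k_0,k_1,r_{10},r_{20}$. Table 1 ($q_1,q_2$ free), for some antiderivative $Q$ of $q_1$ on $I$: $$p_1=k_1q_1e^{k_0Q},\quad p_2=-r_{10}k_1q_1e^{-k_0Q},\quad r_1=r_{10}e^{-2k_0Q},\quad r_2=r_{20}\frac{q_1}{q_2}e^{-2k_0Q}.$$ Table 2 ($p_1,q_2$ free), for some antiderivative $P$ of $p_1$ on $I$ with $k_0P+k_1$ nowhere zero on $I$: $$p_2=-\frac{r_{10}\,p_1}{(k_0P+k_1)^2},\quad q_1=\frac{p_1}{k_0P+k_1},\quad r_1=\frac{r_{10}}{(k_0P+k_1)^2},\quad r_2=\frac{r_{20}}{(k_0P+k_1)^3}\,\frac{p_1}{q_2}.$$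 (a) Suppose that the coefficients satisfy the conditions of Table 1 or of Table 2. Then $\varepsilon=\operatorname{sgn}(p_1p_2)$ is constant, and $$A=\frac{\operatorname{sgn}(p_1)\,q_1}{|p_1p_2|^{1/2}},\qquad B=\frac{\operatorname{sgn}(p_1)\,q_2r_2\,|p_1|}{|p_2|\,|p_1p_2|^{1/2}}$$ are non-zero constants on $I$. Call the system with the constant coefficients $(1,\varepsilon,A,1,-\varepsilon,B)$ the integrable standard DS system (for $p_1p_2>0$ these are $(1,1,A,1,-1,B)$). The following hold. (a1) For every non-empty open interval $J$, the Lie point symmetry algebra of the vcDS system on $I\times\mathbb R^2$ is isomorphic to that of the integrable standard DS system on $J\times\mathbb R^2$. Here the symmetry algebra consists of all smooth vector fields in the variables $(t,x,y,\operatorname{Re}\psi,\operatorname{Im}\psi,w)$, with $t$ in the interval, whose second prolongation annihilates the equations at all second order jets satisfying the equations. More precisely, there is an isomorphism between the Lie algebras of all smooth vector fields over $I$ and over $J$ that carries one symmetry algebra onto the other. (a2) There are smooth $T:I\to\mathbb R$ with $\dot T p_1>0$. For every such $T$ and all smooth $\alpha_0,\beta_0,\theta_0:I\to\mathbb R$,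 put $\alpha=(\dot T/p_1)^{1/2}$, $\beta=(\varepsilon\dot T/p_2)^{1/2}$, $L=\dot T/q_2$, $$\theta=-\frac{\dot\alpha}{4p_1\alpha}x^2-\frac{\dot\beta}{4p_2\beta}y^2-\frac{\dot\alpha_0}{2p_1\alpha}x-\frac{\dot\beta_0}{2p_2\beta}y+\theta_0,\qquad H=-\frac{\theta_t+p_1\theta_x^2+p_2\theta_y^2}{q_2}.$$ Then the point transformation $$\tilde t=T(t),\quad \tilde x=\alpha x+\alpha_0,\quad \tilde y=\beta y+\beta_0,\quad \psi=(\alpha\beta)^{1/2}e^{i\theta}\tilde\psi,\quad w=L\tilde w+H$$ is smooth and locally invertible, maps $I\times\mathbb R^2$ bijectively onto $T(I)\times\mathbb R^2$, and transforms the vcDS system into the integrable standard DS system: $(\tilde\psi,\tilde w)$ satisfies the latter at the image of a point if and only if $(\psi,w)$ satisfies the former at that point. (b) The coefficients satisfy the conditions of Table 1 or of Table 2 if and only if the vcDS system is point-equivalent to an integrable DS system, in the following sense: there are non-zero constants $\tilde p_1,\tilde p_2,\tilde q_1,\tilde q_2,\tilde r_1,\tilde r_2$ with $\tilde p_2+\tilde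 p_1\tilde r_1=0$ such that, near each time $t_0\in I$, some smooth locally invertible fibre-preserving transformation $(\tilde t,\tilde x,\tilde y)=(T,X,Y)(t,x,y)$, $\psi=\Psi(t,x,y,\tilde\psi)$, $w=W(t,x,y,\tilde w)$, defined on a non-empty open set containing a point with time coordinate $t_0$, transforms the vcDS system (pointwise, as in (a2)) into the DS system with these constants as its coefficients. -/

import Mathlib

open Set TopologicalSpace
open scoped ContDiff

noncomputable section

namespace DaveyStewartson

/-- The independent variables `(t, x, y)`. -/
abbrev Base : Type := ℝ × ℝ × ℝ

/-- The dependent variables `(ψ, w)`, with `ψ = u + i v` complex and `w` real. -/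
abbrev Fib : Type := ℂ × ℝ

/-- The space of independent and dependent variables; as a real vector space it has the six
coordinates `t, x, y, u, v, w`. -/
abbrev Tot : Type := Base × Fib

/-- The unit vectors `∂_t`, `∂_x`, `∂_y`. -/
def et : Base := (1, 0, 0)
def ex : Base := (0, 1, 0)
def ey : Base := (0, 0, 1)

/-! ### The system -/

/-- The six real coefficients of a variable coefficient Davey-Stewartson system. -/
structure Coeffs where
  (p₁ p₂ q₁ q₂ r₁ r₂ : ℝ → ℝ)

/-- Constant coefficients. -/
def Coeffs.const (p₁ p₂ q₁ q₂ r₁ r₂ : ℝ) : Coeffs :=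
  ⟨fun _ => p₁, fun _ => p₂, fun _ => q₁, fun _ => q₂, fun _ => r₁, fun _ => r₂⟩

/-- The coefficients are smooth and nowhere zero on the time interval `I`. -/
structure Coeffs.SmoothNonzeroOn (c : Coeffs) (I : Set ℝ) : Prop where
  smooth_p₁ : ContDiffOn ℝ ∞ c.p₁ I
  smooth_p₂ : ContDiffOn ℝ ∞ c.p₂ I
  smooth_q₁ : ContDiffOn ℝ ∞ c.q₁ I
  smooth_q₂ : ContDiffOn ℝ ∞ c.q₂ I
  smooth_r₁ : ContDiffOn ℝ ∞ c.r₁ I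
  smooth_r₂ : ContDiffOn ℝ ∞ c.r₂ I
  ne_zero : ∀ t ∈ I, c.p₁ t ≠ 0 ∧ c.p₂ t ≠ 0 ∧ c.q₁ t ≠ 0 ∧ c.q₂ t ≠ 0 ∧ c.r₁ t ≠ 0 ∧ c.r₂ t ≠ 0

/-- Second order jets `(z, F z, F'(z), F''(z))` of maps `F : Base → Fib`. -/
def Jet : Type := Base × Fib × (Base →L[ℝ] Fib) × (Base →L[ℝ] Base →L[ℝ] Fib)

instance : NormedAddCommGroup Jet := inferInstanceAs
  (NormedAddCommGroup (Base × Fib × (Base →L[ℝ] Fib) × (Base →L[ℝ] Base →L[ℝ] Fib)))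

instance : NormedSpace ℝ Jet := inferInstanceAs
  (NormedSpace ℝ (Base × Fib × (Base →L[ℝ] Fib) × (Base →L[ℝ] Base →L[ℝ] Fib)))

/-- The second order jet of `F` at `z`. -/
def jet (F : Base → Fib) (z : Base) : Jet :=
  (z, F z, fderiv ℝ F z, fderiv ℝ (fderiv ℝ F) z)

/-- The left hand side minus the right hand side of the system
`i ψ_t + p₁ ψ_xx + p₂ ψ_yy = q₁ |ψ|² ψ + q₂ ψ w`, `w_xx + r₁ w_yy = r₂ (|ψ|²)_yy`
as a function of the second order jet, where `(|ψ|²)_yy = 2 Re (ψ̄ ψ_yy) + 2 |ψ_y|²`. -/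
def Delta (c : Coeffs) (j : Jet) : ℂ × ℝ :=
  let t : ℝ := j.1.1
  let ψ : ℂ := j.2.1.1
  let w : ℝ := j.2.1.2
  let D₁ : Base →L[ℝ] Fib := j.2.2.1
  let D₂ : Base →L[ℝ] Base →L[ℝ] Fib := j.2.2.2
  (Complex.I * (D₁ et).1 + (c.p₁ t : ℂ) * (D₂ ex ex).1 + (c.p₂ t : ℂ) * (D₂ ey ey).1
      - ((c.q₁ t : ℂ) * (Complex.normSq ψ : ℂ) * ψ + (c.q₂ t : ℂ) * ψ * (w : ℂ)),
    (D₂ ex ex).2 + c.r₁ t * (D₂ ey ey).2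
      - c.r₂ t * (2 * (starRingEnd ℂ ψ * (D₂ ey ey).1).re + 2 * Complex.normSq (D₁ ey).1))

/-- `F = (ψ, w)` satisfies both equations of the system at the point `z`. -/
def SolvesAt (c : Coeffs) (F : Base → Fib) (z : Base) : Prop :=
  Delta c (jet F z) = 0

/-! ### Point transformations -/

/-- The points with time coordinate in `I`. -/
def slab (I : Set ℝ) : Set Base := {z | z.1 ∈ I}

/-- The points `(z, (ψ, w))` with time coordinate in `I`. -/
def dom (I : Set ℝ) : Set Tot := {p | p.1.1 ∈ I}

/-- A fibre-preserving transformation `(t̃, x̃, ỹ) = base (t, x, y)`,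
`ψ = psi (t, x, y) ψ̃`, `w = w (t, x, y) w̃`. -/
structure FiberMap where
  base : Base → Base
  psi : Base → ℂ → ℂ
  w : Base → ℝ → ℝ

/-- The functions `(ψ, w)` of `(t, x, y)` obtained from functions `(ψ̃, w̃)` of `(t̃, x̃, ỹ)`. -/
def FiberMap.pull (G : FiberMap) (F : Base → Fib) : Base → Fib :=
  fun z => (G.psi z (F (G.base z)).1, G.w z (F (G.base z)).2)

/-- `G` is smooth and locally invertible at all `((t, x, y), (ψ̃, w̃)) ∈ N`. -/
def FiberMap.IsLocallyInvertibleOn (G : FiberMap) (N : Set Tot) : Prop :=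
  ∀ p ∈ N,
    ContDiffAt ℝ ∞ G.base p.1 ∧ Function.Bijective (fderiv ℝ G.base p.1) ∧
    ContDiffAt ℝ ∞ (fun q : Base × ℂ => G.psi q.1 q.2) (p.1, p.2.1) ∧
    Function.Bijective (fderiv ℝ (G.psi p.1) p.2.1) ∧
    ContDiffAt ℝ ∞ (fun q : Base × ℝ => G.w q.1 q.2) (p.1, p.2.2) ∧
    deriv (G.w p.1) p.2.2 ≠ 0

/-- On `N`, the transformation `G` turns the system with coefficients `c` into the system with
coefficients `c'`: functions `F = (ψ̃, w̃)` satisfy the new system at the image of a point if and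
only if the transformed functions satisfy the original system at that point. -/
def FiberMap.Transforms (G : FiberMap) (N : Set Tot) (c c' : Coeffs) : Prop :=
  ∀ (z : Base) (F : Base → Fib), ContDiffAt ℝ 2 F (G.base z) → (z, F (G.base z)) ∈ N →
    (SolvesAt c' F (G.base z) ↔ SolvesAt c (G.pull F) z)

/-- Near every time of `I` the system can be brought by a fibre-preserving local point
transformation into an integrable Davey-Stewartson system: constant non-zero coefficients
with `p₂ + p₁ r₁ = 0`. -/
def PointEquivalentToIntegrable (c : Coeffs) (I : Set ℝ) : Prop :=
  ∃ p₁ p₂ q₁ q₂ r₁ r₂ : ℝ,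
    p₁ ≠ 0 ∧ p₂ ≠ 0 ∧ q₁ ≠ 0 ∧ q₂ ≠ 0 ∧ r₁ ≠ 0 ∧ r₂ ≠ 0 ∧ p₂ + p₁ * r₁ = 0 ∧
    ∀ t₀ ∈ I, ∃ (N : Set Tot) (G : FiberMap), IsOpen N ∧ N ⊆ dom I ∧ (∃ p ∈ N, p.1.1 = t₀) ∧
      G.IsLocallyInvertibleOn N ∧ G.Transforms N c (Coeffs.const p₁ p₂ q₁ q₂ r₁ r₂)

/-- The phase `θ` of an equivalence transformation. -/
def phase (c : Coeffs) (α β α₀ β₀ θ₀ : ℝ → ℝ) (t x y : ℝ) : ℝ :=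
  -(deriv α t / (4 * c.p₁ t * α t)) * x ^ 2 - deriv β t / (4 * c.p₂ t * β t) * y ^ 2
    - deriv α₀ t / (2 * c.p₁ t * α t) * x - deriv β₀ t / (2 * c.p₂ t * β t) * y + θ₀ t

/-- The shift `H` of `w`, determined by `q₂ H = -(θ_t + p₁ θ_x² + p₂ θ_y²)`. -/
def shift (c : Coeffs) (α β α₀ β₀ θ₀ : ℝ → ℝ) (t x y : ℝ) : ℝ :=
  -(deriv (fun s => phase c α β α₀ β₀ θ₀ s x y) t
    + c.p₁ t * (deriv (fun s => phase c α β α₀ β₀ θ₀ t s y) x) ^ 2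
    + c.p₂ t * (deriv (fun s => phase c α β α₀ β₀ θ₀ t x s) y) ^ 2) / c.q₂ t

/-- The equivalence transformations
`t̃ = T(t)`, `x̃ = α(t) x + α₀(t)`, `ỹ = β(t) y + β₀(t)`,
`ψ = (α β)^(1/2) exp(i θ(t, x, y)) ψ̃`, `w = L(t) w̃ + H(t, x, y)`. -/
def equivTransformation (c : Coeffs) (T α β L α₀ β₀ θ₀ : ℝ → ℝ) : FiberMap where
  base z := (T z.1, α z.1 * z.2.1 + α₀ z.1, β z.1 * z.2.2 + β₀ z.1)
  psi z a := (Real.sqrt (α z.1 * β z.1) : ℂ)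
    * Complex.exp (Complex.I * (phase c α β α₀ β₀ θ₀ z.1 z.2.1 z.2.2 : ℂ)) * a
  w z b := L z.1 * b + shift c α β α₀ β₀ θ₀ z.1 z.2.1 z.2.2

/-- The special equivalence transformations with
`α = (T' / p₁)^(1/2)`, `β = (ε T' / p₂)^(1/2)`, `L = T' / q₂`. -/
def canonicalTransformation (c : Coeffs) (ε : ℝ) (T α₀ β₀ θ₀ : ℝ → ℝ) : FiberMap :=
  equivTransformation c T
    (fun t => Real.sqrt (deriv T t / c.p₁ t)) (fun t => Real.sqrt (ε * deriv T t / c.p₂ t))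
    (fun t => deriv T t / c.q₂ t) α₀ β₀ θ₀

/-! ### The two tables of coefficients -/

/-- First table; `Q = ∫ q₁ dt`, and `q₁`, `q₂` are free. -/
def Table1 (c : Coeffs) (I : Set ℝ) : Prop :=
  ∃ (k₀ k₁ r₁₀ r₂₀ : ℝ) (Q : ℝ → ℝ), (∀ t ∈ I, HasDerivAt Q (c.q₁ t) t) ∧ ∀ t ∈ I,
    c.p₁ t = k₁ * c.q₁ t * Real.exp (k₀ * Q t) ∧
    c.p₂ t = -(r₁₀ * k₁ * c.q₁ t * Real.exp (-(k₀ * Q t))) ∧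
    c.r₁ t = r₁₀ * Real.exp (-(2 * k₀ * Q t)) ∧
    c.r₂ t = r₂₀ * (c.q₁ t / c.q₂ t) * Real.exp (-(2 * k₀ * Q t))

/-- Second table; `P = ∫ p₁ dt`, and `p₁`, `q₂` are free. -/
def Table2 (c : Coeffs) (I : Set ℝ) : Prop :=
  ∃ (k₀ k₁ r₁₀ r₂₀ : ℝ) (P : ℝ → ℝ), (∀ t ∈ I, HasDerivAt P (c.p₁ t) t) ∧ ∀ t ∈ I,
    k₀ * P t + k₁ ≠ 0 ∧
    c.p₂ t = -(r₁₀ * (c.p₁ t / (k₀ * P t + k₁) ^ 2)) ∧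
    c.q₁ t = c.p₁ t / (k₀ * P t + k₁) ∧
    c.r₁ t = r₁₀ / (k₀ * P t + k₁) ^ 2 ∧
    c.r₂ t = r₂₀ / (k₀ * P t + k₁) ^ 3 * (c.p₁ t / c.q₂ t)

/-! ### Vector fields -/

theorem isOpen_dom (I : Opens ℝ) : IsOpen (dom I) :=
  I.isOpen.preimage (continuous_fst.comp continuous_fst)

/-- Smooth vector fields
`V = τ ∂_t + ξ ∂_x + η ∂_y + φ₁ ∂_u + φ₂ ∂_v + φ₃ ∂_w` on the points with time in `I`, the
coefficients being functions of `(t, x, y, u, v, w)`, where `V p = ((τ, ξ, η), (φ₁ + i φ₂, φ₃))`.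
A field on this open set is represented by its extension by zero. -/
def smoothFields (I : Opens ℝ) : Submodule ℝ (Tot → Tot) where
  carrier := {V | ContDiffOn ℝ ∞ V (dom I) ∧ ∀ p ∉ dom I, V p = 0}
  add_mem' := fun {V W} hV hW =>
    ⟨hV.1.add hW.1, fun p hp => by simp [hV.2 p hp, hW.2 p hp]⟩
  zero_mem' := ⟨contDiffOn_const, fun _ _ => rfl⟩
  smul_mem' := fun a V hV => ⟨hV.1.const_smul a, fun p hp => by simp [hV.2 p hp]⟩

abbrev VField (I : Opens ℝ) : Type := smoothFields I

theorem VField.contDiffAt {I : Opens ℝ} (V : VField I) {p : Tot} (hp : p ∈ dom I) :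
    ContDiffAt ℝ ∞ V.1 p :=
  (V.2.1 p hp).contDiffAt ((isOpen_dom I).mem_nhds hp)

theorem VField.differentiableAt {I : Opens ℝ} (V : VField I) {p : Tot} (hp : p ∈ dom I) :
    DifferentiableAt ℝ V.1 p :=
  (V.contDiffAt hp).differentiableAt (by simp)

theorem lieBracket_eq_zero {I : Opens ℝ} (V W : VField I) {p : Tot} (hp : p ∉ dom I) :
    VectorField.lieBracket ℝ V.1 W.1 p = 0 :=
  VectorField.lieBracket_eq_zero_of_eq_zero (V.2.2 p hp) (W.2.2 p hp)

/-- The Lie bracket of vector fields. -/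
instance (I : Opens ℝ) : Bracket (VField I) (VField I) where
  bracket V W := ⟨VectorField.lieBracket ℝ V.1 W.1,
    fun _ hp => (((V.contDiffAt hp).lieBracket_vectorField (W.contDiffAt hp)
      (m := ∞) (by simp))).contDiffWithinAt,
    fun _ hp => lieBracket_eq_zero V W hp⟩

theorem bracket_apply {I : Opens ℝ} (V W : VField I) (p : Tot) :
    (⁅V, W⁆ : VField I).1 p = VectorField.lieBracket ℝ V.1 W.1 p := rfl

instance (I : Opens ℝ) : LieRing (VField I) where
  add_lie U V W := by
    ext1; funext p
    by_cases hp : p ∈ dom I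
    · exact VectorField.lieBracket_add_left (U.differentiableAt hp) (V.differentiableAt hp)
    · rw [(⁅U + V, W⁆ : VField I).2.2 p hp, (⁅U, W⁆ + ⁅V, W⁆ : VField I).2.2 p hp]
  lie_add U V W := by
    ext1; funext p
    by_cases hp : p ∈ dom I
    · exact VectorField.lieBracket_add_right (V.differentiableAt hp) (W.differentiableAt hp)
    · rw [(⁅U, V + W⁆ : VField I).2.2 p hp, (⁅U, V⁆ + ⁅U, W⁆ : VField I).2.2 p hp]
  lie_self U := by
    ext1; exact VectorField.lieBracket_self
  leibniz_lie U V W := by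
    ext1; funext p
    by_cases hp : p ∈ dom I
    · exact VectorField.leibniz_identity_lieBracket (n := ∞) (by
        simp only [minSmoothness_of_isRCLikeNormedField]
        exact WithTop.coe_le_coe.2 (le_top : (2 : ℕ∞) ≤ ⊤))
        (U.contDiffAt hp) (V.contDiffAt hp) (W.contDiffAt hp)
    · rw [(⁅U, ⁅V, W⁆⁆ : VField I).2.2 p hp, (⁅⁅U, V⁆, W⁆ + ⁅V, ⁅U, W⁆⁆ : VField I).2.2 p hp]

instance (I : Opens ℝ) : LieAlgebra ℝ (VField I) where
  lie_smul a V W := by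
    ext1; funext p
    by_cases hp : p ∈ dom I
    · exact VectorField.lieBracket_const_smul_right (W.differentiableAt hp)
    · rw [(⁅V, a • W⁆ : VField I).2.2 p hp, (a • ⁅V, W⁆ : VField I).2.2 p hp]

/-! ### Infinitesimal point symmetries -/

/-- The characteristic of the vector field `V` along `F`:
`φ - τ F_t - ξ F_x - η F_y`, evaluated at `(z, F z)`. -/
def characteristic (V : Tot → Tot) (F : Base → Fib) (z : Base) : Fib :=
  (V (z, F z)).2 - fderiv ℝ F z (V (z, F z)).1

/-- The value of the second prolongation of `V` at the second order jet of `F` at `z`, by the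
prolongation formula `φ^J = D_J (characteristic) + τ F_{J,t} + ξ F_{J,x} + η F_{J,y}`. The third
derivatives of `F` cancel. -/
def prolong (V : Tot → Tot) (F : Base → Fib) (z : Base) : Jet :=
  ((V (z, F z)).1, (V (z, F z)).2,
    fderiv ℝ (characteristic V F) z + fderiv ℝ (fderiv ℝ F) z (V (z, F z)).1,
    fderiv ℝ (fderiv ℝ (characteristic V F)) z
      + fderiv ℝ (fderiv ℝ (fderiv ℝ F)) z (V (z, F z)).1)

/-- `V` is an infinitesimal symmetry: its second prolongation annihilates the equations
at all second order jets that satisfy the equations. -/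
def IsSymmetry (c : Coeffs) (I : Set ℝ) (V : Tot → Tot) : Prop :=
  ∀ (F : Base → Fib) (z : Base), z.1 ∈ I → ContDiffAt ℝ ∞ F z → Delta c (jet F z) = 0 →
    fderiv ℝ (Delta c) (jet F z) (prolong V F z) = 0

theorem contDiffAt_characteristic {I : Opens ℝ} (V : VField I) {F : Base → Fib} {z : Base}
    (hz : z.1 ∈ I) (hF : ContDiffAt ℝ ∞ F z) : ContDiffAt ℝ ∞ (characteristic V.1 F) z := by
  have h1 : ContDiffAt ℝ ∞ (fun z => V.1 (z, F z)) z :=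
    ContDiffAt.comp (g := V.1) z (V.contDiffAt hz) (contDiffAt_id.prodMk hF)
  have h2 : ContDiffAt ℝ ∞ (fderiv ℝ F) z := hF.fderiv_right (by simp)
  exact h1.snd.sub (h2.clm_apply h1.fst)

theorem prolong_add {I : Opens ℝ} (V W : VField I) {F : Base → Fib} {z : Base}
    (hz : z.1 ∈ I) (hF : ContDiffAt ℝ ∞ F z) :
    prolong (V + W).1 F z = prolong V.1 F z + prolong W.1 F z := by
  have hV := contDiffAt_characteristic V hz hF
  have hW := contDiffAt_characteristic W hz hF
  have e : characteristic (V + W).1 F = characteristic V.1 F + characteristic W.1 F := by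
    funext z; simp [characteristic]; abel
  have e1 : fderiv ℝ (characteristic (V + W).1 F) =ᶠ[nhds z]
      fderiv ℝ (characteristic V.1 F) + fderiv ℝ (characteristic W.1 F) := by
    filter_upwards [(hV.of_le (m := 1) (by simp)).eventually (by simp),
      (hW.of_le (m := 1) (by simp)).eventually (by simp)] with y hy hy'
    rw [e]
    exact fderiv_add (hy.differentiableAt (by simp)) (hy'.differentiableAt (by simp))
  have e2 : fderiv ℝ (fderiv ℝ (characteristic (V + W).1 F)) z
      = fderiv ℝ (fderiv ℝ (characteristic V.1 F)) z
        + fderiv ℝ (fderiv ℝ (characteristic W.1 F)) z := by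
    rw [e1.fderiv_eq]
    exact fderiv_add ((hV.fderiv_right (m := ∞) (by simp)).differentiableAt (by simp))
      ((hW.fderiv_right (m := ∞) (by simp)).differentiableAt (by simp))
  refine Prod.ext rfl (Prod.ext rfl (Prod.ext ?_ ?_))
  · change fderiv ℝ (characteristic (V + W).1 F) z
        + fderiv ℝ (fderiv ℝ F) z ((V.1 (z, F z)).1 + (W.1 (z, F z)).1)
      = (fderiv ℝ (characteristic V.1 F) z + fderiv ℝ (fderiv ℝ F) z (V.1 (z, F z)).1)
        + (fderiv ℝ (characteristic W.1 F) z + fderiv ℝ (fderiv ℝ F) z (W.1 (z, F z)).1)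
    rw [e1.eq_of_nhds, map_add, Pi.add_apply]
    abel
  · change fderiv ℝ (fderiv ℝ (characteristic (V + W).1 F)) z
        + fderiv ℝ (fderiv ℝ (fderiv ℝ F)) z ((V.1 (z, F z)).1 + (W.1 (z, F z)).1)
      = (fderiv ℝ (fderiv ℝ (characteristic V.1 F)) z
          + fderiv ℝ (fderiv ℝ (fderiv ℝ F)) z (V.1 (z, F z)).1)
        + (fderiv ℝ (fderiv ℝ (characteristic W.1 F)) z
          + fderiv ℝ (fderiv ℝ (fderiv ℝ F)) z (W.1 (z, F z)).1)
    rw [e2, map_add]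
    abel

theorem prolong_smul {I : Opens ℝ} (a : ℝ) (V : VField I) {F : Base → Fib} {z : Base}
    (hz : z.1 ∈ I) (hF : ContDiffAt ℝ ∞ F z) :
    prolong (a • V).1 F z = a • prolong V.1 F z := by
  have hV := contDiffAt_characteristic V hz hF
  have e : characteristic (a • V).1 F = a • characteristic V.1 F := by
    funext z; simp [characteristic, smul_sub]
  have e1 : fderiv ℝ (characteristic (a • V).1 F) =ᶠ[nhds z]
      a • fderiv ℝ (characteristic V.1 F) := by
    filter_upwards [(hV.of_le (m := 1) (by simp)).eventually (by simp)] with y hy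
    rw [e]
    exact fderiv_const_smul (hy.differentiableAt (by simp)) a
  have e2 : fderiv ℝ (fderiv ℝ (characteristic (a • V).1 F)) z
      = a • fderiv ℝ (fderiv ℝ (characteristic V.1 F)) z := by
    rw [e1.fderiv_eq]
    exact fderiv_const_smul ((hV.fderiv_right (m := ∞) (by simp)).differentiableAt (by simp)) a
  refine Prod.ext rfl (Prod.ext rfl (Prod.ext ?_ ?_))
  · change fderiv ℝ (characteristic (a • V).1 F) z
        + fderiv ℝ (fderiv ℝ F) z (a • (V.1 (z, F z)).1)
      = a • (fderiv ℝ (characteristic V.1 F) z + fderiv ℝ (fderiv ℝ F) z (V.1 (z, F z)).1)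
    rw [e1.eq_of_nhds, map_smul, Pi.smul_apply, smul_add]
  · change fderiv ℝ (fderiv ℝ (characteristic (a • V).1 F)) z
        + fderiv ℝ (fderiv ℝ (fderiv ℝ F)) z (a • (V.1 (z, F z)).1)
      = a • (fderiv ℝ (fderiv ℝ (characteristic V.1 F)) z
          + fderiv ℝ (fderiv ℝ (fderiv ℝ F)) z (V.1 (z, F z)).1)
    rw [e2, map_smul, smul_add]

/-- The symmetry algebra of the system on the time interval `I`: all infinitesimal symmetries,
as a subspace of the Lie algebra of smooth vector fields. -/
def symmetryAlgebra (c : Coeffs) (I : Opens ℝ) : Submodule ℝ (VField I) where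
  carrier := {V | IsSymmetry c I V.1}
  add_mem' := fun {V W} hV hW F z hz hF h => by
    rw [prolong_add V W hz hF, map_add, hV F z hz hF h, hW F z hz hF h, add_zero]
  zero_mem' := fun F z hz hF _ => by
    have h0 : prolong (0 : VField I).1 F z = 0 := by
      have h := prolong_smul (0 : ℝ) (0 : VField I) hz hF
      rwa [zero_smul ℝ (0 : VField I), zero_smul] at h
    rw [h0, map_zero]
  smul_mem' := fun a V hV F z hz hF h => by
    rw [prolong_smul a V hz hF, map_smul, hV F z hz hF h, smul_zero]

end DaveyStewartson

end

open DaveyStewartson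

/-! Substitute ψ = m ψ̃, w = L w̃ + H, with x̃ and ỹ affine in x and y respectively and coefficients
depending on t. The terms in ψ̃_x and ψ̃_y cancel when the phase θ of m satisfies 2 p₁ α θ_x = -x̃_t
and its analogue in y. The imaginary multiples of ψ̃ then force |m|² to be proportional to α β, and
the real multiples define H. Matching the remaining coefficients is algebra in α, β, L and T'. The
only differential condition left is that H, a quadratic polynomial in x and y, solves H_xx + r₁ H_yy
= 0. All conditions together are `Admissible`; the computation is `sys_pull`.

Sufficiency. Table 2 is a reparametrization of part of Table 1 (`Table2.table1`). Table 1 gives the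
algebraic relations that make A and B constant, and the logarithmic derivatives q₁'/q₁ + k₀ q₁ of p₁
and q₁'/q₁ - k₀ q₁ of p₂ (`Table1.reducible`). The condition on H is then the difference of one
expression at k₀ and at -k₀ (`deriv_phaseCoeff`). That expression is even in k₀, whatever T is; so T
stays free (`Reducible.admissible`).

Symmetries. If T maps I onto J, the transformation is a diffeomorphism of the spaces of all
variables, and pushforward is an isomorphism of the Lie algebras of vector fields. The second
prolongation of V at a jet of F is the velocity of the jet of F + s Q along a moving base point, Q
being the characteristic. The transformation is affine in the fibre, so it carries F' + s Q' to F +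
s Q, and it multiplies the equations by nowhere zero factors. Differentiating at s = 0 matches the
two symmetry conditions (`fderiv_Delta_prolong`, `symmetryAlgebra_push`).

Necessity. The transformation is now arbitrary, but solving the system at a point is a condition on
a second order jet, so quadratic polynomials with any admissible jet may be inserted. Differences of
such tests isolate single derivatives (`FiberMap.Reduces.perturb`). They show that t̃ depends on t
alone, x̃ on t and affinely on x, ỹ on t and affinely on y, and that ψ is real linear in ψ̃
(`FiberMap.Reduces.firstOrder`, `secondOrder`, `exists_box`). The images M and w of constants ψ̃ and
w̃ satisfy a linear Schrödinger equation for M, whose potential has its second space derivatives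
determined by the phase of M (`potential_of_phase`). Together with the wave equation for w and p₂ =
-p₁ r₁ this yields an ordinary differential equation for D = p₂'/p₂ - p₁'/p₁, which says that D/q₁
is constant. Integration gives Table 1 (`Table1.of_reducibleAt`). -/

namespace DaveyStewartson

/-! ### Directional derivatives in the independent variables -/

section PartialDerivatives

variable {E F : Type*} [NormedAddCommGroup E] [NormedSpace ℝ E]
  [NormedAddCommGroup F] [NormedSpace ℝ F]

/-- The directional derivative along a constant vector. -/
noncomputable def pd (v : Base) (f : Base → E) (z : Base) : E := fderiv ℝ f z v

theorem ContDiffAt.pd {f : Base → E} {z : Base} {m n : WithTop ℕ∞} (h : ContDiffAt ℝ n f z)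
    (hmn : m + 1 ≤ n) (v : Base) : ContDiffAt ℝ m (DaveyStewartson.pd v f) z :=
  (h.fderiv_right hmn).clm_apply contDiffAt_const

theorem pd_congr {f g : Base → E} {z : Base} (h : f =ᶠ[nhds z] g) (v : Base) :
    pd v f z = pd v g z := by
  simp only [pd, h.fderiv_eq]

theorem pd_congr_eventually {f g : Base → E} {z : Base} (h : f =ᶠ[nhds z] g) (v : Base) :
    pd v f =ᶠ[nhds z] pd v g :=
  h.eventuallyEq_nhds.mono fun _ hy => pd_congr hy v

theorem pd_pd_eq_fderiv {f : Base → E} {z : Base} (h : ContDiffAt ℝ 2 f z) (v w : Base) :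
    pd v (pd w f) z = fderiv ℝ (fderiv ℝ f) z v w := by
  have h1 : DifferentiableAt ℝ (fderiv ℝ f) z :=
    (h.fderiv_right (m := 1) (by norm_num)).differentiableAt (by norm_num)
  have := h1.hasFDerivAt.clm_apply (hasFDerivAt_const w z)
  unfold pd
  rw [this.fderiv]
  simp

theorem pd_comm {f : Base → E} {z : Base} (h : ContDiffAt ℝ 2 f z) (v w : Base) :
    pd v (pd w f) z = pd w (pd v f) z := by
  rw [pd_pd_eq_fderiv h, pd_pd_eq_fderiv h]
  exact (h.isSymmSndFDerivAt (by simp)) v w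

theorem pd_clm (ℓ : E →L[ℝ] F) {f : Base → E} {z : Base} (h : DifferentiableAt ℝ f z) (v : Base) :
    pd v (fun y => ℓ (f y)) z = ℓ (pd v f z) := by
  have := ℓ.hasFDerivAt.comp z h.hasFDerivAt
  exact congrArg (fun A => A v) this.fderiv

theorem pd_add {f g : Base → E} {z : Base} (hf : DifferentiableAt ℝ f z)
    (hg : DifferentiableAt ℝ g z) (v : Base) :
    pd v (fun y => f y + g y) z = pd v f z + pd v g z := by
  unfold pd
  rw [fderiv_fun_add hf hg]; rfl

theorem pd_smul {f : Base → ℝ} {g : Base → E} {z : Base} (hf : DifferentiableAt ℝ f z)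
    (hg : DifferentiableAt ℝ g z) (v : Base) :
    pd v (fun y => f y • g y) z = pd v f z • g z + f z • pd v g z := by
  unfold pd
  rw [fderiv_fun_smul hf hg]; simp [add_comm]

theorem pd_mul {𝔸 : Type*} [NormedCommRing 𝔸] [NormedAlgebra ℝ 𝔸] {f g : Base → 𝔸} {z : Base}
    (hf : DifferentiableAt ℝ f z)
    (hg : DifferentiableAt ℝ g z) (v : Base) :
    pd v (fun y => f y * g y) z = pd v f z * g z + f z * pd v g z := by
  unfold pd
  rw [fderiv_fun_mul hf hg]; simp; ring

theorem pd_comp {G : Base → Base} {f : Base → E} {z : Base} (hf : DifferentiableAt ℝ f (G z))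
    (hG : DifferentiableAt ℝ G z) (v : Base) :
    pd v (fun y => f (G y)) z = fderiv ℝ f (G z) (pd v G z) := by
  unfold pd
  rw [show (fun y => f (G y)) = f ∘ G from rfl, fderiv_comp z hf hG]; rfl

theorem pd_time {φ : ℝ → E} {z : Base} (h : DifferentiableAt ℝ φ z.1) (v : Base) :
    pd v (fun y => φ y.1) z = v.1 • deriv φ z.1 := by
  have := h.hasDerivAt.hasFDerivAt.comp z (hasFDerivAt_fst (p := z) (𝕜 := ℝ))
  refine (congrArg (fun A => A v) this.fderiv).trans ?_
  simp

end PartialDerivatives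

/-! ### The two equations and their behaviour under substitution -/

/-- The first equation of the system in terms of the functions `ψ` and `w`. -/
noncomputable def sys₁ (c : Coeffs) (ψ : Base → ℂ) (w : Base → ℝ) (z : Base) : ℂ :=
  Complex.I * pd et ψ z + c.p₁ z.1 * pd ex (pd ex ψ) z + c.p₂ z.1 * pd ey (pd ey ψ) z
    - (c.q₁ z.1 * Complex.normSq (ψ z) * ψ z + c.q₂ z.1 * ψ z * w z)

/-- The second equation of the system in terms of the functions `ψ` and `w`. -/
noncomputable def sys₂ (c : Coeffs) (ψ : Base → ℂ) (w : Base → ℝ) (z : Base) : ℝ :=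
  pd ex (pd ex w) z + c.r₁ z.1 * pd ey (pd ey w) z
    - c.r₂ z.1 * (2 * (starRingEnd ℂ (ψ z) * pd ey (pd ey ψ) z).re
      + 2 * Complex.normSq (pd ey ψ z))

theorem Delta_jet (c : Coeffs) {F : Base → Fib} {z : Base} (h : ContDiffAt ℝ 2 F z) :
    Delta c (jet F z) =
      (sys₁ c (fun y => (F y).1) (fun y => (F y).2) z,
        sys₂ c (fun y => (F y).1) (fun y => (F y).2) z) := by
  have h1 : DifferentiableAt ℝ F z := h.differentiableAt (by norm_num)
  have e1 : ∀ v, (fderiv ℝ F z v).1 = pd v (fun y => (F y).1) z := fun v =>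
    (pd_clm (ContinuousLinearMap.fst ℝ ℂ ℝ) h1 v).symm
  have d1 : ∀ v, (pd v fun y => (F y).1) =ᶠ[nhds z] fun y => (pd v F y).1 := by
    intro v
    filter_upwards [h.eventually (by simp)] with y hy
    exact (pd_clm (ContinuousLinearMap.fst ℝ ℂ ℝ) (hy.differentiableAt (by norm_num)) v)
  have d2 : ∀ v, (pd v fun y => (F y).2) =ᶠ[nhds z] fun y => (pd v F y).2 := by
    intro v
    filter_upwards [h.eventually (by simp)] with y hy
    exact (pd_clm (ContinuousLinearMap.snd ℝ ℂ ℝ) (hy.differentiableAt (by norm_num)) v)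
  have h2 : ∀ v, DifferentiableAt ℝ (pd v F) z := fun v =>
    (ContDiffAt.pd (m := 1) h (by norm_num) v).differentiableAt (by norm_num)
  have e11 : ∀ v, (fderiv ℝ (fderiv ℝ F) z v v).1 = pd v (pd v (fun y => (F y).1)) z := by
    intro v
    rw [pd_congr (d1 v) v, ← pd_pd_eq_fderiv h]
    exact (pd_clm (ContinuousLinearMap.fst ℝ ℂ ℝ) (h2 v) v).symm
  have e22 : ∀ v, (fderiv ℝ (fderiv ℝ F) z v v).2 = pd v (pd v (fun y => (F y).2)) z := by
    intro v
    rw [pd_congr (d2 v) v, ← pd_pd_eq_fderiv h]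
    exact (pd_clm (ContinuousLinearMap.snd ℝ ℂ ℝ) (h2 v) v).symm
  simp only [Delta, jet, sys₁, sys₂]
  rw [e1, e1, e11, e11, e22, e22]

/-- First and second derivatives of a composition along a direction which the base map rescales. -/
theorem pd_comp_of_smul {E : Type*} [NormedAddCommGroup E] [NormedSpace ℝ E]
    {f : Base → E} {G : Base → Base} {α : ℝ → ℝ} {v : Base} {z : Base} (hv : v.1 = 0)
    (hf : ContDiffAt ℝ 2 f (G z)) (hG : ContDiffAt ℝ 2 G z)
    (hGv : ∀ᶠ y in nhds z, pd v G y = α y.1 • v) (hα : DifferentiableAt ℝ α z.1) :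
    ((pd v fun y => f (G y)) =ᶠ[nhds z] fun y => α y.1 • pd v f (G y)) ∧
      pd v (pd v fun y => f (G y)) z = α z.1 ^ 2 • pd v (pd v f) (G z) := by
  have h1 : (pd v fun y => f (G y)) =ᶠ[nhds z] fun y => α y.1 • pd v f (G y) := by
    filter_upwards [hG.continuousAt.eventually (hf.eventually (by simp)), hG.eventually (by simp),
      hGv] with y h1 h2 h3
    rw [pd_comp (h1.differentiableAt (by norm_num)) (h2.differentiableAt (by norm_num)), h3,
      map_smul]
    rfl
  refine ⟨h1, ?_⟩
  have hd : DifferentiableAt ℝ (pd v f) (G z) :=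
    (ContDiffAt.pd (m := 1) hf (by norm_num) v).differentiableAt (by norm_num)
  have hG1 : DifferentiableAt ℝ G z := hG.differentiableAt (by norm_num)
  have hα' : DifferentiableAt ℝ (fun y : Base => α y.1) z :=
    DifferentiableAt.comp (g := α) z hα differentiableAt_fst
  rw [pd_congr h1, pd_smul (g := fun y => pd v f (G y)) hα' (hd.comp z hG1), pd_time hα, hv, pd_comp hd hG1,
    hGv.self_of_nhds, map_smul]
  simp only [zero_smul, smul_smul, zero_add]
  rw [sq]; rfl

/-- First and second derivatives of `m · u` where `m` has logarithmic derivative `i f`. -/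
theorem pd_phase_mul {m u : Base → ℂ} {f : Base → ℝ} {v z : Base}
    (hm : ContDiffAt ℝ 2 m z) (hu : ContDiffAt ℝ 2 u z) (hf : DifferentiableAt ℝ f z)
    (hmv : ∀ᶠ y in nhds z, pd v m y = Complex.I * f y * m y) :
    pd v (fun y => m y * u y) z = Complex.I * f z * m z * u z + m z * pd v u z ∧
      pd v (pd v fun y => m y * u y) z =
        m z * ((Complex.I * pd v f z - f z ^ 2) * u z + 2 * Complex.I * f z * pd v u z
          + pd v (pd v u) z) := by
  have h1 : (pd v fun y => m y * u y) =ᶠ[nhds z]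
      fun y => (Complex.I * f y * m y) * u y + m y * pd v u y := by
    filter_upwards [hm.eventually (by simp), hu.eventually (by simp), hmv] with y h1 h2 h3
    rw [pd_mul (h1.differentiableAt (by norm_num)) (h2.differentiableAt (by norm_num)), h3]
  refine ⟨h1.self_of_nhds, ?_⟩
  have dm : DifferentiableAt ℝ m z := hm.differentiableAt (by norm_num)
  have du : DifferentiableAt ℝ u z := hu.differentiableAt (by norm_num)
  have dud : DifferentiableAt ℝ (pd v u) z :=
    (ContDiffAt.pd (m := 1) hu (by norm_num) v).differentiableAt (by norm_num)
  have dfc : DifferentiableAt ℝ (fun y => (f y : ℂ)) z := Complex.ofRealCLM.differentiableAt.comp z hf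
  have dif : DifferentiableAt ℝ (fun y => Complex.I * (f y : ℂ)) z := dfc.const_mul _
  have ef : pd v (fun y => (f y : ℂ)) z = pd v f z := pd_clm Complex.ofRealCLM hf v
  have eI : pd v (fun y => Complex.I * (f y : ℂ)) z = Complex.I * pd v f z := by
    rw [pd_mul (differentiableAt_const _) dfc, ef]
    simp [pd]
  rw [pd_congr h1, pd_add ((dif.fun_mul dm).fun_mul du) (dm.fun_mul dud), pd_mul (dif.fun_mul dm) du,
    pd_mul dif dm, pd_mul dm dud, hmv.self_of_nhds, eI]
  ring_nf
  rw [Complex.I_sq]; ring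

/-- The hypotheses are what remains of the equations after substitution. `hfX` and `hgY` remove the
first space derivatives of `a`, `hr` the imaginary multiples of `a`, and `hν` balances the real ones
against the shift `H`. The six relations `hp₁` to `hr₂` match coefficients, and `hHH` makes `H`
invisible to the second equation. -/
theorem sys_pull {c c' : Coeffs} {z : Base} {G : Base → Base} {m : Base → ℂ} {L : ℝ → ℝ}
    {H : Base → ℝ} {a : Base → ℂ} {b : Base → ℝ} {α β : ℝ → ℝ} {f g : Base → ℝ} {τ Xt Yt r ν : ℝ}
    (ha : ContDiffAt ℝ 2 a (G z)) (hb : ContDiffAt ℝ 2 b (G z))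
    (hG : ContDiffAt ℝ 2 G z) (hm : ContDiffAt ℝ 2 m z) (hL : ContDiffAt ℝ 2 L z.1)
    (hH : ContDiffAt ℝ 2 H z)
    (hf : DifferentiableAt ℝ f z) (hg : DifferentiableAt ℝ g z)
    (hα : DifferentiableAt ℝ α z.1) (hβ : DifferentiableAt ℝ β z.1)
    (hGt : pd et G z = (τ, Xt, Yt))
    (hGx : ∀ᶠ y in nhds z, pd ex G y = α y.1 • ex)
    (hGy : ∀ᶠ y in nhds z, pd ey G y = β y.1 • ey)
    (hmt : pd et m z = (r + Complex.I * ν) * m z)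
    (hmx : ∀ᶠ y in nhds z, pd ex m y = Complex.I * f y * m y)
    (hmy : ∀ᶠ y in nhds z, pd ey m y = Complex.I * g y * m y)
    (hfX : 2 * c.p₁ z.1 * α z.1 * f z = -Xt) (hgY : 2 * c.p₂ z.1 * β z.1 * g z = -Yt)
    (hr : r = -(c.p₁ z.1 * pd ex f z + c.p₂ z.1 * pd ey g z))
    (hν : c.q₂ z.1 * H z = -(ν + c.p₁ z.1 * f z ^ 2 + c.p₂ z.1 * g z ^ 2))
    (hp₁ : c.p₁ z.1 * α z.1 ^ 2 = τ * c'.p₁ (G z).1)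
    (hp₂ : c.p₂ z.1 * β z.1 ^ 2 = τ * c'.p₂ (G z).1)
    (hq₁ : c.q₁ z.1 * Complex.normSq (m z) = τ * c'.q₁ (G z).1)
    (hq₂ : c.q₂ z.1 * L z.1 = τ * c'.q₂ (G z).1)
    (hr₁ : c.r₁ z.1 * β z.1 ^ 2 = α z.1 ^ 2 * c'.r₁ (G z).1)
    (hr₂ : c.r₂ z.1 * Complex.normSq (m z) * β z.1 ^ 2 = L z.1 * α z.1 ^ 2 * c'.r₂ (G z).1)
    (hHH : pd ex (pd ex H) z + c.r₁ z.1 * pd ey (pd ey H) z = 0) :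
    sys₁ c (fun y => m y * a (G y)) (fun y => L y.1 * b (G y) + H y) z
        = τ * m z * sys₁ c' a b (G z) ∧
      sys₂ c (fun y => m y * a (G y)) (fun y => L y.1 * b (G y) + H y) z
        = L z.1 * α z.1 ^ 2 * sys₂ c' a b (G z) := by
  have hu : ContDiffAt ℝ 2 (fun y => a (G y)) z := ha.comp z hG
  have hbG : ContDiffAt ℝ 2 (fun y => b (G y)) z := hb.comp z hG
  obtain ⟨ux, uxx⟩ := pd_comp_of_smul rfl ha hG hGx hα
  obtain ⟨uy, uyy⟩ := pd_comp_of_smul rfl ha hG hGy hβ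
  obtain ⟨mx, mxx⟩ := pd_phase_mul hm hu hf hmx
  obtain ⟨my, myy⟩ := pd_phase_mul hm hu hg hmy
  have da : DifferentiableAt ℝ a (G z) := ha.differentiableAt (by norm_num)
  have dG : DifferentiableAt ℝ G z := hG.differentiableAt (by norm_num)
  have ut : pd et (fun y => a (G y)) z = τ * pd et a (G z) + Xt * pd ex a (G z)
      + Yt * pd ey a (G z) := by
    rw [pd_comp da dG, hGt]
    have : ((τ, Xt, Yt) : Base) = τ • et + Xt • ex + Yt • ey := by simp [et, ex, ey]
    rw [this]
    simp only [map_add, map_smul, Complex.real_smul]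
    rfl
  have mt : pd et (fun y => m y * a (G y)) z = (r + Complex.I * ν) * m z * a (G z)
      + m z * (τ * pd et a (G z) + Xt * pd ex a (G z) + Yt * pd ey a (G z)) := by
    rw [pd_mul (g := fun y => a (G y)) (hm.differentiableAt (by norm_num)) (da.comp z dG), hmt, ut]
  have hw : ∀ (v : Base) (γ : ℝ → ℝ), v.1 = 0 → DifferentiableAt ℝ γ z.1 →
      (∀ᶠ y in nhds z, pd v G y = γ y.1 • v) →
      pd v (pd v fun y => L y.1 * b (G y) + H y) z
        = L z.1 * (γ z.1 ^ 2 * pd v (pd v b) (G z)) + pd v (pd v H) z := by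
    intro v γ hv hγ hGv
    obtain ⟨bx, bxx⟩ := pd_comp_of_smul hv hb hG hGv hγ
    have hLb : ContDiffAt ℝ 2 (fun y : Base => L y.1) z :=
      ContDiffAt.comp (g := L) z hL contDiffAt_fst
    have hd : ∀ {φ : Base → ℝ}, ContDiffAt ℝ 2 φ z → DifferentiableAt ℝ φ z := fun h =>
      h.differentiableAt (by norm_num)
    have h1 : (pd v fun y => L y.1 * b (G y) + H y) =ᶠ[nhds z]
        fun y => L y.1 * pd v (fun y => b (G y)) y + pd v H y := by
      filter_upwards [hLb.eventually (by simp), hbG.eventually (by simp), hH.eventually (by simp),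
        (ContDiffAt.eventually hL (by simp)).filter_mono
          (continuous_fst.tendsto (X := ℝ × ℝ × ℝ) z) |> Filter.eventually_map.1]
        with y h1 h2 h3 h4
      have h1' := h1.differentiableAt (n := 2) (by norm_num)
      have h2' := h2.differentiableAt (n := 2) (by norm_num)
      rw [pd_add (h1'.fun_mul h2') (h3.differentiableAt (by norm_num)), pd_mul h1' h2',
        pd_time (h4.differentiableAt (by norm_num)), hv]
      simp
    have d2 : DifferentiableAt ℝ (pd v fun y => b (G y)) z :=
      (ContDiffAt.pd (m := 1) hbG (by norm_num) v).differentiableAt (by norm_num)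
    have d3 : DifferentiableAt ℝ (pd v H) z :=
      (ContDiffAt.pd (m := 1) hH (by norm_num) v).differentiableAt (by norm_num)
    rw [pd_congr h1, pd_add ((hd hLb).fun_mul d2) d3, pd_mul (hd hLb) d2,
      pd_time (hL.differentiableAt (by norm_num)), hv, bxx]
    simp
  have wxx := hw ex α rfl hα hGx
  have wyy := hw ey β rfl hβ hGy
  rw [ux.self_of_nhds] at mx mxx
  rw [uy.self_of_nhds] at my myy
  rw [uxx] at mxx
  rw [uyy] at myy
  simp only [Complex.real_smul] at mx mxx my myy
  constructor
  · unfold sys₁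
    rw [mt, mxx, myy]
    have hfX' : (2 * c.p₁ z.1 * α z.1 * f z : ℂ) = -Xt := by exact_mod_cast hfX
    have hgY' : (2 * c.p₂ z.1 * β z.1 * g z : ℂ) = -Yt := by exact_mod_cast hgY
    have hr' : (r : ℂ) = -(c.p₁ z.1 * pd ex f z + c.p₂ z.1 * pd ey g z) := by exact_mod_cast hr
    have hν' : (c.q₂ z.1 * H z : ℂ) = -(ν + c.p₁ z.1 * f z ^ 2 + c.p₂ z.1 * g z ^ 2) := by
      exact_mod_cast hν
    have hp₁' : (c.p₁ z.1 * α z.1 ^ 2 : ℂ) = τ * c'.p₁ (G z).1 := by exact_mod_cast hp₁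
    have hp₂' : (c.p₂ z.1 * β z.1 ^ 2 : ℂ) = τ * c'.p₂ (G z).1 := by exact_mod_cast hp₂
    have hq₁' : (c.q₁ z.1 * Complex.normSq (m z) : ℂ) = τ * c'.q₁ (G z).1 := by exact_mod_cast hq₁
    have hq₂' : (c.q₂ z.1 * L z.1 : ℂ) = τ * c'.q₂ (G z).1 := by exact_mod_cast hq₂
    simp only [Complex.normSq_mul]
    push_cast
    linear_combination (Complex.I * m z * pd ex a (G z)) * hfX' + (Complex.I * m z * pd ey a (G z)) * hgY'
      + (Complex.I * m z * a (G z)) * hr' - (m z * a (G z)) * hν'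
      + (m z * pd ex (pd ex a) (G z)) * hp₁' + (m z * pd ey (pd ey a) (G z)) * hp₂'
      - (Complex.normSq (a (G z)) * m z * a (G z)) * hq₁' - (m z * a (G z) * b (G z)) * hq₂'
      + (ν * m z * a (G z)) * Complex.I_sq
  · unfold sys₂
    rw [my, myy, wxx, wyy]
    -- Half of (|ψ|²)_yy. The logarithmic derivative `I * g` of `m` in y is imaginary, so |m| does
    -- not vary with y and all terms in `g` cancel.
    have key : (starRingEnd ℂ (m z * a (G z)) * (m z * ((Complex.I * pd ey g z - g z ^ 2) * a (G z)
        + 2 * Complex.I * g z * (β z.1 * pd ey a (G z)) + (β z.1 ^ 2 : ℝ) * pd ey (pd ey a) (G z)))).re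
        + Complex.normSq (Complex.I * g z * m z * a (G z) + m z * (β z.1 * pd ey a (G z)))
        = Complex.normSq (m z) * β z.1 ^ 2 * ((starRingEnd ℂ (a (G z)) * pd ey (pd ey a) (G z)).re
          + Complex.normSq (pd ey a (G z))) := by
      simp [Complex.normSq_apply, sq]
      ring
    linear_combination hHH - (2 * c.r₂ z.1) * key + (L z.1 * pd ey (pd ey b) (G z)) * hr₁
      - (2 * ((starRingEnd ℂ (a (G z)) * pd ey (pd ey a) (G z)).re
          + Complex.normSq (pd ey a (G z)))) * hr₂

/-! ### Phase and shift as quadratic polynomials -/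

/-- Polynomials in `x`, `y` of degree two without mixed term, with coefficients depending on `t`. -/
def quad (A B C D E : ℝ → ℝ) (z : Base) : ℝ :=
  A z.1 * z.2.1 ^ 2 + B z.1 * z.2.2 ^ 2 + C z.1 * z.2.1 + D z.1 * z.2.2 + E z.1

section Quad

variable {A B C D E : ℝ → ℝ} {z : Base}

theorem contDiffAt_time {E : Type*} [NormedAddCommGroup E] [NormedSpace ℝ E] {φ : ℝ → E} {z : Base}
    {n : WithTop ℕ∞} (h : ContDiffAt ℝ n φ z.1) : ContDiffAt ℝ n (fun y : Base => φ y.1) z :=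
  ContDiffAt.comp (g := φ) z h contDiffAt_fst

theorem quad_contDiffAt {n : WithTop ℕ∞} (hA : ContDiffAt ℝ n A z.1) (hB : ContDiffAt ℝ n B z.1)
    (hC : ContDiffAt ℝ n C z.1) (hD : ContDiffAt ℝ n D z.1) (hE : ContDiffAt ℝ n E z.1) :
    ContDiffAt ℝ n (quad A B C D E) z := by
  have hx : ContDiffAt ℝ n (fun y : Base => y.2.1) z := contDiffAt_fst.comp z contDiffAt_snd
  have hy : ContDiffAt ℝ n (fun y : Base => y.2.2) z := contDiffAt_snd.comp z contDiffAt_snd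
  exact (((((contDiffAt_time hA).mul (hx.pow 2)).add ((contDiffAt_time hB).mul (hy.pow 2))).add
    ((contDiffAt_time hC).mul hx)).add ((contDiffAt_time hD).mul hy)).add (contDiffAt_time hE)

theorem quad_hasFDerivAt (hA : DifferentiableAt ℝ A z.1) (hB : DifferentiableAt ℝ B z.1)
    (hC : DifferentiableAt ℝ C z.1) (hD : DifferentiableAt ℝ D z.1)
    (hE : DifferentiableAt ℝ E z.1) (v : Base) :
    pd v (quad A B C D E) z
      = v.1 * quad (deriv A) (deriv B) (deriv C) (deriv D) (deriv E) z
        + v.2.1 * (2 * A z.1 * z.2.1 + C z.1) + v.2.2 * (2 * B z.1 * z.2.2 + D z.1) := by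
  have time : ∀ {φ : ℝ → ℝ}, DifferentiableAt ℝ φ z.1 → DifferentiableAt ℝ (fun y : Base => φ y.1) z :=
    fun h => DifferentiableAt.comp (g := _) z h differentiableAt_fst
  have hx : DifferentiableAt ℝ (fun y : Base => y.2.1) z := by fun_prop
  have hy : DifferentiableAt ℝ (fun y : Base => y.2.2) z := by fun_prop
  have ex : pd v (fun y : Base => y.2.1) z = v.2.1 :=
    (pd_clm ((ContinuousLinearMap.fst ℝ ℝ ℝ).comp (ContinuousLinearMap.snd ℝ ℝ (ℝ × ℝ)))
      (differentiableAt_id) v).trans (by simp [pd])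
  have ey : pd v (fun y : Base => y.2.2) z = v.2.2 :=
    (pd_clm ((ContinuousLinearMap.snd ℝ ℝ ℝ).comp (ContinuousLinearMap.snd ℝ ℝ (ℝ × ℝ)))
      (differentiableAt_id) v).trans (by simp [pd])
  have exx : pd v (fun y : Base => y.2.1 ^ 2) z = 2 * z.2.1 * v.2.1 := by
    simp only [sq]; rw [pd_mul hx hx, ex]; ring
  have eyy : pd v (fun y : Base => y.2.2 ^ 2) z = 2 * z.2.2 * v.2.2 := by
    simp only [sq]; rw [pd_mul hy hy, ey]; ring
  have h1 := (time hA).fun_mul (hx.fun_pow 2)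
  have h2 := (time hB).fun_mul (hy.fun_pow 2)
  have h3 := (time hC).fun_mul hx
  have h4 := (time hD).fun_mul hy
  unfold quad
  rw [pd_add (((h1.fun_add h2).fun_add h3).fun_add h4) (time hE), pd_add ((h1.fun_add h2).fun_add h3) h4,
    pd_add (h1.fun_add h2) h3, pd_add h1 h2, pd_mul (time hA) (hx.fun_pow 2),
    pd_mul (time hB) (hy.fun_pow 2), pd_mul (time hC) hx, pd_mul (time hD) hy, pd_time hA, pd_time hB,
    pd_time hC, pd_time hD, pd_time hE, ex, ey, exx, eyy]
  simp only [smul_eq_mul]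
  ring

end Quad

theorem slab_mem_nhds (I : Opens ℝ) {z : Base} (hz : z.1 ∈ I) : ∀ᶠ y in nhds z, y.1 ∈ I :=
  continuous_fst.continuousAt.eventually (I.isOpen.mem_nhds hz)

/-- The quadratic `x`-coefficient of the phase and its analogue for `y`. -/
noncomputable def phaseCoeff (p α : ℝ → ℝ) (t : ℝ) : ℝ := -(deriv α t / (4 * p t * α t))

/-- The linear coefficients of the phase. -/
noncomputable def phaseLin (p α α₀ : ℝ → ℝ) (t : ℝ) : ℝ := -(deriv α₀ t / (2 * p t * α t))

theorem phase_eq_quad (c : Coeffs) (α β α₀ β₀ θ₀ : ℝ → ℝ) (z : Base) :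
    phase c α β α₀ β₀ θ₀ z.1 z.2.1 z.2.2 = quad (phaseCoeff c.p₁ α) (phaseCoeff c.p₂ β)
      (phaseLin c.p₁ α α₀) (phaseLin c.p₂ β β₀) θ₀ z := by
  simp only [phase, quad, phaseCoeff, phaseLin]; ring

/-- The conditions under which an equivalence transformation turns the system with
coefficients `c` into the one with coefficients `c'`. -/
structure Admissible (c c' : Coeffs) (I : Opens ℝ) (T α β L : ℝ → ℝ) : Prop where
  smooth_T : ContDiffOn ℝ ∞ T I
  smooth_α : ContDiffOn ℝ ∞ α I
  smooth_β : ContDiffOn ℝ ∞ β I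
  smooth_L : ContDiffOn ℝ ∞ L I
  deriv_T_ne_zero : ∀ t ∈ I, deriv T t ≠ 0
  α_pos : ∀ t ∈ I, 0 < α t
  β_pos : ∀ t ∈ I, 0 < β t
  L_ne_zero : ∀ t ∈ I, L t ≠ 0
  p₁ : ∀ t ∈ I, c.p₁ t * α t ^ 2 = deriv T t * c'.p₁ (T t)
  p₂ : ∀ t ∈ I, c.p₂ t * β t ^ 2 = deriv T t * c'.p₂ (T t)
  q₁ : ∀ t ∈ I, c.q₁ t * (α t * β t) = deriv T t * c'.q₁ (T t)
  q₂ : ∀ t ∈ I, c.q₂ t * L t = deriv T t * c'.q₂ (T t)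
  r₁ : ∀ t ∈ I, c.r₁ t * β t ^ 2 = α t ^ 2 * c'.r₁ (T t)
  r₂ : ∀ t ∈ I, c.r₂ t * (α t * β t) * β t ^ 2 = L t * α t ^ 2 * c'.r₂ (T t)
  -- Up to the factor -2/q₂ this is H_xx + r₁ H_yy.
  wave : ∀ t ∈ I, (deriv (phaseCoeff c.p₁ α) t + 4 * c.p₁ t * phaseCoeff c.p₁ α t ^ 2)
    + c.r₁ t * (deriv (phaseCoeff c.p₂ β) t + 4 * c.p₂ t * phaseCoeff c.p₂ β t ^ 2) = 0

section Smoothness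

variable {I : Opens ℝ} {t : ℝ}

theorem contDiffAt_of_mem {E : Type*} [NormedAddCommGroup E] [NormedSpace ℝ E] {φ : ℝ → E}
    (h : ContDiffOn ℝ ∞ φ I) (ht : t ∈ I) : ContDiffAt ℝ ∞ φ t :=
  (h t ht).contDiffAt (I.isOpen.mem_nhds ht)

theorem contDiffAt_deriv_of_mem {φ : ℝ → ℝ}
    (h : ContDiffOn ℝ ∞ φ I) (ht : t ∈ I) : ContDiffAt ℝ ∞ (deriv φ) t :=
  (h.deriv_of_isOpen I.isOpen (m := ∞) (by simp)).contDiffAt (I.isOpen.mem_nhds ht)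

theorem phaseCoeff_contDiffOn {p α : ℝ → ℝ} (hp : ContDiffOn ℝ ∞ p I) (hα : ContDiffOn ℝ ∞ α I)
    (hp0 : ∀ t ∈ I, p t ≠ 0) (hα0 : ∀ t ∈ I, α t ≠ 0) : ContDiffOn ℝ ∞ (phaseCoeff p α) I :=
  fun t ht => (((contDiffAt_deriv_of_mem hα ht).div ((contDiffAt_const.mul
    (contDiffAt_of_mem hp ht)).mul (contDiffAt_of_mem hα ht))
      (mul_ne_zero (mul_ne_zero (by norm_num) (hp0 t ht)) (hα0 t ht))).neg).contDiffWithinAt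

theorem phaseLin_contDiffOn {p α α₀ : ℝ → ℝ} (hp : ContDiffOn ℝ ∞ p I) (hα : ContDiffOn ℝ ∞ α I)
    (hα₀ : ContDiffOn ℝ ∞ α₀ I)
    (hp0 : ∀ t ∈ I, p t ≠ 0) (hα0 : ∀ t ∈ I, α t ≠ 0) : ContDiffOn ℝ ∞ (phaseLin p α α₀) I :=
  fun t ht => (((contDiffAt_deriv_of_mem hα₀ ht).div ((contDiffAt_const.mul
    (contDiffAt_of_mem hp ht)).mul (contDiffAt_of_mem hα ht))
      (mul_ne_zero (mul_ne_zero (by norm_num) (hp0 t ht)) (hα0 t ht))).neg).contDiffWithinAt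

end Smoothness

/-- The constant term of the shift, and its linear and quadratic coefficients, come from those of
the phase by squaring. -/
theorem shift_eq_quad {I : Opens ℝ} {c c' : Coeffs} (hc : c.SmoothNonzeroOn I)
    {T α β L α₀ β₀ θ₀ : ℝ → ℝ} (h : Admissible c c' I T α β L)
    (hα₀ : ContDiffOn ℝ ∞ α₀ I) (hβ₀ : ContDiffOn ℝ ∞ β₀ I) (hθ₀ : ContDiffOn ℝ ∞ θ₀ I) {z : Base}
    (hz : z.1 ∈ I) :
    shift c α β α₀ β₀ θ₀ z.1 z.2.1 z.2.2 = quad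
      (fun t => -(deriv (phaseCoeff c.p₁ α) t + 4 * c.p₁ t * phaseCoeff c.p₁ α t ^ 2) / c.q₂ t)
      (fun t => -(deriv (phaseCoeff c.p₂ β) t + 4 * c.p₂ t * phaseCoeff c.p₂ β t ^ 2) / c.q₂ t)
      (fun t => -(deriv (phaseLin c.p₁ α α₀) t
        + 4 * c.p₁ t * phaseCoeff c.p₁ α t * phaseLin c.p₁ α α₀ t) / c.q₂ t)
      (fun t => -(deriv (phaseLin c.p₂ β β₀) t
        + 4 * c.p₂ t * phaseCoeff c.p₂ β t * phaseLin c.p₂ β β₀ t) / c.q₂ t)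
      (fun t => -(deriv θ₀ t + c.p₁ t * phaseLin c.p₁ α α₀ t ^ 2
        + c.p₂ t * phaseLin c.p₂ β β₀ t ^ 2) / c.q₂ t) z := by
  obtain ⟨t, x, y⟩ := z
  change t ∈ I at hz
  have hα0 : ∀ t ∈ I, α t ≠ 0 := fun t ht => (h.α_pos t ht).ne'
  have hβ0 : ∀ t ∈ I, β t ≠ 0 := fun t ht => (h.β_pos t ht).ne'
  have hp1 : ∀ t ∈ I, c.p₁ t ≠ 0 := fun t ht => (hc.ne_zero t ht).1
  have hp2 : ∀ t ∈ I, c.p₂ t ≠ 0 := fun t ht => (hc.ne_zero t ht).2.1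
  have diff : ∀ {φ : ℝ → ℝ}, ContDiffOn ℝ ∞ φ I → HasDerivAt φ (deriv φ t) t := fun hφ =>
    ((contDiffAt_of_mem hφ hz).differentiableAt (by simp)).hasDerivAt
  have hA := diff (phaseCoeff_contDiffOn hc.smooth_p₁ h.smooth_α hp1 hα0)
  have hB := diff (phaseCoeff_contDiffOn hc.smooth_p₂ h.smooth_β hp2 hβ0)
  have hC := diff (phaseLin_contDiffOn hc.smooth_p₁ h.smooth_α hα₀ hp1 hα0)
  have hD := diff (phaseLin_contDiffOn hc.smooth_p₂ h.smooth_β hβ₀ hp2 hβ0)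
  have hE := diff hθ₀
  have e : ∀ t x y, phase c α β α₀ β₀ θ₀ t x y = phaseCoeff c.p₁ α t * x ^ 2
      + phaseCoeff c.p₂ β t * y ^ 2 + phaseLin c.p₁ α α₀ t * x + phaseLin c.p₂ β β₀ t * y + θ₀ t :=
    fun t x y => phase_eq_quad c α β α₀ β₀ θ₀ (t, x, y)
  have dt := ((((hA.mul_const (x ^ 2)).add (hB.mul_const (y ^ 2))).add (hC.mul_const x)).add
    (hD.mul_const y)).add hE
  have dx : deriv (fun s => phase c α β α₀ β₀ θ₀ t s y) x
      = 2 * phaseCoeff c.p₁ α t * x + phaseLin c.p₁ α α₀ t := by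
    simp only [e]
    have := ((((((hasDerivAt_id x).pow 2).const_mul (phaseCoeff c.p₁ α t)).add_const
      (phaseCoeff c.p₂ β t * y ^ 2)).add ((hasDerivAt_id x).const_mul
      (phaseLin c.p₁ α α₀ t))).add_const (phaseLin c.p₂ β β₀ t * y)).add_const (θ₀ t)
    refine this.deriv.trans ?_
    simp; ring
  have dy : deriv (fun s => phase c α β α₀ β₀ θ₀ t x s) y
      = 2 * phaseCoeff c.p₂ β t * y + phaseLin c.p₂ β β₀ t := by
    simp only [e]
    have := ((((((hasDerivAt_id y).pow 2).const_mul (phaseCoeff c.p₂ β t)).const_add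
      (phaseCoeff c.p₁ α t * x ^ 2)).add_const (phaseLin c.p₁ α α₀ t * x)).add ((hasDerivAt_id y).const_mul
      (phaseLin c.p₂ β β₀ t))).add_const (θ₀ t)
    refine this.deriv.trans ?_
    simp; ring
  have dt' : deriv (fun s => phase c α β α₀ β₀ θ₀ s x y) t = deriv (phaseCoeff c.p₁ α) t * x ^ 2
      + deriv (phaseCoeff c.p₂ β) t * y ^ 2 + deriv (phaseLin c.p₁ α α₀) t * x
      + deriv (phaseLin c.p₂ β β₀) t * y + deriv θ₀ t := by
    simp only [e]
    exact dt.deriv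
  simp only [shift]
  rw [dx, dy, dt']
  have := (hc.ne_zero t hz).2.2.2.1
  simp only [quad]
  field_simp
  ring

/-! ### Equivalence transformations: smoothness and effect on the equations -/

section Transformation

variable {I : Opens ℝ} {c c' : Coeffs} {T α β L α₀ β₀ θ₀ : ℝ → ℝ} {z : Base}

/-- The factor of `ψ̃` in an equivalence transformation. -/
noncomputable def amplitude (c : Coeffs) (α β α₀ β₀ θ₀ : ℝ → ℝ) (z : Base) : ℂ :=
  (Real.sqrt (α z.1 * β z.1) : ℂ)
    * Complex.exp (Complex.I * (phase c α β α₀ β₀ θ₀ z.1 z.2.1 z.2.2 : ℂ))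

theorem phase_contDiffAt (hc : c.SmoothNonzeroOn I) (h : Admissible c c' I T α β L)
    (hα₀ : ContDiffOn ℝ ∞ α₀ I) (hβ₀ : ContDiffOn ℝ ∞ β₀ I) (hθ₀ : ContDiffOn ℝ ∞ θ₀ I)
    (hz : z.1 ∈ I) :
    ContDiffAt ℝ ∞ (fun y : Base => phase c α β α₀ β₀ θ₀ y.1 y.2.1 y.2.2) z := by
  simp only [phase_eq_quad]
  have hα0 : ∀ t ∈ I, α t ≠ 0 := fun t ht => (h.α_pos t ht).ne'
  have hβ0 : ∀ t ∈ I, β t ≠ 0 := fun t ht => (h.β_pos t ht).ne'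
  have hp1 : ∀ t ∈ I, c.p₁ t ≠ 0 := fun t ht => (hc.ne_zero t ht).1
  have hp2 : ∀ t ∈ I, c.p₂ t ≠ 0 := fun t ht => (hc.ne_zero t ht).2.1
  exact quad_contDiffAt
    (contDiffAt_of_mem (phaseCoeff_contDiffOn hc.smooth_p₁ h.smooth_α hp1 hα0) hz)
    (contDiffAt_of_mem (phaseCoeff_contDiffOn hc.smooth_p₂ h.smooth_β hp2 hβ0) hz)
    (contDiffAt_of_mem (phaseLin_contDiffOn hc.smooth_p₁ h.smooth_α hα₀ hp1 hα0) hz)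
    (contDiffAt_of_mem (phaseLin_contDiffOn hc.smooth_p₂ h.smooth_β hβ₀ hp2 hβ0) hz)
    (contDiffAt_of_mem hθ₀ hz)

/-- Hides the explicit coefficients of the shift: later arguments use only their smoothness and the
relation between the coefficients of x² and y², which is `Admissible.wave` divided by -q₂. -/
theorem exists_shift_eq_quad (hc : c.SmoothNonzeroOn I) (h : Admissible c c' I T α β L)
    (hα₀ : ContDiffOn ℝ ∞ α₀ I) (hβ₀ : ContDiffOn ℝ ∞ β₀ I) (hθ₀ : ContDiffOn ℝ ∞ θ₀ I) :
    ∃ A B C D E : ℝ → ℝ, ContDiffOn ℝ ∞ A I ∧ ContDiffOn ℝ ∞ B I ∧ ContDiffOn ℝ ∞ C I ∧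
      ContDiffOn ℝ ∞ D I ∧ ContDiffOn ℝ ∞ E I ∧ (∀ t ∈ I, A t + c.r₁ t * B t = 0) ∧
      ∀ z : Base, z.1 ∈ I → shift c α β α₀ β₀ θ₀ z.1 z.2.1 z.2.2 = quad A B C D E z := by
  have hα0 : ∀ t ∈ I, α t ≠ 0 := fun t ht => (h.α_pos t ht).ne'
  have hβ0 : ∀ t ∈ I, β t ≠ 0 := fun t ht => (h.β_pos t ht).ne'
  have hp1 : ∀ t ∈ I, c.p₁ t ≠ 0 := fun t ht => (hc.ne_zero t ht).1
  have hp2 : ∀ t ∈ I, c.p₂ t ≠ 0 := fun t ht => (hc.ne_zero t ht).2.1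
  have hA := phaseCoeff_contDiffOn hc.smooth_p₁ h.smooth_α hp1 hα0
  have hB := phaseCoeff_contDiffOn hc.smooth_p₂ h.smooth_β hp2 hβ0
  have hC := phaseLin_contDiffOn hc.smooth_p₁ h.smooth_α hα₀ hp1 hα0
  have hD := phaseLin_contDiffOn hc.smooth_p₂ h.smooth_β hβ₀ hp2 hβ0
  have q0 : ∀ t ∈ I, c.q₂ t ≠ 0 := fun t ht => (hc.ne_zero t ht).2.2.2.1
  have d : ∀ {φ : ℝ → ℝ}, ContDiffOn ℝ ∞ φ I → ContDiffOn ℝ ∞ (deriv φ) I := fun hφ =>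
    hφ.deriv_of_isOpen I.isOpen (m := ∞) (by simp)
  refine ⟨_, _, _, _, _,
    (((d hA).add ((contDiffOn_const.mul hc.smooth_p₁).mul (hA.pow 2))).neg.div hc.smooth_q₂ q0),
    (((d hB).add ((contDiffOn_const.mul hc.smooth_p₂).mul (hB.pow 2))).neg.div hc.smooth_q₂ q0),
    (((d hC).add (((contDiffOn_const.mul hc.smooth_p₁).mul hA).mul hC)).neg.div hc.smooth_q₂ q0),
    (((d hD).add (((contDiffOn_const.mul hc.smooth_p₂).mul hB).mul hD)).neg.div hc.smooth_q₂ q0),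
    ((((d hθ₀).add (hc.smooth_p₁.mul (hC.pow 2))).add (hc.smooth_p₂.mul (hD.pow 2))).neg.div
      hc.smooth_q₂ q0), ?_, fun z hz => shift_eq_quad hc h hα₀ hβ₀ hθ₀ hz⟩
  intro t ht
  have := h.wave t ht
  have hq := q0 t ht
  simp only [Pi.div_apply]
  field_simp
  linear_combination -this

theorem shift_contDiffAt (hc : c.SmoothNonzeroOn I) (h : Admissible c c' I T α β L)
    (hα₀ : ContDiffOn ℝ ∞ α₀ I) (hβ₀ : ContDiffOn ℝ ∞ β₀ I) (hθ₀ : ContDiffOn ℝ ∞ θ₀ I)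
    (hz : z.1 ∈ I) :
    ContDiffAt ℝ ∞ (fun y : Base => shift c α β α₀ β₀ θ₀ y.1 y.2.1 y.2.2) z := by
  obtain ⟨A, B, C, D, E, hA, hB, hC, hD, hE, -, e⟩ := exists_shift_eq_quad hc h hα₀ hβ₀ hθ₀
  exact ContDiffAt.congr_of_eventuallyEq (quad_contDiffAt (contDiffAt_of_mem hA hz)
    (contDiffAt_of_mem hB hz) (contDiffAt_of_mem hC hz) (contDiffAt_of_mem hD hz)
    (contDiffAt_of_mem hE hz)) ((slab_mem_nhds I hz).mono e)

theorem shift_wave (hc : c.SmoothNonzeroOn I) (h : Admissible c c' I T α β L)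
    (hα₀ : ContDiffOn ℝ ∞ α₀ I) (hβ₀ : ContDiffOn ℝ ∞ β₀ I) (hθ₀ : ContDiffOn ℝ ∞ θ₀ I)
    (hz : z.1 ∈ I) :
    pd ex (pd ex fun y : Base => shift c α β α₀ β₀ θ₀ y.1 y.2.1 y.2.2) z
      + c.r₁ z.1 * pd ey (pd ey fun y : Base => shift c α β α₀ β₀ θ₀ y.1 y.2.1 y.2.2) z = 0 := by
  obtain ⟨A, B, C, D, E, hA, hB, hC, hD, hE, hAB, e⟩ := exists_shift_eq_quad hc h hα₀ hβ₀ hθ₀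
  have e' := (slab_mem_nhds I hz).mono e
  have diff : ∀ {φ : ℝ → ℝ}, ContDiffOn ℝ ∞ φ I → ∀ {t}, t ∈ I → DifferentiableAt ℝ φ t :=
    fun hφ t ht => (contDiffAt_of_mem hφ ht).differentiableAt (by simp)
  have zero : DifferentiableAt ℝ (fun _ : ℝ => (0 : ℝ)) z.1 := differentiableAt_const _
  have e1 : pd ex (quad A B C D E) =ᶠ[nhds z]
      quad (fun _ => 0) (fun _ => 0) (fun t => 2 * A t) (fun _ => 0) C :=
    (slab_mem_nhds I hz).mono fun y hy => by
      rw [quad_hasFDerivAt (diff hA hy) (diff hB hy) (diff hC hy) (diff hD hy) (diff hE hy)]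
      simp [quad, ex]
  have e2 : pd ey (quad A B C D E) =ᶠ[nhds z]
      quad (fun _ => 0) (fun _ => 0) (fun _ => 0) (fun t => 2 * B t) D :=
    (slab_mem_nhds I hz).mono fun y hy => by
      rw [quad_hasFDerivAt (diff hA hy) (diff hB hy) (diff hC hy) (diff hD hy) (diff hE hy)]
      simp [quad, ey]
  rw [pd_congr ((pd_congr_eventually e' ex).trans e1), pd_congr ((pd_congr_eventually e' ey).trans e2),
    quad_hasFDerivAt zero zero ((diff hA hz).const_mul 2) zero (diff hC hz),
    quad_hasFDerivAt zero zero zero ((diff hB hz).const_mul 2) (diff hD hz)]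
  have := hAB _ hz
  simp [ex, ey]
  linear_combination 2 * this

theorem base_contDiffAt (h : Admissible c c' I T α β L)
    (hα₀ : ContDiffOn ℝ ∞ α₀ I) (hβ₀ : ContDiffOn ℝ ∞ β₀ I) (hz : z.1 ∈ I) :
    ContDiffAt ℝ ∞ (equivTransformation c T α β L α₀ β₀ θ₀).base z := by
  have hx : ContDiffAt ℝ ∞ (fun y : Base => y.2.1) z := contDiffAt_fst.comp z contDiffAt_snd
  have hy : ContDiffAt ℝ ∞ (fun y : Base => y.2.2) z := contDiffAt_snd.comp z contDiffAt_snd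
  have tm : ∀ {φ : ℝ → ℝ}, ContDiffOn ℝ ∞ φ I → ContDiffAt ℝ ∞ (fun y : Base => φ y.1) z :=
    fun hφ => contDiffAt_time (contDiffAt_of_mem hφ hz)
  exact (tm h.smooth_T).prodMk ((((tm h.smooth_α).mul hx).add (tm hα₀)).prodMk
    (((tm h.smooth_β).mul hy).add (tm hβ₀)))

theorem pd_base (h : Admissible c c' I T α β L)
    (hα₀ : ContDiffOn ℝ ∞ α₀ I) (hβ₀ : ContDiffOn ℝ ∞ β₀ I) (hz : z.1 ∈ I) (v : Base) :
    pd v (equivTransformation c T α β L α₀ β₀ θ₀).base z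
      = (v.1 * deriv T z.1, v.1 * (deriv α z.1 * z.2.1 + deriv α₀ z.1) + α z.1 * v.2.1,
        v.1 * (deriv β z.1 * z.2.2 + deriv β₀ z.1) + β z.1 * v.2.2) := by
  have hd := (base_contDiffAt (θ₀ := θ₀) h hα₀ hβ₀ hz).differentiableAt (by simp)
  have diff : ∀ {φ : ℝ → ℝ}, ContDiffOn ℝ ∞ φ I → DifferentiableAt ℝ φ z.1 := fun hφ =>
    (contDiffAt_of_mem hφ hz).differentiableAt (by simp)
  have zero : DifferentiableAt ℝ (fun _ : ℝ => (0 : ℝ)) z.1 := differentiableAt_const _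
  have e1 : (pd v (equivTransformation c T α β L α₀ β₀ θ₀).base z).1 = v.1 * deriv T z.1 :=
    (pd_clm (ContinuousLinearMap.fst ℝ ℝ (ℝ × ℝ)) hd v).symm.trans (pd_time (diff h.smooth_T) v)
  have e2 : (pd v (equivTransformation c T α β L α₀ β₀ θ₀).base z).2.1
      = v.1 * (deriv α z.1 * z.2.1 + deriv α₀ z.1) + α z.1 * v.2.1 := by
    refine (pd_clm ((ContinuousLinearMap.fst ℝ ℝ ℝ).comp
      (ContinuousLinearMap.snd ℝ ℝ (ℝ × ℝ))) hd v).symm.trans ?_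
    have e : (fun y : Base => ((ContinuousLinearMap.fst ℝ ℝ ℝ).comp
      (ContinuousLinearMap.snd ℝ ℝ (ℝ × ℝ))) ((equivTransformation c T α β L α₀ β₀ θ₀).base y))
        = quad (fun _ => 0) (fun _ => 0) α (fun _ => 0) α₀ := by
      funext y; simp [quad, equivTransformation]
    rw [e, quad_hasFDerivAt zero zero (diff h.smooth_α) zero (diff hα₀)]
    simp [quad]; ring
  have e3 : (pd v (equivTransformation c T α β L α₀ β₀ θ₀).base z).2.2
      = v.1 * (deriv β z.1 * z.2.2 + deriv β₀ z.1) + β z.1 * v.2.2 := by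
    refine (pd_clm ((ContinuousLinearMap.snd ℝ ℝ ℝ).comp
      (ContinuousLinearMap.snd ℝ ℝ (ℝ × ℝ))) hd v).symm.trans ?_
    have e : (fun y : Base => ((ContinuousLinearMap.snd ℝ ℝ ℝ).comp
      (ContinuousLinearMap.snd ℝ ℝ (ℝ × ℝ))) ((equivTransformation c T α β L α₀ β₀ θ₀).base y))
        = quad (fun _ => 0) (fun _ => 0) (fun _ => 0) β β₀ := by
      funext y; simp [quad, equivTransformation]
    rw [e, quad_hasFDerivAt zero zero zero (diff h.smooth_β) (diff hβ₀)]
    simp [quad]; ring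
  exact Prod.ext e1 (Prod.ext e2 e3)

theorem amplitude_contDiffAt (hc : c.SmoothNonzeroOn I) (h : Admissible c c' I T α β L)
    (hα₀ : ContDiffOn ℝ ∞ α₀ I) (hβ₀ : ContDiffOn ℝ ∞ β₀ I) (hθ₀ : ContDiffOn ℝ ∞ θ₀ I)
    (hz : z.1 ∈ I) : ContDiffAt ℝ ∞ (amplitude c α β α₀ β₀ θ₀) z := by
  have h1 : ContDiffAt ℝ ∞ (fun t => Real.sqrt (α t * β t)) z.1 :=
    ((contDiffAt_of_mem h.smooth_α hz).mul (contDiffAt_of_mem h.smooth_β hz)).sqrt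
      (mul_pos (h.α_pos _ hz) (h.β_pos _ hz)).ne'
  exact (Complex.ofRealCLM.contDiff.contDiffAt.comp z (contDiffAt_time h1)).mul
    ((contDiffAt_const.mul (Complex.ofRealCLM.contDiff.contDiffAt.comp z
      (phase_contDiffAt hc h hα₀ hβ₀ hθ₀ hz))).cexp)

theorem amplitude_ne_zero (h : Admissible c c' I T α β L) (hz : z.1 ∈ I) :
    amplitude c α β α₀ β₀ θ₀ z ≠ 0 :=
  mul_ne_zero (by exact_mod_cast (Real.sqrt_pos.2 (mul_pos (h.α_pos _ hz) (h.β_pos _ hz))).ne')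
    (Complex.exp_ne_zero _)

theorem normSq_amplitude (h : Admissible c c' I T α β L) (hz : z.1 ∈ I) :
    Complex.normSq (amplitude c α β α₀ β₀ θ₀ z) = α z.1 * β z.1 := by
  have h1 : ‖Complex.exp (Complex.I * (phase c α β α₀ β₀ θ₀ z.1 z.2.1 z.2.2 : ℂ))‖ = 1 := by
    rw [mul_comm]; exact Complex.norm_exp_ofReal_mul_I _
  rw [Complex.normSq_eq_norm_sq, amplitude, norm_mul, h1, mul_one, Complex.norm_real, Real.norm_eq_abs,
    sq_abs, Real.sq_sqrt (mul_pos (h.α_pos _ hz) (h.β_pos _ hz)).le]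

theorem pd_amplitude (hc : c.SmoothNonzeroOn I) (h : Admissible c c' I T α β L)
    (hα₀ : ContDiffOn ℝ ∞ α₀ I) (hβ₀ : ContDiffOn ℝ ∞ β₀ I) (hθ₀ : ContDiffOn ℝ ∞ θ₀ I)
    (hz : z.1 ∈ I) (v : Base) :
    pd v (amplitude c α β α₀ β₀ θ₀) z
      = ((v.1 * ((deriv α z.1 / α z.1 + deriv β z.1 / β z.1) / 2) : ℝ) + Complex.I *
        pd v (fun y : Base => phase c α β α₀ β₀ θ₀ y.1 y.2.1 y.2.2) z)
          * amplitude c α β α₀ β₀ θ₀ z := by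
  have hα := (contDiffAt_of_mem h.smooth_α hz).differentiableAt (by simp)
  have hβ := (contDiffAt_of_mem h.smooth_β hz).differentiableAt (by simp)
  have hpos := mul_pos (h.α_pos _ hz) (h.β_pos _ hz)
  have h1 : HasDerivAt (fun t => Real.sqrt (α t * β t)) _ z.1 :=
    (hα.hasDerivAt.mul hβ.hasDerivAt).sqrt hpos.ne'
  have h1' : HasDerivAt (fun t => (Real.sqrt (α t * β t) : ℂ)) _ z.1 := h1.ofReal_comp
  have hph := (phase_contDiffAt hc h hα₀ hβ₀ hθ₀ hz).differentiableAt (by simp)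
  have h2 : HasFDerivAt (fun y : Base => Complex.exp
      (Complex.I * (phase c α β α₀ β₀ θ₀ y.1 y.2.1 y.2.2 : ℂ))) _ z :=
    ((Complex.ofRealCLM.hasFDerivAt.comp z hph.hasFDerivAt).const_mul Complex.I).cexp
  have h3 : DifferentiableAt ℝ (fun y : Base => (Real.sqrt (α y.1 * β y.1) : ℂ)) z :=
    DifferentiableAt.comp (g := fun t => (Real.sqrt (α t * β t) : ℂ)) z h1'.differentiableAt
      differentiableAt_fst
  have e2 : pd v (fun y : Base => Complex.exp
      (Complex.I * (phase c α β α₀ β₀ θ₀ y.1 y.2.1 y.2.2 : ℂ))) z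
      = Complex.exp (Complex.I * (phase c α β α₀ β₀ θ₀ z.1 z.2.1 z.2.2 : ℂ)) * (Complex.I *
        pd v (fun y : Base => phase c α β α₀ β₀ θ₀ y.1 y.2.1 y.2.2) z) := by
    refine (congrArg (fun A => A v) h2.fderiv).trans ?_
    simp [pd]
  unfold amplitude
  rw [pd_mul h3 h2.differentiableAt, pd_time h1'.differentiableAt, h1'.deriv, e2]
  have hs : Real.sqrt (α z.1 * β z.1) ≠ 0 := (Real.sqrt_pos.2 hpos).ne'
  -- The logarithmic derivative of (αβ)^(1/2) is half the sum of those of α and β.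
  have key : (deriv α z.1 * β z.1 + α z.1 * deriv β z.1) / (2 * Real.sqrt (α z.1 * β z.1))
      = (deriv α z.1 / α z.1 + deriv β z.1 / β z.1) / 2 * Real.sqrt (α z.1 * β z.1) := by
    rw [div_eq_iff (by positivity)]
    have := Real.mul_self_sqrt hpos.le
    have ha := (h.α_pos _ hz).ne'
    have hb := (h.β_pos _ hz).ne'
    calc _ = (deriv α z.1 / α z.1 + deriv β z.1 / β z.1) * (α z.1 * β z.1) := by field_simp
      _ = _ := by linear_combination (-(deriv α z.1 / α z.1 + deriv β z.1 / β z.1)) * this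
  simp only [Pi.mul_apply]
  rw [key]
  simp only [Complex.real_smul]
  push_cast
  ring

theorem pull_equivTransformation (F : Base → Fib) (y : Base) :
    (equivTransformation c T α β L α₀ β₀ θ₀).pull F y
      = (amplitude c α β α₀ β₀ θ₀ y * (F ((equivTransformation c T α β L α₀ β₀ θ₀).base y)).1,
        L y.1 * (F ((equivTransformation c T α β L α₀ β₀ θ₀).base y)).2
          + shift c α β α₀ β₀ θ₀ y.1 y.2.1 y.2.2) := rfl

theorem contDiffAt_pull (hc : c.SmoothNonzeroOn I) (h : Admissible c c' I T α β L)
    (hα₀ : ContDiffOn ℝ ∞ α₀ I) (hβ₀ : ContDiffOn ℝ ∞ β₀ I) (hθ₀ : ContDiffOn ℝ ∞ θ₀ I)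
    (hz : z.1 ∈ I) {F : Base → Fib} {n : ℕ∞}
    (hF : ContDiffAt ℝ n F ((equivTransformation c T α β L α₀ β₀ θ₀).base z)) :
    ContDiffAt ℝ n ((equivTransformation c T α β L α₀ β₀ θ₀).pull F) z := by
  have hn : (n : WithTop ℕ∞) ≤ ∞ := WithTop.coe_le_coe.2 le_top
  have hG := (base_contDiffAt (θ₀ := θ₀) h hα₀ hβ₀ hz).of_le hn
  have hFG := hF.comp z hG
  exact (((amplitude_contDiffAt hc h hα₀ hβ₀ hθ₀ hz).of_le hn).mul hFG.fst).prodMk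
    (((contDiffAt_time ((contDiffAt_of_mem h.smooth_L hz).of_le hn)).mul hFG.snd).add
      ((shift_contDiffAt hc h hα₀ hβ₀ hθ₀ hz).of_le hn))

/-- The exact factors are recorded, and not only the equivalence of the two vanishing conditions,
because this identity is differentiated in `fderiv_Delta_prolong`. -/
theorem Delta_pull (hc : c.SmoothNonzeroOn I) (h : Admissible c c' I T α β L)
    (hα₀ : ContDiffOn ℝ ∞ α₀ I) (hβ₀ : ContDiffOn ℝ ∞ β₀ I) (hθ₀ : ContDiffOn ℝ ∞ θ₀ I)
    (hz : z.1 ∈ I) {F : Base → Fib}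
    (hF : ContDiffAt ℝ 2 F ((equivTransformation c T α β L α₀ β₀ θ₀).base z)) :
    Delta c (jet ((equivTransformation c T α β L α₀ β₀ θ₀).pull F) z)
      = (deriv T z.1 * amplitude c α β α₀ β₀ θ₀ z
          * (Delta c' (jet F ((equivTransformation c T α β L α₀ β₀ θ₀).base z))).1,
        L z.1 * α z.1 ^ 2
          * (Delta c' (jet F ((equivTransformation c T α β L α₀ β₀ θ₀).base z))).2) := by
  have two : (2 : WithTop ℕ∞) ≤ ∞ := WithTop.coe_le_coe.2 (le_top : (2 : ℕ∞) ≤ ⊤)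
  rw [Delta_jet c (contDiffAt_pull hc h hα₀ hβ₀ hθ₀ hz (n := 2) hF), Delta_jet c' hF]
  simp only [pull_equivTransformation]
  set G := (equivTransformation c T α β L α₀ β₀ θ₀).base with hGdef
  have hα0 : ∀ t ∈ I, α t ≠ 0 := fun t ht => (h.α_pos t ht).ne'
  have hβ0 : ∀ t ∈ I, β t ≠ 0 := fun t ht => (h.β_pos t ht).ne'
  have hp1 : ∀ t ∈ I, c.p₁ t ≠ 0 := fun t ht => (hc.ne_zero t ht).1
  have hp2 : ∀ t ∈ I, c.p₂ t ≠ 0 := fun t ht => (hc.ne_zero t ht).2.1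
  have diff : ∀ {φ : ℝ → ℝ}, ContDiffOn ℝ ∞ φ I → ∀ {t}, t ∈ I → DifferentiableAt ℝ φ t :=
    fun hφ t ht => (contDiffAt_of_mem hφ ht).differentiableAt (by simp)
  have hA := phaseCoeff_contDiffOn hc.smooth_p₁ h.smooth_α hp1 hα0
  have hB := phaseCoeff_contDiffOn hc.smooth_p₂ h.smooth_β hp2 hβ0
  have hC := phaseLin_contDiffOn hc.smooth_p₁ h.smooth_α hα₀ hp1 hα0
  have hD := phaseLin_contDiffOn hc.smooth_p₂ h.smooth_β hβ₀ hp2 hβ0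
  have hPh : ∀ {y : Base}, y.1 ∈ I → ∀ v : Base,
      pd v (fun y : Base => phase c α β α₀ β₀ θ₀ y.1 y.2.1 y.2.2) y = _ := fun {y} hy v => by
    simp only [phase_eq_quad]
    exact quad_hasFDerivAt (diff hA hy) (diff hB hy) (diff hC hy) (diff hD hy) (diff hθ₀ hy) v
  -- `f` and `g` are θ_x and θ_y. The terms 2 p₁ α θ_x = -x̃_t and 2 p₂ β θ_y = -ỹ_t explain the
  -- denominators in `phaseCoeff` and `phaseLin`.
  set f : Base → ℝ := quad (fun _ => 0) (fun _ => 0) (fun t => 2 * phaseCoeff c.p₁ α t) (fun _ => 0)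
    (phaseLin c.p₁ α α₀) with hf
  set g : Base → ℝ := quad (fun _ => 0) (fun _ => 0) (fun _ => 0) (fun t => 2 * phaseCoeff c.p₂ β t)
    (phaseLin c.p₂ β β₀) with hg
  have zero : ∀ t, DifferentiableAt ℝ (fun _ : ℝ => (0 : ℝ)) t := fun t => differentiableAt_const _
  have cz : ContDiffAt ℝ ∞ (fun _ : ℝ => (0 : ℝ)) z.1 := contDiffAt_const
  have dfx : pd ex f z = 2 * phaseCoeff c.p₁ α z.1 := by
    rw [hf, quad_hasFDerivAt (zero _) (zero _) ((diff hA hz).const_mul 2) (zero _) (diff hC hz)]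
    simp [ex]
  have dgy : pd ey g z = 2 * phaseCoeff c.p₂ β z.1 := by
    rw [hg, quad_hasFDerivAt (zero _) (zero _) (zero _) ((diff hB hz).const_mul 2) (diff hD hz)]
    simp [ey]
  have df : DifferentiableAt ℝ f z := (quad_contDiffAt cz cz (contDiffAt_const.mul
    (contDiffAt_of_mem hA hz)) cz (contDiffAt_of_mem hC hz)).differentiableAt (by simp)
  have dg : DifferentiableAt ℝ g z := (quad_contDiffAt cz cz cz (contDiffAt_const.mul
    (contDiffAt_of_mem hB hz)) (contDiffAt_of_mem hD hz)).differentiableAt (by simp)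
  have hin := slab_mem_nhds I hz
  have q0 : ∀ t ∈ I, c.q₂ t ≠ 0 := fun t ht => (hc.ne_zero t ht).2.2.2.1
  have hα' := hα0 _ hz
  have hβ' := hβ0 _ hz
  have hp1' := hp1 _ hz
  have hp2' := hp2 _ hz
  have s2 := sys_pull (c := c) (c' := c') (z := z) (G := G) (m := amplitude c α β α₀ β₀ θ₀) (L := L)
    (H := fun y => shift c α β α₀ β₀ θ₀ y.1 y.2.1 y.2.2) (α := α) (β := β) (f := f) (g := g)
    (τ := deriv T z.1) (Xt := deriv α z.1 * z.2.1 + deriv α₀ z.1)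
    (Yt := deriv β z.1 * z.2.2 + deriv β₀ z.1)
    (r := (deriv α z.1 / α z.1 + deriv β z.1 / β z.1) / 2)
    (ν := pd et (fun y : Base => phase c α β α₀ β₀ θ₀ y.1 y.2.1 y.2.2) z)
    (a := fun y => (F y).1) (b := fun y => (F y).2)
    hF.fst hF.snd ((base_contDiffAt h hα₀ hβ₀ hz).of_le two)
    ((amplitude_contDiffAt hc h hα₀ hβ₀ hθ₀ hz).of_le two)
    ((contDiffAt_of_mem h.smooth_L hz).of_le two) ((shift_contDiffAt hc h hα₀ hβ₀ hθ₀ hz).of_le two)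
    df dg (diff h.smooth_α hz) (diff h.smooth_β hz)
    (by rw [hGdef, pd_base h hα₀ hβ₀ hz]; simp [et])
    (hin.mono fun y hy => by rw [hGdef, pd_base h hα₀ hβ₀ hy]; simp [ex])
    (hin.mono fun y hy => by rw [hGdef, pd_base h hα₀ hβ₀ hy]; simp [ey])
    (by rw [pd_amplitude hc h hα₀ hβ₀ hθ₀ hz]; simp [et])
    (hin.mono fun y hy => by
      rw [pd_amplitude hc h hα₀ hβ₀ hθ₀ hy, hPh hy]; simp [ex, hf, quad])
    (hin.mono fun y hy => by
      rw [pd_amplitude hc h hα₀ hβ₀ hθ₀ hy, hPh hy]; simp [ey, hg, quad])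
    (by simp only [hf, quad, phaseCoeff, phaseLin]; field_simp; ring)
    (by simp only [hg, quad, phaseCoeff, phaseLin]; field_simp; ring)
    (by rw [dfx, dgy]; simp only [phaseCoeff]; field_simp; ring)
    (by
      rw [hPh hz, shift_eq_quad hc h hα₀ hβ₀ hθ₀ hz]
      have := q0 _ hz
      simp only [quad, et, hf, hg]
      field_simp
      ring)
    (h.p₁ _ hz) (h.p₂ _ hz) (by rw [normSq_amplitude h hz]; exact h.q₁ _ hz) (h.q₂ _ hz)
    (h.r₁ _ hz) (by rw [normSq_amplitude h hz]; exact h.r₂ _ hz)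
    (shift_wave hc h hα₀ hβ₀ hθ₀ hz)
  exact Prod.ext s2.1 s2.2

end Transformation

/-! ### Equivalence transformations: invertibility -/

section Transformation

variable {I : Opens ℝ} {c c' : Coeffs} {T α β L α₀ β₀ θ₀ : ℝ → ℝ}

/-- Rolle's theorem; on an interval no monotonicity is needed. -/
theorem injOn_of_deriv_ne_zero (hI : IsPreconnected (I : Set ℝ)) (hT : ContDiffOn ℝ ∞ T I)
    (h : ∀ t ∈ I, deriv T t ≠ 0) : InjOn T I := by
  have key : ∀ a ∈ I, ∀ b ∈ I, a < b → T a ≠ T b := by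
    intro a ha b hb hab e
    have hsub : Icc a b ⊆ I := hI.ordConnected.out ha hb
    obtain ⟨s, hs, hs0⟩ := exists_deriv_eq_zero hab (hT.continuousOn.mono hsub) e
    exact h s (hsub (Ioo_subset_Icc_self hs)) hs0
  intro a ha b hb e
  rcases lt_trichotomy a b with hab | hab | hab
  · exact absurd e (key a ha b hb hab)
  · exact hab
  · exact absurd e.symm (key b hb a ha hab)

theorem base_bijOn (hI : IsPreconnected (I : Set ℝ)) (h : Admissible c c' I T α β L) :
    BijOn (equivTransformation c T α β L α₀ β₀ θ₀).base (slab I) (slab (T '' I)) := by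
  refine ⟨fun z hz => ⟨z.1, hz, rfl⟩, ?_, ?_⟩
  · rintro ⟨t, x, y⟩ hz ⟨t', x', y'⟩ hz' e
    simp only [equivTransformation, Prod.mk.injEq] at e
    obtain ⟨e1, e2, e3⟩ := e
    obtain rfl := injOn_of_deriv_ne_zero hI h.smooth_T h.deriv_T_ne_zero hz hz' e1
    have ha := (h.α_pos _ hz).ne'
    have hb := (h.β_pos _ hz).ne'
    simp only at ha hb
    rw [mul_left_cancel₀ ha (add_right_cancel e2), mul_left_cancel₀ hb (add_right_cancel e3)]
  · rintro ⟨t, x, y⟩ ⟨s, hs, rfl⟩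
    have ha := (h.α_pos _ hs).ne'
    have hb := (h.β_pos _ hs).ne'
    refine ⟨(s, (x - α₀ s) / α s, (y - β₀ s) / β s), hs, ?_⟩
    simp only [equivTransformation, Prod.mk.injEq, true_and]
    constructor <;> field_simp <;> ring

theorem fderiv_base_bijective (h : Admissible c c' I T α β L)
    (hα₀ : ContDiffOn ℝ ∞ α₀ I) (hβ₀ : ContDiffOn ℝ ∞ β₀ I) {z : Base} (hz : z.1 ∈ I) :
    Function.Bijective (fderiv ℝ (equivTransformation c T α β L α₀ β₀ θ₀).base z) := by
  set D := fderiv ℝ (equivTransformation c T α β L α₀ β₀ θ₀).base z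
  have inj : Function.Injective (D : Base →ₗ[ℝ] Base) := by
    rw [← LinearMap.ker_eq_bot, LinearMap.ker_eq_bot']
    intro v hv
    have e : D v = _ := pd_base (θ₀ := θ₀) h hα₀ hβ₀ hz v
    have hv' : D v = 0 := hv
    rw [e] at hv'
    simp only [Prod.mk_eq_zero, mul_eq_zero, h.deriv_T_ne_zero _ hz, or_false] at hv'
    obtain ⟨h1, h2, h3⟩ := hv'
    rw [h1] at h2 h3
    simp only [zero_mul, zero_add, mul_eq_zero, (h.α_pos _ hz).ne', (h.β_pos _ hz).ne',
      false_or] at h2 h3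
    exact Prod.ext h1 (Prod.ext h2 h3)
  exact ⟨inj, LinearMap.injective_iff_surjective.1 inj⟩

theorem isLocallyInvertibleOn (hc : c.SmoothNonzeroOn I) (h : Admissible c c' I T α β L)
    (hα₀ : ContDiffOn ℝ ∞ α₀ I) (hβ₀ : ContDiffOn ℝ ∞ β₀ I) (hθ₀ : ContDiffOn ℝ ∞ θ₀ I) :
    (equivTransformation c T α β L α₀ β₀ θ₀).IsLocallyInvertibleOn (dom I) := by
  rintro ⟨z, a, b⟩ hz
  change z.1 ∈ I at hz
  have hm := amplitude_ne_zero (α₀ := α₀) (β₀ := β₀) (θ₀ := θ₀) h hz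
  refine ⟨base_contDiffAt h hα₀ hβ₀ hz, fderiv_base_bijective h hα₀ hβ₀ hz, ?_, ?_, ?_, ?_⟩
  · exact ((amplitude_contDiffAt hc h hα₀ hβ₀ hθ₀ hz).comp (z, a) contDiffAt_fst).mul contDiffAt_snd
  · have e : HasFDerivAt (fun a : ℂ => amplitude c α β α₀ β₀ θ₀ z * a)
        (amplitude c α β α₀ β₀ θ₀ z • ContinuousLinearMap.id ℝ ℂ) a :=
      (hasFDerivAt_id a).const_mul _
    change Function.Bijective (fderiv ℝ (fun a : ℂ => amplitude c α β α₀ β₀ θ₀ z * a) a)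
    rw [e.fderiv]
    refine ⟨fun u v huv => ?_, fun u => ⟨(amplitude c α β α₀ β₀ θ₀ z)⁻¹ * u, ?_⟩⟩
    · simpa [hm] using huv
    · simp [hm]
  · exact ((contDiffAt_time (contDiffAt_of_mem h.smooth_L hz)).comp (z, b)
      contDiffAt_fst).mul contDiffAt_snd |>.add
        ((shift_contDiffAt hc h hα₀ hβ₀ hθ₀ hz).comp (z, b) contDiffAt_fst)
  · have e : HasDerivAt (fun b : ℝ => L z.1 * b + shift c α β α₀ β₀ θ₀ z.1 z.2.1 z.2.2)
        (L z.1 * 1) b := ((hasDerivAt_id b).const_mul _).add_const _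
    change deriv (fun b : ℝ => L z.1 * b + shift c α β α₀ β₀ θ₀ z.1 z.2.1 z.2.2) b ≠ 0
    rw [e.deriv, mul_one]
    exact h.L_ne_zero _ hz

theorem transforms (hc : c.SmoothNonzeroOn I) (h : Admissible c c' I T α β L)
    (hα₀ : ContDiffOn ℝ ∞ α₀ I) (hβ₀ : ContDiffOn ℝ ∞ β₀ I) (hθ₀ : ContDiffOn ℝ ∞ θ₀ I) :
    (equivTransformation c T α β L α₀ β₀ θ₀).Transforms (dom I) c c' := by
  intro z F hF hz
  change z.1 ∈ I at hz
  rw [SolvesAt, SolvesAt, Delta_pull hc h hα₀ hβ₀ hθ₀ hz hF]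
  have h1 := amplitude_ne_zero (α₀ := α₀) (β₀ := β₀) (θ₀ := θ₀) h hz
  have h2 := h.deriv_T_ne_zero _ hz
  have h3 := h.L_ne_zero _ hz
  have h4 := (h.α_pos _ hz).ne'
  simp [Prod.ext_iff, h1, h2, h3, h4]

end Transformation

/-! ### Consequences of the tables -/

theorem pos_or_neg_of_ne_zero {s : Set ℝ} (hs : IsPreconnected s) {f : ℝ → ℝ}
    (hf : ContinuousOn f s) (h0 : ∀ t ∈ s, f t ≠ 0) :
    (∀ t ∈ s, 0 < f t) ∨ (∀ t ∈ s, f t < 0) := by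
  by_contra! hcon
  obtain ⟨⟨a, ha, ha'⟩, b, hb, hb'⟩ := hcon
  obtain ⟨t, ht, ht'⟩ := hs.intermediate_value ha hb hf ⟨ha', hb'⟩
  exact h0 t ht ht'

/-- Write Λ = k₀ P + k₁. For k₀ ≠ 0 the function q₁ = p₁/Λ is the derivative of Q = log|Λ|/k₀, so
that exp(k₀ Q) = |Λ|. For k₀ = 0 the function Λ is the constant k₁, Q = P/k₁, and all exponentials
are 1. -/
theorem Table2.table1 {I : Opens ℝ} {c : Coeffs} (hI : IsPreconnected (I : Set ℝ))
    (hne : (I : Set ℝ).Nonempty) (h : Table2 c I) : Table1 c I := by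
  obtain ⟨k₀, k₁, r₁₀, r₂₀, P, hP, h⟩ := h
  by_cases hk : k₀ = 0
  · subst hk
    have hk1 : k₁ ≠ 0 := by
      obtain ⟨t, ht⟩ := hne
      simpa using (h t ht).1
    refine ⟨0, k₁, r₁₀ / k₁ ^ 2, r₂₀ / k₁ ^ 2, fun t => P t / k₁, fun t ht => ?_, fun t ht => ?_⟩
    · have h' := (h t ht).2.2.1
      simp only [zero_mul, zero_add] at h'
      rw [h']
      exact (hP t ht).div_const k₁
    · obtain ⟨-, h2, h3, h4, h5⟩ := h t ht
      simp only [zero_mul, zero_add] at h2 h3 h4 h5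
      simp only [zero_mul, mul_zero, neg_zero, Real.exp_zero, mul_one]
      rw [h2, h3, h4, h5]
      refine ⟨by field_simp, by field_simp, rfl, by field_simp⟩
  · have hd : ∀ t ∈ I, HasDerivAt (fun t => k₀ * P t + k₁) (k₀ * c.p₁ t) t := fun t ht =>
      ((hP t ht).const_mul k₀).add_const k₁
    -- Λ has no zero on the interval, so its sign σ is constant. It becomes the constant k₁ of Table
    -- 1, since p₁ = q₁ Λ = σ q₁ exp(k₀ Q).
    obtain ⟨σ, hσ, hsgn⟩ : ∃ σ : ℝ, (σ = 1 ∨ σ = -1) ∧ ∀ t ∈ I, 0 < σ * (k₀ * P t + k₁) := by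
      rcases pos_or_neg_of_ne_zero hI (fun t ht => (hd t ht).continuousAt.continuousWithinAt)
        (fun t ht => (h t ht).1) with h' | h'
      · exact ⟨1, Or.inl rfl, fun t ht => by simpa using h' t ht⟩
      · exact ⟨-1, Or.inr rfl, fun t ht => by have := h' t ht; linarith⟩
    have hσ2 : σ * σ = 1 := by rcases hσ with rfl | rfl <;> norm_num
    refine ⟨k₀, σ, r₁₀, r₂₀, fun t => Real.log (σ * (k₀ * P t + k₁)) / k₀, fun t ht => ?_,
      fun t ht => ?_⟩
    · have h1 := (((hd t ht).const_mul σ).log (hsgn t ht).ne').div_const k₀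
      refine h1.congr_deriv ?_
      rw [(h t ht).2.2.1]
      have := (h t ht).1
      have : σ ≠ 0 := by rintro rfl; norm_num at hσ2
      field_simp
    · obtain ⟨h1, h2, h3, h4, h5⟩ := h t ht
      have e0 : k₀ * (Real.log (σ * (k₀ * P t + k₁)) / k₀) = Real.log (σ * (k₀ * P t + k₁)) := by
        field_simp
      have e1 : Real.exp (k₀ * (Real.log (σ * (k₀ * P t + k₁)) / k₀)) = σ * (k₀ * P t + k₁) := by
        rw [e0, Real.exp_log (hsgn t ht)]
      have e2 : Real.exp (-(k₀ * (Real.log (σ * (k₀ * P t + k₁)) / k₀)))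
          = (σ * (k₀ * P t + k₁))⁻¹ := by
        rw [Real.exp_neg, e1]
      have e3 : Real.exp (-(2 * k₀ * (Real.log (σ * (k₀ * P t + k₁)) / k₀)))
          = (σ * (k₀ * P t + k₁))⁻¹ ^ 2 := by
        rw [← e2, ← Real.exp_nat_mul]; congr 1; push_cast; ring
      have hσ0 : σ ≠ 0 := by rintro rfl; norm_num at hσ2
      have hσ2' : σ ^ 2 = 1 := by rw [sq, hσ2]
      rw [e1, e2, e3, h2, h3, h4, h5]
      set Λ := k₀ * P t + k₁
      have : (σ * Λ)⁻¹ = σ * Λ⁻¹ := by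
        rw [mul_inv]; congr 1; exact inv_eq_of_mul_eq_one_left hσ2
      rw [this]
      refine ⟨?_, ?_, ?_, ?_⟩
      · field_simp; rw [hσ2']; ring
      · field_simp; rw [hσ2']; ring
      · field_simp; rw [hσ2']; ring
      · field_simp; rw [hσ2']; ring

/-- The relations between the coefficients that hold exactly if the system can be made
integrable with constant coefficients `1, ε, A, 1, -ε, B`. -/
structure Reducible (c : Coeffs) (I : Opens ℝ) (ε A B : ℝ) : Prop where
  sign : ∀ t ∈ I, 0 < ε * (c.p₁ t * c.p₂ t)
  q₁ : ∀ t ∈ I, c.q₁ t = A * (Real.sign (c.p₁ t) * Real.sqrt |c.p₁ t * c.p₂ t|)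
  r₂ : ∀ t ∈ I, c.q₂ t * c.r₂ t * |c.p₁ t|
    = B * (Real.sign (c.p₁ t) * |c.p₂ t| * Real.sqrt |c.p₁ t * c.p₂ t|)
  r₁ : ∀ t ∈ I, c.p₂ t = -(c.p₁ t * c.r₁ t)
  logDeriv : ∃ k₀ : ℝ, ∀ t ∈ I,
    HasDerivAt c.p₁ (c.p₁ t * (deriv c.q₁ t / c.q₁ t + k₀ * c.q₁ t)) t ∧
    HasDerivAt c.p₂ (c.p₂ t * (deriv c.q₁ t / c.q₁ t - k₀ * c.q₁ t)) t

theorem sign_mul_abs' (a : ℝ) : Real.sign a * |a| = a := by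
  rcases lt_trichotomy a 0 with h | rfl | h
  · rw [Real.sign_of_neg h, abs_of_neg h]; ring
  · simp
  · rw [Real.sign_of_pos h, abs_of_pos h]; ring

/-- The exponentials cancel in p₁ p₂ = -r₁₀ (k₁ q₁)², so |p₁ p₂|^(1/2) is a constant multiple of
|q₁|. Differentiating the formulas for p₁ and p₂ gives the logarithmic derivatives. -/
theorem Table1.reducible {I : Opens ℝ} {c : Coeffs} (hne : (I : Set ℝ).Nonempty)
    (hc : c.SmoothNonzeroOn I) (h : Table1 c I) :
    ∃ ε A B : ℝ, (ε = 1 ∨ ε = -1) ∧ A ≠ 0 ∧ B ≠ 0 ∧ Reducible c I ε A B := by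
  obtain ⟨k₀, k₁, r₁₀, r₂₀, Q, hQ, h⟩ := h
  obtain ⟨hk1, hr1, hr2⟩ : k₁ ≠ 0 ∧ r₁₀ ≠ 0 ∧ r₂₀ ≠ 0 := by
    obtain ⟨t, ht⟩ := hne
    obtain ⟨n1, n2, n3, n4, n5, n6⟩ := hc.ne_zero t ht
    obtain ⟨h1, h2, h3, h4⟩ := h t ht
    refine ⟨?_, ?_, ?_⟩
    · rintro rfl; apply n1; rw [h1]; ring
    · rintro rfl; apply n5; rw [h3]; ring
    · rintro rfl; apply n6; rw [h4]; ring
  have hexp : ∀ t, Real.exp (k₀ * Q t) * Real.exp (-(k₀ * Q t)) = 1 := fun t => by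
    rw [← Real.exp_add]; simp
  have hs0 : 0 < Real.sqrt |r₁₀| := Real.sqrt_pos.2 (abs_pos.2 hr1)
  have hs2 : Real.sqrt |r₁₀| * Real.sqrt |r₁₀| = |r₁₀| := Real.mul_self_sqrt (abs_nonneg _)
  -- ε is the sign of -r₁₀, hence that of p₁ p₂.
  obtain ⟨ε, hε, hεr⟩ : ∃ ε : ℝ, (ε = 1 ∨ ε = -1) ∧ -(ε * r₁₀) = |r₁₀| := by
    rcases lt_or_gt_of_ne hr1 with h' | h'
    · exact ⟨1, Or.inl rfl, by rw [abs_of_neg h']; ring⟩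
    · exact ⟨-1, Or.inr rfl, by rw [abs_of_pos h']; ring⟩
  have hprod : ∀ t ∈ I, c.p₁ t * c.p₂ t = -(r₁₀ * (k₁ * c.q₁ t) ^ 2) := by
    intro t ht
    obtain ⟨h1, h2, -⟩ := h t ht
    rw [h1, h2]
    linear_combination (-(r₁₀ * (k₁ * c.q₁ t) ^ 2)) * hexp t
  have hsqrt : ∀ t ∈ I, Real.sqrt |c.p₁ t * c.p₂ t| = Real.sqrt |r₁₀| * |k₁ * c.q₁ t| := by
    intro t ht
    rw [hprod t ht, abs_neg, abs_mul, Real.sqrt_mul (abs_nonneg _), abs_pow,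
      Real.sqrt_sq (abs_nonneg _)]
  have hsgn : ∀ t ∈ I, Real.sign (c.p₁ t) * |k₁ * c.q₁ t| = k₁ * c.q₁ t := by
    intro t ht
    have e : Real.sign (c.p₁ t) = Real.sign (k₁ * c.q₁ t) := by
      rw [(h t ht).1]
      have := Real.exp_pos (k₀ * Q t)
      rcases lt_trichotomy (k₁ * c.q₁ t) 0 with h' | h' | h'
      · rw [Real.sign_of_neg h', Real.sign_of_neg (mul_neg_of_neg_of_pos h' this)]
      · rw [h', zero_mul]
      · rw [Real.sign_of_pos h', Real.sign_of_pos (mul_pos h' this)]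
    rw [e, sign_mul_abs']
  -- sgn(p₁) |p₁ p₂|^(1/2) = k₁ |r₁₀|^(1/2) q₁ gives A. For B the numerator q₁ is replaced by q₂ r₂
  -- |p₁|/|p₂|, which equals r₂₀ q₁/|r₁₀| because |p₁|/|p₂| = exp(2 k₀ Q)/|r₁₀|.
  refine ⟨ε, 1 / (k₁ * Real.sqrt |r₁₀|), r₂₀ / |r₁₀| / (k₁ * Real.sqrt |r₁₀|), hε, by positivity, by positivity,
    ⟨fun t ht => ?_, fun t ht => ?_, fun t ht => ?_, fun t ht => ?_, k₀, fun t ht => ?_⟩⟩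
  · rw [hprod t ht]
    have hq := (hc.ne_zero t ht).2.2.1
    have : 0 < |r₁₀| * (k₁ * c.q₁ t) ^ 2 := by positivity
    rw [← hεr] at this
    linarith
  · rw [hsqrt t ht]
    have := hsgn t ht
    set a := |k₁ * c.q₁ t|
    field_simp
    linear_combination -this
  · rw [hsqrt t ht]
    have h' := hsgn t ht
    obtain ⟨h1, h2, h3, h4⟩ := h t ht
    have hq2 := (hc.ne_zero t ht).2.2.2.1
    have e2 : Real.exp (-(2 * k₀ * Q t)) = Real.exp (-(k₀ * Q t)) ^ 2 := by
      rw [← Real.exp_nat_mul]; congr 1; push_cast; ring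
    have hp1 : |c.p₁ t| = |k₁ * c.q₁ t| * Real.exp (k₀ * Q t) := by
      rw [h1, abs_mul, abs_of_pos (Real.exp_pos _)]
    have hp2 : |c.p₂ t| = |r₁₀| * |k₁ * c.q₁ t| * Real.exp (-(k₀ * Q t)) := by
      rw [h2, abs_neg, abs_mul, abs_of_pos (Real.exp_pos _), mul_assoc r₁₀, abs_mul]
    rw [hp1, hp2, h4, e2]
    have hE := hexp t
    set E := Real.exp (k₀ * Q t)
    set E' := Real.exp (-(k₀ * Q t))
    set a := |k₁ * c.q₁ t|
    field_simp
    linear_combination (c.q₁ t * a * E' * k₁) * hE - (a * E') * h'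
  · obtain ⟨h1, h2, h3, h4⟩ := h t ht
    have e2 : Real.exp (-(2 * k₀ * Q t)) = Real.exp (-(k₀ * Q t)) ^ 2 := by
      rw [← Real.exp_nat_mul]; congr 1; push_cast; ring
    rw [h1, h2, h3, e2]
    linear_combination (r₁₀ * k₁ * c.q₁ t * Real.exp (-(k₀ * Q t))) * hexp t
  · have hq := ((contDiffAt_of_mem hc.smooth_q₁ ht).differentiableAt (by simp)).hasDerivAt
    have hq0 := (hc.ne_zero t ht).2.2.1
    have hE := ((hQ t ht).const_mul k₀)
    have hI : ∀ᶠ s in nhds t, s ∈ I := I.isOpen.mem_nhds ht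
    obtain ⟨h1, h2, -⟩ := h t ht
    constructor
    · have d := (((hq.const_mul k₁).mul hE.exp)).congr_of_eventuallyEq (f₁ := c.p₁)
        (hI.mono fun s hs => by simpa using (h s hs).1)
      refine d.congr_deriv ?_
      rw [h1]
      field_simp
    · have d := (((hq.const_mul (-(r₁₀ * k₁))).mul hE.neg.exp)).congr_of_eventuallyEq (f₁ := c.p₂)
        (hI.mono fun s hs => by simpa using (h s hs).2.1)
      refine d.congr_deriv ?_
      rw [h2]
      field_simp
      simp
      ring

/-! ### The wave condition and the canonical transformations -/

/-- The phase coefficient in terms of logarithmic derivatives. -/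
theorem deriv_phaseCoeff {I : Opens ℝ} {p α T q : ℝ → ℝ} {δ k : ℝ}
    (hT : ContDiffOn ℝ ∞ T I) (hq : ContDiffOn ℝ ∞ q I)
    (hT0 : ∀ t ∈ I, deriv T t ≠ 0) (hq0 : ∀ t ∈ I, q t ≠ 0) (hp0 : ∀ t ∈ I, p t ≠ 0)
    (hα : ContDiffOn ℝ ∞ α I) (hα0 : ∀ t ∈ I, 0 < α t)
    (hαp : ∀ t ∈ I, p t * α t ^ 2 = δ * deriv T t)
    (hd : ∀ t ∈ I, HasDerivAt p (p t * (deriv q t / q t + k * q t)) t) {t : ℝ} (ht : t ∈ I) :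
    16 * p t * (deriv (phaseCoeff p α) t + 4 * p t * phaseCoeff p α t ^ 2)
      = -2 * (deriv (fun t => deriv (deriv T) t / deriv T t - deriv q t / q t) t - k * deriv q t)
        + 2 * ((deriv (deriv T) t / deriv T t - deriv q t / q t) - k * q t)
          * (deriv q t / q t + k * q t)
        + ((deriv (deriv T) t / deriv T t - deriv q t / q t) - k * q t) ^ 2 := by
  -- Differentiating p α² = δ T' logarithmically gives 2 α'/α = T''/T' - p'/p = u - k q, where u =
  -- T''/T' - q'/q does not depend on p.
  have two_deriv : ∀ s ∈ I, phaseCoeff p α s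
      = -(((deriv (deriv T) s / deriv T s - deriv q s / q s) - k * q s) / (8 * p s)) := by
    intro s hs
    have dα := ((contDiffAt_of_mem hα hs).differentiableAt (by simp)).hasDerivAt
    have dT := ((contDiffAt_deriv_of_mem hT hs).differentiableAt (by simp)).hasDerivAt
    have e := ((hd s hs).mul (dα.pow 2)).unique ((dT.const_mul δ).congr_of_eventuallyEq
      (Filter.eventuallyEq_of_mem (I.isOpen.mem_nhds hs) hαp))
    have hα' := (hα0 s hs).ne'
    have hp' := hp0 s hs
    have hq' := hq0 s hs
    have hT' := hT0 s hs
    have h2 := hαp s hs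
    have hδ : δ ≠ 0 := by
      rintro rfl
      rw [zero_mul] at h2
      exact mul_ne_zero hp' (pow_ne_zero 2 hα') h2
    have key : deriv (deriv T) s / deriv T s = (deriv q s / q s + k * q s) + 2 * (deriv α s / α s) := by
      rw [div_eq_iff hT']
      apply mul_left_cancel₀ hδ
      rw [← e]
      simp only [Pi.pow_apply]
      have hX : ∀ X, δ * (X * deriv T s) = X * (p s * α s ^ 2) := fun X => by rw [h2]; ring
      rw [hX]
      field_simp
      push_cast
      ring
    rw [key, phaseCoeff]
    field_simp
    ring
  have ev : phaseCoeff p α =ᶠ[nhds t] _ :=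
    Filter.eventuallyEq_of_mem (I.isOpen.mem_nhds ht) two_deriv
  have hp' := hp0 t ht
  have hu : DifferentiableAt ℝ (fun t => deriv (deriv T) t / deriv T t - deriv q t / q t) t := by
    have d1 := contDiffAt_deriv_of_mem hT ht
    have d2 : ContDiffAt ℝ ∞ (deriv (deriv T)) t := contDiffAt_deriv_of_mem
      (hT.deriv_of_isOpen I.isOpen (m := ∞) (by simp)) ht
    have d3 := contDiffAt_deriv_of_mem hq ht
    exact (((d2.div d1 (hT0 t ht)).sub (d3.div (contDiffAt_of_mem hq ht) (hq0 t ht))).differentiableAt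
      (by simp))
  have dq := ((contDiffAt_of_mem hq ht).differentiableAt (by simp)).hasDerivAt
  have dd := ((hu.hasDerivAt.sub (dq.const_mul k)).div ((hd t ht).const_mul 8)
    (mul_ne_zero (by norm_num) hp')).neg
  rw [ev.deriv_eq, two_deriv t ht]
  erw [dd.deriv]
  simp only [Pi.sub_apply]
  set u' := deriv (fun t => deriv (deriv T) t / deriv T t - deriv q t / q t) t
  set a := deriv (deriv T) t / deriv T t - deriv q t / q t
  set b := deriv q t / q t
  field_simp
  ring

/-- The algebraic conditions follow from p₁ α² = T', p₂ β² = ε T' and α β = |T'|/|p₁ p₂|^(1/2). The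
sign of T' agrees with that of p₁, which is where the factors sgn(p₁) in A and B come from. -/
theorem Reducible.admissible {I : Opens ℝ} {c : Coeffs} (hc : c.SmoothNonzeroOn I) {ε A B : ℝ}
    (hε : ε = 1 ∨ ε = -1) (h : Reducible c I ε A B) {T : ℝ → ℝ} (hT : ContDiffOn ℝ ∞ T I)
    (hTp : ∀ t ∈ I, 0 < deriv T t * c.p₁ t) :
    Admissible c (Coeffs.const 1 ε A 1 (-ε) B) I T (fun t => Real.sqrt (deriv T t / c.p₁ t))
      (fun t => Real.sqrt (ε * deriv T t / c.p₂ t)) (fun t => deriv T t / c.q₂ t) := by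
  have hT0 : ∀ t ∈ I, deriv T t ≠ 0 := fun t ht => left_ne_zero_of_mul (hTp t ht).ne'
  have hp1 : ∀ t ∈ I, c.p₁ t ≠ 0 := fun t ht => (hc.ne_zero t ht).1
  have hp2 : ∀ t ∈ I, c.p₂ t ≠ 0 := fun t ht => (hc.ne_zero t ht).2.1
  have hq1 : ∀ t ∈ I, c.q₁ t ≠ 0 := fun t ht => (hc.ne_zero t ht).2.2.1
  have hq2 : ∀ t ∈ I, c.q₂ t ≠ 0 := fun t ht => (hc.ne_zero t ht).2.2.2.1
  have hT' : ContDiffOn ℝ ∞ (deriv T) I := hT.deriv_of_isOpen I.isOpen (m := ∞) (by simp)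
  have pos1 : ∀ t ∈ I, 0 < deriv T t / c.p₁ t := fun t ht => by
    have := hTp t ht
    have h2 : deriv T t / c.p₁ t = deriv T t * c.p₁ t / c.p₁ t ^ 2 := by
      field_simp [hp1 t ht]
    rw [h2]; have := hp1 t ht; positivity
  have pos2 : ∀ t ∈ I, 0 < ε * deriv T t / c.p₂ t := fun t ht => by
    have h1 := mul_pos (h.sign t ht) (hTp t ht)
    have n1 := hp1 t ht
    have n2 := hp2 t ht
    have h2 : ε * deriv T t / c.p₂ t
        = ε * (c.p₁ t * c.p₂ t) * (deriv T t * c.p₁ t) / (c.p₁ t * c.p₂ t) ^ 2 := by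
      field_simp
    rw [h2]; positivity
  have sα : ContDiffOn ℝ ∞ (fun t => Real.sqrt (deriv T t / c.p₁ t)) I :=
    (hT'.div hc.smooth_p₁ hp1).sqrt fun t ht => (pos1 t ht).ne'
  have sβ : ContDiffOn ℝ ∞ (fun t => Real.sqrt (ε * deriv T t / c.p₂ t)) I :=
    ((contDiffOn_const.mul hT').div hc.smooth_p₂ hp2).sqrt fun t ht => (pos2 t ht).ne'
  have eα : ∀ t ∈ I, c.p₁ t * Real.sqrt (deriv T t / c.p₁ t) ^ 2 = deriv T t := fun t ht => by
    rw [Real.sq_sqrt (pos1 t ht).le, mul_div_cancel₀ _ (hp1 t ht)]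
  have eβ : ∀ t ∈ I, c.p₂ t * Real.sqrt (ε * deriv T t / c.p₂ t) ^ 2 = ε * deriv T t :=
    fun t ht => by rw [Real.sq_sqrt (pos2 t ht).le, mul_div_cancel₀ _ (hp2 t ht)]
  have hε2 : ε * ε = 1 := by rcases hε with rfl | rfl <;> norm_num
  have hsg : ∀ t ∈ I, Real.sign (c.p₁ t) * |deriv T t| = deriv T t := fun t ht => by
    have e : Real.sign (c.p₁ t) = Real.sign (deriv T t) := by
      rcases (mul_pos_iff.1 (hTp t ht)) with h' | h'
      · rw [Real.sign_of_pos h'.1, Real.sign_of_pos h'.2]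
      · rw [Real.sign_of_neg h'.1, Real.sign_of_neg h'.2]
    rw [e, sign_mul_abs']
  have spos : ∀ t ∈ I, 0 < Real.sqrt |c.p₁ t * c.p₂ t| := fun t ht =>
    Real.sqrt_pos.2 (abs_pos.2 (mul_ne_zero (hp1 t ht) (hp2 t ht)))
  have eαβ : ∀ t ∈ I, Real.sqrt (deriv T t / c.p₁ t) * Real.sqrt (ε * deriv T t / c.p₂ t)
      = |deriv T t| / Real.sqrt |c.p₁ t * c.p₂ t| := fun t ht => by
    have n1 := hp1 t ht
    have n2 := hp2 t ht
    have e : |c.p₁ t * c.p₂ t| = ε * (c.p₁ t * c.p₂ t) := by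
      rw [← abs_of_pos (h.sign t ht), abs_mul]
      rcases hε with rfl | rfl <;> simp
    rw [← Real.sqrt_mul (pos1 t ht).le, e, ← Real.sqrt_sq_eq_abs, ← Real.sqrt_div (sq_nonneg _)]
    congr 1
    have hε0 : ε ≠ 0 := by rintro rfl; norm_num at hε2
    field_simp
    linear_combination (deriv T t ^ 2) * hε2
  refine ⟨hT, sα, sβ, hT'.div hc.smooth_q₂ hq2, hT0, fun t ht => Real.sqrt_pos.2 (pos1 t ht),
    fun t ht => Real.sqrt_pos.2 (pos2 t ht), fun t ht => div_ne_zero (hT0 t ht) (hq2 t ht),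
    fun t ht => ?_, fun t ht => ?_, fun t ht => ?_, fun t ht => ?_, fun t ht => ?_, fun t ht => ?_,
    fun t ht => ?_⟩
  · simp only [Coeffs.const, eα t ht, mul_one]
  · simp only [Coeffs.const, eβ t ht, mul_comm]
  · simp only [Coeffs.const]
    rw [eαβ t ht]
    nth_rewrite 1 [h.q₁ t ht]
    have := (spos t ht).ne'
    have h2 := hsg t ht
    field_simp
    linear_combination A * h2
  · have := hq2 t ht
    simp only [Coeffs.const]
    field_simp
  · simp only [Coeffs.const]
    have h1 := eα t ht
    have h2 := eβ t ht
    have h3 := h.r₁ t ht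
    have n1 := hp1 t ht
    apply mul_left_cancel₀ n1
    linear_combination -h2 + (-ε) * (-h1) + (Real.sqrt (ε * deriv T t / c.p₂ t) ^ 2) * h3
  · simp only [Coeffs.const]
    have h1 := eα t ht
    have h2 := eβ t ht
    have h3 := h.r₂ t ht
    have h4 := hsg t ht
    have n1 := hp1 t ht
    have n2 := hp2 t ht
    have n3 := hq2 t ht
    have n4 := (spos t ht).ne'
    -- ε p₁ p₂ > 0 says that ε sgn(p₁) = sgn(p₂); the other combinations of signs are contradictory.
    have e3 : ε * (c.p₁ t * |c.p₂ t|) = |c.p₁ t| * c.p₂ t := by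
      rcases (mul_pos_iff.1 (h.sign t ht)) with h' | h'
      all_goals
        rcases hε with rfl | rfl
        all_goals
          first
            | (exfalso; linarith [h'.1])
            | (rcases lt_or_gt_of_ne n1 with g1 | g1 <;> rcases lt_or_gt_of_ne n2 with g2 | g2 <;>
                first
                  | (exfalso; nlinarith [h'.2])
                  | (simp only [abs_of_pos, abs_of_neg, g1, g2]; ring))
    rw [eαβ t ht, Real.sq_sqrt (pos1 t ht).le, Real.sq_sqrt (pos2 t ht).le]
    have n5 : |c.p₁ t| ≠ 0 := abs_ne_zero.2 n1
    have n6 : |c.p₂ t| ≠ 0 := abs_ne_zero.2 n2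
    set s := Real.sqrt |c.p₁ t * c.p₂ t|
    have e5 : c.r₂ t = B * (Real.sign (c.p₁ t) * |c.p₂ t| * s) / (c.q₂ t * |c.p₁ t|) := by
      rw [eq_div_iff (mul_ne_zero n3 n5), ← h3]; ring
    rw [e5]
    generalize |c.p₁ t| = a₁ at *
    generalize |c.p₂ t| = a₂ at *
    generalize |deriv T t| = a₃ at *
    field_simp
    linear_combination (B * deriv T t * Real.sign (c.p₁ t) * a₃) * e3
      + (B * deriv T t * a₁ * c.p₂ t) * h4
  -- After multiplication by 16 p₁ and with p₁ r₁ = -p₂, the wave condition is the difference of the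
  -- right hand sides of `deriv_phaseCoeff` at k₀ and at -k₀. In each the terms odd in k₀ are 2 k q'
  -- + 2 u k q - 2 k q' - 2 u k q = 0, so the difference vanishes for every T.
  · obtain ⟨k₀, hk⟩ := h.logDeriv
    have d1 := deriv_phaseCoeff (δ := 1) (k := k₀) hT hc.smooth_q₁ hT0 hq1 hp1 sα
      (fun t ht => Real.sqrt_pos.2 (pos1 t ht)) (fun t ht => by rw [eα t ht, one_mul])
      (fun t ht => (hk t ht).1) ht
    have d2 := deriv_phaseCoeff (δ := ε) (k := -k₀) hT hc.smooth_q₁ hT0 hq1 hp2 sβ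
      (fun t ht => Real.sqrt_pos.2 (pos2 t ht)) (fun t ht => by rw [eβ t ht])
      (fun t ht => by simpa [sub_eq_add_neg] using (hk t ht).2) ht
    have n1 := hp1 t ht
    have n3 := hq1 t ht
    have h3 := h.r₁ t ht
    have hb : deriv c.q₁ t / c.q₁ t * c.q₁ t = deriv c.q₁ t := div_mul_cancel₀ _ n3
    apply mul_left_cancel₀ (mul_ne_zero (by norm_num : (16 : ℝ) ≠ 0) n1)
    linear_combination d1 - d2 + 16 * (deriv (phaseCoeff c.p₂ fun t => Real.sqrt (ε * deriv T t / c.p₂ t)) t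
      + 4 * c.p₂ t * phaseCoeff c.p₂ (fun t => Real.sqrt (ε * deriv T t / c.p₂ t)) t ^ 2) * h3
      - 4 * k₀ * hb

/-! ### Pushforward of vector fields -/

/-- Diffeomorphisms between the domains over two time intervals. -/
structure DomDiffeo (I J : Opens ℝ) where
  toFun : Tot → Tot
  invFun : Tot → Tot
  contDiffOn_toFun : ContDiffOn ℝ ∞ toFun (dom I)
  contDiffOn_invFun : ContDiffOn ℝ ∞ invFun (dom J)
  mapsTo : MapsTo toFun (dom I) (dom J)
  mapsTo_inv : MapsTo invFun (dom J) (dom I)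
  left_inv : ∀ p ∈ dom I, invFun (toFun p) = p
  right_inv : ∀ p ∈ dom J, toFun (invFun p) = p

namespace DomDiffeo

variable {I J : Opens ℝ}

def symm (Φ : DomDiffeo I J) : DomDiffeo J I where
  toFun := Φ.invFun
  invFun := Φ.toFun
  contDiffOn_toFun := Φ.contDiffOn_invFun
  contDiffOn_invFun := Φ.contDiffOn_toFun
  mapsTo := Φ.mapsTo_inv
  mapsTo_inv := Φ.mapsTo
  left_inv := Φ.right_inv
  right_inv := Φ.left_inv

theorem contDiffAt (Φ : DomDiffeo I J) {p : Tot} (hp : p ∈ dom I) : ContDiffAt ℝ ∞ Φ.toFun p :=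
  (Φ.contDiffOn_toFun p hp).contDiffAt ((isOpen_dom I).mem_nhds hp)

theorem contDiffAt_inv (Φ : DomDiffeo I J) {p : Tot} (hp : p ∈ dom J) :
    ContDiffAt ℝ ∞ Φ.invFun p := Φ.symm.contDiffAt hp

theorem differentiableAt (Φ : DomDiffeo I J) {p : Tot} (hp : p ∈ dom I) :
    DifferentiableAt ℝ Φ.toFun p := (Φ.contDiffAt hp).differentiableAt (by simp)

theorem fderiv_inv_comp (Φ : DomDiffeo I J) {p : Tot} (hp : p ∈ dom I) :
    (fderiv ℝ Φ.invFun (Φ.toFun p)).comp (fderiv ℝ Φ.toFun p) = ContinuousLinearMap.id ℝ Tot := by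
  have hd : DifferentiableAt ℝ Φ.invFun (Φ.toFun p) := Φ.symm.differentiableAt (Φ.mapsTo hp)
  rw [← fderiv_comp p hd (Φ.differentiableAt hp)]
  have e : Φ.invFun ∘ Φ.toFun =ᶠ[nhds p] id :=
    Filter.eventuallyEq_of_mem ((isOpen_dom I).mem_nhds hp) Φ.left_inv
  exact e.fderiv_eq.trans fderiv_id

theorem fderiv_comp_inv (Φ : DomDiffeo I J) {p : Tot} (hp : p ∈ dom J) :
    (fderiv ℝ Φ.toFun (Φ.invFun p)).comp (fderiv ℝ Φ.invFun p) = ContinuousLinearMap.id ℝ Tot :=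
  Φ.symm.fderiv_inv_comp hp

open Classical in
/-- The pushforward of vector fields. -/
noncomputable def pushFun (Φ : DomDiffeo I J) (V : Tot → Tot) (p : Tot) : Tot :=
  if p ∈ dom J then fderiv ℝ Φ.toFun (Φ.invFun p) (V (Φ.invFun p)) else 0

theorem pushFun_of_mem (Φ : DomDiffeo I J) (V : Tot → Tot) {p : Tot} (hp : p ∈ dom J) :
    Φ.pushFun V p = fderiv ℝ Φ.toFun (Φ.invFun p) (V (Φ.invFun p)) := if_pos hp

theorem pushFun_toFun (Φ : DomDiffeo I J) (V : Tot → Tot) {p : Tot} (hp : p ∈ dom I) :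
    Φ.pushFun V (Φ.toFun p) = fderiv ℝ Φ.toFun p (V p) := by
  rw [pushFun_of_mem Φ V (Φ.mapsTo hp), Φ.left_inv p hp]

/-- The derivatives of Φ and of its inverse are inverse to each other. Written as a pullback along
the inverse, the pushforward inherits the compatibility of pullbacks with Lie brackets. -/
theorem pushFun_eq_pullback (Φ : DomDiffeo I J) (V : Tot → Tot) {p : Tot} (hp : p ∈ dom J) :
    Φ.pushFun V p = VectorField.pullback ℝ Φ.invFun V p := by
  rw [Φ.pushFun_of_mem V hp, VectorField.pullback, ContinuousLinearMap.inverse_eq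
    (f := fderiv ℝ Φ.invFun p) (g := fderiv ℝ Φ.toFun (Φ.invFun p))]
  · have := Φ.fderiv_inv_comp (Φ.mapsTo_inv hp)
    rwa [Φ.right_inv p hp] at this
  · exact Φ.fderiv_comp_inv hp

noncomputable def push (Φ : DomDiffeo I J) (V : VField I) : VField J :=
  ⟨Φ.pushFun V.1, fun p hp => by
    have h1 : ContDiffAt ℝ ∞ (fun p => fderiv ℝ Φ.toFun (Φ.invFun p) (V.1 (Φ.invFun p))) p := by
      have hi := Φ.contDiffAt_inv hp
      have hd : ContDiffAt ℝ ∞ (fderiv ℝ Φ.toFun) (Φ.invFun p) :=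
        (Φ.contDiffAt (Φ.mapsTo_inv hp)).fderiv_right (by simp)
      exact (hd.comp p hi).clm_apply ((V.contDiffAt (Φ.mapsTo_inv hp)).comp p hi)
    exact (h1.congr_of_eventuallyEq (Filter.eventuallyEq_of_mem ((isOpen_dom J).mem_nhds hp)
      fun q hq => Φ.pushFun_of_mem V.1 hq)).contDiffWithinAt,
    fun _ hp => if_neg hp⟩

theorem push_symm_push (Φ : DomDiffeo I J) (V : VField I) : Φ.symm.push (Φ.push V) = V := by
  ext1; funext p
  by_cases hp : p ∈ dom I
  · have h1 : (Φ.symm.push (Φ.push V)).1 p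
        = fderiv ℝ Φ.invFun (Φ.toFun p) (Φ.pushFun V.1 (Φ.toFun p)) := Φ.symm.pushFun_of_mem _ hp
    rw [h1, Φ.pushFun_toFun V.1 hp]
    exact congrArg (fun A => A (V.1 p)) (Φ.fderiv_inv_comp hp)
  · rw [(Φ.symm.push (Φ.push V)).2.2 p hp, V.2.2 p hp]

theorem push_lie (Φ : DomDiffeo I J) (V W : VField I) : Φ.push ⁅V, W⁆ = ⁅Φ.push V, Φ.push W⁆ := by
  ext1; funext p
  by_cases hp : p ∈ dom J
  · have ev : ∀ U : VField I, Φ.pushFun U.1 =ᶠ[nhds p] VectorField.pullback ℝ Φ.invFun U.1 :=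
      fun U => Filter.eventuallyEq_of_mem ((isOpen_dom J).mem_nhds hp)
        fun q hq => Φ.pushFun_eq_pullback U.1 hq
    have h1 : (⁅Φ.push V, Φ.push W⁆ : VField J).1 p
        = VectorField.lieBracket ℝ (Φ.pushFun V.1) (Φ.pushFun W.1) p := rfl
    have h2 : (Φ.push ⁅V, W⁆).1 p = Φ.pushFun (VectorField.lieBracket ℝ V.1 W.1) p := rfl
    rw [h1, h2, Φ.pushFun_eq_pullback _ hp, (ev V).lieBracket_vectorField_eq (ev W)]
    exact VectorField.pullback_lieBracket (n := ∞) (by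
      simp only [minSmoothness_of_isRCLikeNormedField]
      exact WithTop.coe_le_coe.2 (le_top : (2 : ℕ∞) ≤ ⊤)) (Φ.contDiffAt_inv hp)
      (V.differentiableAt (Φ.mapsTo_inv hp)) (W.differentiableAt (Φ.mapsTo_inv hp))
  · rw [(Φ.push ⁅V, W⁆).2.2 p hp, (⁅Φ.push V, Φ.push W⁆ : VField J).2.2 p hp]

/-- The isomorphism of Lie algebras of vector fields induced by a diffeomorphism. -/
noncomputable def lieEquiv (Φ : DomDiffeo I J) : VField I ≃ₗ⁅ℝ⁆ VField J where
  toFun := Φ.push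
  invFun := Φ.symm.push
  left_inv := Φ.push_symm_push
  right_inv := Φ.symm.push_symm_push
  map_add' V W := by
    ext1; funext p
    by_cases hp : p ∈ dom J
    · change Φ.pushFun (V + W).1 p = Φ.pushFun V.1 p + Φ.pushFun W.1 p
      simp [Φ.pushFun_of_mem _ hp]
    · rw [(Φ.push (V + W)).2.2 p hp, (Φ.push V + Φ.push W).2.2 p hp]
  map_smul' a V := by
    ext1; funext p
    by_cases hp : p ∈ dom J
    · change Φ.pushFun (a • V).1 p = a • Φ.pushFun V.1 p
      simp [Φ.pushFun_of_mem _ hp]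
    · rw [(Φ.push (a • V)).2.2 p hp]
      exact ((a • Φ.push V).2.2 p hp).symm
  map_lie' := fun {V W} => Φ.push_lie V W

end DomDiffeo

/-! ### Diffeomorphisms between intervals -/

/-- A diffeomorphism onto the real line, explicit in each of four cases: log((t - a)/(b - t)) for a
bounded interval, log(t - a) or -log(b - t) for a half line, the identity otherwise. Openness keeps
the end points out of the interval. -/
theorem exists_interval_chart (I : Opens ℝ) (hI : IsPreconnected (I : Set ℝ))
    (hne : (I : Set ℝ).Nonempty) :
    ∃ φ ψ : ℝ → ℝ, ContDiffOn ℝ ∞ φ I ∧ ContDiff ℝ ∞ ψ ∧ (∀ s, ψ s ∈ I) ∧ (∀ s, φ (ψ s) = s) ∧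
      (∀ t ∈ I, ψ (φ t) = t) ∧ ∀ t, 0 < deriv ψ t := by
  have hlow : BddBelow (I : Set ℝ) → ∀ t ∈ I, sInf (I : Set ℝ) < t := fun hb t ht => by
    obtain ⟨ε, hε, h⟩ := Metric.isOpen_iff.1 I.isOpen t ht
    have : t - ε / 2 ∈ (I : Set ℝ) := h (by simp [abs_of_pos, hε])
    linarith [csInf_le hb this]
  have hup : BddAbove (I : Set ℝ) → ∀ t ∈ I, t < sSup (I : Set ℝ) := fun hb t ht => by
    obtain ⟨ε, hε, h⟩ := Metric.isOpen_iff.1 I.isOpen t ht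
    have : t + ε / 2 ∈ (I : Set ℝ) := h (by simp [abs_of_pos, hε])
    linarith [le_csSup hb this]
  have hcon : IsConnected (I : Set ℝ) := ⟨hne, hI⟩
  by_cases hb : BddBelow (I : Set ℝ) <;> by_cases ha : BddAbove (I : Set ℝ)
  · set a := sInf (I : Set ℝ) with ha_def
    set b := sSup (I : Set ℝ) with hb_def
    have hab : a < b := by
      obtain ⟨t, ht⟩ := hne
      exact (hlow hb t ht).trans (hup ha t ht)
    have hsub : Ioo a b ⊆ I := hcon.Ioo_csInf_csSup_subset hb ha
    have hpos : ∀ s, (0 : ℝ) < 1 + Real.exp s := fun s => by positivity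
    have hder : ∀ s, HasDerivAt (fun s => (a + b * Real.exp s) / (1 + Real.exp s))
        ((b - a) * Real.exp s / (1 + Real.exp s) ^ 2) s := fun s => by
      refine ((((Real.hasDerivAt_exp s).const_mul b).const_add a).div
        ((Real.hasDerivAt_exp s).const_add 1) (hpos s).ne').congr_deriv ?_
      have := (hpos s).ne'
      field_simp
      ring
    refine ⟨fun t => Real.log ((t - a) / (b - t)), fun s => (a + b * Real.exp s) / (1 + Real.exp s),
      ?_, ?_, fun s => hsub ⟨?_, ?_⟩, fun s => ?_, fun t ht => ?_, fun s => ?_⟩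
    · have h1 : ∀ t ∈ I, b - t ≠ 0 := fun t ht => (sub_pos.2 (hup ha t ht)).ne'
      exact ((contDiffOn_id.sub contDiffOn_const).div (contDiffOn_const.sub contDiffOn_id) h1).log
        fun t ht => div_ne_zero (sub_pos.2 (hlow hb t ht)).ne' (h1 t ht)
    · exact (contDiff_const.add (contDiff_const.mul Real.contDiff_exp)).div
        (contDiff_const.add Real.contDiff_exp) fun s => (hpos s).ne'
    · rw [lt_div_iff₀ (hpos s)]
      nlinarith [Real.exp_pos s]
    · rw [div_lt_iff₀ (hpos s)]
      nlinarith [Real.exp_pos s]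
    · have h1 := (hpos s).ne'
      have h2 : (a + b * Real.exp s) / (1 + Real.exp s) - a
          = (b - a) / (1 + Real.exp s) * Real.exp s := by field_simp; ring
      have h3 : b - (a + b * Real.exp s) / (1 + Real.exp s) = (b - a) / (1 + Real.exp s) := by
        field_simp; ring
      have h4 : (b - a) / (1 + Real.exp s) ≠ 0 := div_ne_zero (sub_pos.2 hab).ne' h1
      simp only [h2, h3]
      rw [mul_div_cancel_left₀ _ h4, Real.log_exp]
    · have h1 := sub_pos.2 (hlow hb t ht)
      have h2 := sub_pos.2 (hup ha t ht)
      change 0 < t - a at h1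
      change 0 < b - t at h2
      simp only [Real.exp_log (div_pos h1 h2)]
      have h3 : b - a ≠ 0 := (sub_pos.2 hab).ne'
      have h4 : 1 + (t - a) / (b - t) = (b - a) / (b - t) := by field_simp; ring
      rw [h4]
      field_simp
      ring
    · rw [(hder s).deriv]
      have := sub_pos.2 hab
      have := hpos s
      positivity
  · set a := sInf (I : Set ℝ)
    have hsub : Ioi a ⊆ I := hI.Ioi_csInf_subset hb ha
    refine ⟨fun t => Real.log (t - a), fun s => a + Real.exp s,
      (contDiffOn_id.sub contDiffOn_const).log fun t ht => (sub_pos.2 (hlow hb t ht)).ne',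
      contDiff_const.add Real.contDiff_exp, fun s => hsub (by simp [Real.exp_pos]), fun s => by simp,
      fun t ht => by simp [Real.exp_log (sub_pos.2 (hlow hb t ht))], fun s => ?_⟩
    rw [((Real.hasDerivAt_exp s).const_add a).deriv]
    exact Real.exp_pos s
  · set b := sSup (I : Set ℝ)
    have hsub : Iio b ⊆ I := hI.Iio_csSup_subset hb ha
    refine ⟨fun t => -Real.log (b - t), fun s => b - Real.exp (-s),
      ((contDiffOn_const.sub contDiffOn_id).log fun t ht => (sub_pos.2 (hup ha t ht)).ne').neg,
      contDiff_const.sub contDiff_neg.exp, fun s => hsub (by simp [Real.exp_pos]), fun s => by simp,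
      fun t ht => by simp [Real.exp_log (sub_pos.2 (hup ha t ht))], fun s => ?_⟩
    rw [((hasDerivAt_neg s).exp.const_sub b).deriv]
    simp [Real.exp_pos]
  · have : (I : Set ℝ) = univ := hI.eq_univ_of_unbounded hb ha
    have hm : ∀ s : ℝ, s ∈ I := fun s => by rw [← SetLike.mem_coe, this]; trivial
    exact ⟨id, id, contDiffOn_id, contDiff_id, hm, fun _ => rfl, fun _ _ => rfl, fun t => by simp⟩

/-- The two intervals are compared through the real line, where multiplication by σ fixes the
orientation. Both orientations are needed: T' must have the sign of p₁. -/
theorem exists_interval_diffeo (I J : Opens ℝ) (hI : IsPreconnected (I : Set ℝ))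
    (hIne : (I : Set ℝ).Nonempty) (hJ : IsPreconnected (J : Set ℝ)) (hJne : (J : Set ℝ).Nonempty)
    {σ : ℝ} (hσ : σ = 1 ∨ σ = -1) :
    ∃ T S : ℝ → ℝ, ContDiffOn ℝ ∞ T I ∧ ContDiffOn ℝ ∞ S J ∧ (∀ t ∈ I, T t ∈ J) ∧
      (∀ t ∈ J, S t ∈ I) ∧ (∀ t ∈ I, S (T t) = t) ∧ (∀ t ∈ J, T (S t) = t) ∧
      ∀ t ∈ I, 0 < σ * deriv T t := by
  obtain ⟨φ, ψ, hφ, hψ, hmem, hφψ, hψφ, hpos⟩ := exists_interval_chart I hI hIne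
  obtain ⟨φ', ψ', hφ', hψ', hmem', hφψ', hψφ', hpos'⟩ := exists_interval_chart J hJ hJne
  have hσ2 : σ * σ = 1 := by rcases hσ with rfl | rfl <;> norm_num
  refine ⟨fun t => ψ' (σ * φ t), fun t => ψ (σ * φ' t), hψ'.comp_contDiffOn (contDiffOn_const.mul hφ),
    hψ.comp_contDiffOn (contDiffOn_const.mul hφ'), fun t _ => hmem' _, fun t _ => hmem _,
    fun t ht => ?_, fun t ht => ?_, fun t ht => ?_⟩
  · simp only [hφψ']
    rw [← mul_assoc, hσ2, one_mul, hψφ t ht]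
  · simp only [hφψ]
    rw [← mul_assoc, hσ2, one_mul, hψφ' t ht]
  · have h1 := ((contDiffAt_of_mem hφ ht).differentiableAt (by simp)).hasDerivAt
    have h2 : ∀ s, HasDerivAt ψ (deriv ψ s) s := fun s =>
      (hψ.contDiffAt.differentiableAt (by simp)).hasDerivAt
    have h3 : ∀ s, HasDerivAt ψ' (deriv ψ' s) s := fun s =>
      (hψ'.contDiffAt.differentiableAt (by simp)).hasDerivAt
    have h4 : deriv ψ (φ t) * deriv φ t = 1 :=
      ((h2 (φ t)).comp t h1).unique ((hasDerivAt_id t).congr_of_eventuallyEq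
        (Filter.eventuallyEq_of_mem (I.isOpen.mem_nhds ht) hψφ))
    have h5 : 0 < deriv φ t := by
      have := hpos (φ t)
      by_contra! hcon
      nlinarith
    have h6 : HasDerivAt (fun t => ψ' (σ * φ t)) (deriv ψ' (σ * φ t) * (σ * deriv φ t)) t :=
      (h3 (σ * φ t)).comp t (h1.const_mul σ)
    rw [h6.deriv]
    have h7 : σ * (deriv ψ' (σ * φ t) * (σ * deriv φ t)) = deriv ψ' (σ * φ t) * deriv φ t := by
      linear_combination (deriv ψ' (σ * φ t) * deriv φ t) * hσ2
    rw [h7]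
    exact mul_pos (hpos' _) h5

/-! ### Jets and prolongation -/

theorem jet_congr {A B : Base → Fib} {y : Base} (h : A =ᶠ[nhds y] B) : jet A y = jet B y := by
  have e : fderiv ℝ A =ᶠ[nhds y] fderiv ℝ B := h.eventuallyEq_nhds.mono fun _ hx => hx.fderiv_eq
  simp only [jet, h.self_of_nhds, e.self_of_nhds, e.fderiv_eq]
  rfl

/-- The base component of jets. -/
def jetBase : Jet →L[ℝ] Base where
  toFun j := j.1
  map_add' _ _ := rfl
  map_smul' _ _ := rfl
  cont := continuous_fst

/-- The value component of jets. -/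
def jetValue : Jet →L[ℝ] Fib where
  toFun j := j.2.1
  map_add' _ _ := rfl
  map_smul' _ _ := rfl
  cont := continuous_fst.comp continuous_snd

/-- The first derivative component of jets. -/
def jetFirst : Jet →L[ℝ] Base →L[ℝ] Fib where
  toFun j := j.2.2.1
  map_add' _ _ := rfl
  map_smul' _ _ := rfl
  cont := continuous_fst.comp (continuous_snd.comp continuous_snd)

/-- The second derivative component of jets. -/
def jetSecond : Jet →L[ℝ] Base →L[ℝ] Base →L[ℝ] Fib where
  toFun j := j.2.2.2
  map_add' _ _ := rfl
  map_smul' _ _ := rfl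
  cont := continuous_snd.comp (continuous_snd.comp continuous_snd)

theorem hasDerivAt_prod₄ {A B C D : Type*} [NormedAddCommGroup A] [NormedSpace ℝ A]
    [NormedAddCommGroup B] [NormedSpace ℝ B] [NormedAddCommGroup C] [NormedSpace ℝ C]
    [NormedAddCommGroup D] [NormedSpace ℝ D] {a : ℝ → A} {b : ℝ → B} {c : ℝ → C} {d : ℝ → D}
    {a' : A} {b' : B} {c' : C} {d' : D} {s : ℝ} (ha : HasDerivAt a a' s) (hb : HasDerivAt b b' s)
    (hc : HasDerivAt c c' s) (hd : HasDerivAt d d' s) :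
    @HasDerivAt ℝ _ (A × B × C × D) (Prod.normedAddCommGroup.toAddCommGroup) (Prod.normedSpace.toModule) _ _
      (fun s => (a s, b s, c s, d s)) (a', b', c', d') s :=
  ha.prodMk (hb.prodMk (hc.prodMk hd))

theorem Delta_differentiableAt {I : Opens ℝ} {c : Coeffs} (hc : c.SmoothNonzeroOn I) {j : Jet}
    (hj : j.1.1 ∈ I) : DifferentiableAt ℝ (Delta c) j := by
  have ht : DifferentiableAt ℝ (fun k : Jet => (jetBase k).1) j :=
    (jetBase.differentiableAt).fst
  have hd : ∀ {φ : ℝ → ℝ}, ContDiffOn ℝ ∞ φ I →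
      DifferentiableAt ℝ (fun k : Jet => φ (jetBase k).1) j := fun {φ} hφ =>
    DifferentiableAt.comp (g := φ) j ((contDiffAt_of_mem hφ hj).differentiableAt (by simp)) ht
  have hdc : ∀ {φ : ℝ → ℝ}, ContDiffOn ℝ ∞ φ I →
      DifferentiableAt ℝ (fun k : Jet => (φ (jetBase k).1 : ℂ)) j := fun hφ =>
    Complex.ofRealCLM.differentiableAt.comp j (hd hφ)
  have h1 := hdc hc.smooth_p₁
  have h2 := hdc hc.smooth_p₂
  have h3 := hdc hc.smooth_q₁
  have h4 := hdc hc.smooth_q₂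
  have h5 := hd hc.smooth_r₁
  have h6 := hd hc.smooth_r₂
  have hn : ∀ {f : Jet → ℂ} {x : Jet},
      DifferentiableAt ℝ f x → DifferentiableAt ℝ (fun y => Complex.normSq (f y)) x := by
    intro f x hf
    have e : (fun y => Complex.normSq (f y)) = fun y => (f y).re * (f y).re + (f y).im * (f y).im := by
      funext y; exact Complex.normSq_apply _
    rw [e]
    have h1 : DifferentiableAt ℝ (fun y => (f y).re) x := Complex.reCLM.differentiableAt.comp x hf
    have h2 : DifferentiableAt ℝ (fun y => (f y).im) x := Complex.imCLM.differentiableAt.comp x hf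
    exact (h1.mul h1).add (h2.mul h2)
  have a1 : ∀ v : Base, DifferentiableAt ℝ (fun k : Jet => jetFirst k v) j := fun v =>
    jetFirst.differentiableAt.clm_apply (differentiableAt_const v)
  have a2 : ∀ v : Base, DifferentiableAt ℝ (fun k : Jet => jetSecond k v v) j := fun v =>
    (jetSecond.differentiableAt.clm_apply (differentiableAt_const v)).clm_apply
      (differentiableAt_const v)
  have b : DifferentiableAt ℝ (fun k : Jet => (jetValue k).1) j := jetValue.differentiableAt.fst
  have b2 : DifferentiableAt ℝ (fun k : Jet => ((jetValue k).2 : ℂ)) j :=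
    Complex.ofRealCLM.differentiableAt.comp j jetValue.differentiableAt.snd
  have bc : DifferentiableAt ℝ (fun k : Jet => starRingEnd ℂ (jetValue k).1) j :=
    Complex.conjCLE.differentiableAt.comp j b
  have nψ : DifferentiableAt ℝ (fun k : Jet => (Complex.normSq (jetValue k).1 : ℂ)) j :=
    Complex.ofRealCLM.differentiableAt.comp j (hn b)
  have E1 := ((((a1 et).fst.const_mul Complex.I).add (h1.mul (a2 ex).fst)).add
    (h2.mul (a2 ey).fst)).sub (((h3.mul nψ).mul b).add ((h4.mul b).mul b2))
  have re : DifferentiableAt ℝ (fun k : Jet =>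
      (starRingEnd ℂ (jetValue k).1 * (jetSecond k ey ey).1).re) j :=
    Complex.reCLM.differentiableAt.comp j (bc.mul (a2 ey).fst)
  have E2 := ((a2 ex).snd.add (h5.mul (a2 ey).snd)).sub
    (h6.mul ((re.const_mul 2).add ((hn (a1 ey).fst).const_mul 2)))
  exact E1.prodMk E2

/-- The derivative of the jets of `F + s Q` along a curve. -/
theorem hasDerivAt_jet {F Q : Base → Fib} {z ξ : Base} {γ : ℝ → Base} (hF : ContDiffAt ℝ ∞ F z)
    (hQ : ContDiffAt ℝ ∞ Q z) (hγ : HasDerivAt γ ξ 0) (hz : γ 0 = z) :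
    HasDerivAt (F := Jet) (fun s => jet (fun y => F y + s • Q y) (γ s))
      ((ξ, fderiv ℝ F z ξ + Q z, fderiv ℝ (fderiv ℝ F) z ξ + fderiv ℝ Q z,
        fderiv ℝ (fderiv ℝ (fderiv ℝ F)) z ξ + fderiv ℝ (fderiv ℝ Q) z) : Jet) 0 := by
  subst hz
  have F1 : ContDiffAt ℝ ∞ (fderiv ℝ F) (γ 0) := hF.fderiv_right (by simp)
  have F2 : ContDiffAt ℝ ∞ (fderiv ℝ (fderiv ℝ F)) (γ 0) := F1.fderiv_right (by simp)
  have Q1 : ContDiffAt ℝ ∞ (fderiv ℝ Q) (γ 0) := hQ.fderiv_right (by simp)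
  have Q2 : ContDiffAt ℝ ∞ (fderiv ℝ (fderiv ℝ Q)) (γ 0) := Q1.fderiv_right (by simp)
  have key : ∀ {X : Type} [NormedAddCommGroup X] [NormedSpace ℝ X] {f q : Base → X},
      ContDiffAt ℝ ∞ f (γ 0) → ContDiffAt ℝ ∞ q (γ 0) →
      HasDerivAt (fun s => f (γ s) + s • q (γ s)) (fderiv ℝ f (γ 0) ξ + q (γ 0)) 0 := by
    intro X _ _ f q hf hq
    have h1 := (hf.differentiableAt (by simp)).hasFDerivAt.comp_hasDerivAt 0 hγ
    have h2 := (hq.differentiableAt (by simp)).hasFDerivAt.comp_hasDerivAt 0 hγ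
    have h3 := (hasDerivAt_id (0 : ℝ)).smul h2
    refine (h1.add h3).congr_deriv ?_
    simp
  have main := hasDerivAt_prod₄ hγ (key hF hQ) (key F1 Q1) (key F2 Q2)
  refine HasDerivAt.congr_of_eventuallyEq (F := Jet) main ?_
  have ev : ∀ᶠ y in nhds (γ 0), ∀ᶠ y' in nhds y, ContDiffAt ℝ 2 F y' ∧ ContDiffAt ℝ 2 Q y' := by
    have two : (2 : WithTop ℕ∞) ≤ ∞ := WithTop.coe_le_coe.2 (le_top : (2 : ℕ∞) ≤ ⊤)
    exact (((hF.of_le two).eventually (by simp)).and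
      ((hQ.of_le two).eventually (by simp))).eventually_nhds
  filter_upwards [hγ.continuousAt.eventually ev] with s hs
  have d1 : (fderiv ℝ fun y => F y + s • Q y) =ᶠ[nhds (γ s)]
      fun y => fderiv ℝ F y + s • fderiv ℝ Q y := by
    filter_upwards [hs] with y hy
    have h2 := (hy.2.differentiableAt (by norm_num))
    rw [fderiv_fun_add (hy.1.differentiableAt (by norm_num)) (h2.fun_const_smul s), fderiv_fun_const_smul h2]
  have d2 : fderiv ℝ (fderiv ℝ fun y => F y + s • Q y) (γ s)
      = fderiv ℝ (fderiv ℝ F) (γ s) + s • fderiv ℝ (fderiv ℝ Q) (γ s) := by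
    have h1 := ((hs.self_of_nhds.1.fderiv_right (m := 1) (by norm_num)).differentiableAt (by norm_num))
    have h2 := ((hs.self_of_nhds.2.fderiv_right (m := 1) (by norm_num)).differentiableAt (by norm_num))
    rw [d1.fderiv_eq, fderiv_fun_add h1 (h2.fun_const_smul s), fderiv_fun_const_smul h2]
  simp only [jet]
  rw [d1.self_of_nhds, d2]

/-- The prolongation of a field as the derivative of a family of jets. -/
theorem hasDerivAt_jet_characteristic {I : Opens ℝ} (V : VField I) {F : Base → Fib} {z : Base}
    (hz : z.1 ∈ I) (hF : ContDiffAt ℝ ∞ F z) {γ : ℝ → Base} (hγ : HasDerivAt γ (V.1 (z, F z)).1 0)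
    (h0 : γ 0 = z) :
    HasDerivAt (fun s => jet (fun y => F y + s • characteristic V.1 F y) (γ s)) (prolong V.1 F z) 0 := by
  refine (hasDerivAt_jet hF (contDiffAt_characteristic V hz hF) hγ h0).congr_deriv ?_
  refine Prod.ext rfl (Prod.ext ?_ (Prod.ext ?_ ?_))
  · exact add_sub_cancel (fderiv ℝ F z (V.1 (z, F z)).1) (V.1 (z, F z)).2
  · exact add_comm (fderiv ℝ (fderiv ℝ F) z (V.1 (z, F z)).1) _
  · exact add_comm (fderiv ℝ (fderiv ℝ (fderiv ℝ F)) z (V.1 (z, F z)).1) _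

/-- Turns the infinitesimal symmetry condition into the derivative of a one-parameter family of
functions, which a point transformation can carry along. The curve `γ` matters only through its
position and velocity at 0, so it may be replaced by its image under the base map. -/
theorem hasDerivAt_Delta_jet {I : Opens ℝ} {c : Coeffs} (hc : c.SmoothNonzeroOn I)
    (V : VField I) {F : Base → Fib} {z : Base}
    (hz : z.1 ∈ I) (hF : ContDiffAt ℝ ∞ F z) {γ : ℝ → Base} (hγ : HasDerivAt γ (V.1 (z, F z)).1 0)
    (h0 : γ 0 = z) :
    HasDerivAt (fun s => Delta c (jet (fun y => F y + s • characteristic V.1 F y) (γ s)))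
      (fderiv ℝ (Delta c) (jet F z) (prolong V.1 F z)) 0 := by
  have hj : jet (fun y => F y + (0 : ℝ) • characteristic V.1 F y) (γ 0) = jet F z := by
    simp [h0]
  have hD : HasFDerivAt (Delta c) (fderiv ℝ (Delta c) (jet F z))
      (jet (fun y => F y + (0 : ℝ) • characteristic V.1 F y) (γ 0)) := by
    rw [hj]; exact (Delta_differentiableAt hc (j := jet F z) hz).hasFDerivAt
  exact hD.comp_hasDerivAt 0 (hasDerivAt_jet_characteristic V hz hF hγ h0)

/-! ### Transport of symmetries -/

section Transport

variable {I J : Opens ℝ} {c c' : Coeffs} {T S α β L α₀ β₀ θ₀ : ℝ → ℝ}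

/-- The diffeomorphism of the space of all variables given by an equivalence transformation. -/
noncomputable def Admissible.diffeo (hc : c.SmoothNonzeroOn I) (h : Admissible c c' I T α β L)
    (hα₀ : ContDiffOn ℝ ∞ α₀ I) (hβ₀ : ContDiffOn ℝ ∞ β₀ I) (hθ₀ : ContDiffOn ℝ ∞ θ₀ I)
    (hS : ContDiffOn ℝ ∞ S J) (hTJ : ∀ t ∈ I, T t ∈ J) (hSI : ∀ t ∈ J, S t ∈ I)
    (hST : ∀ t ∈ I, S (T t) = t) (hTS : ∀ t ∈ J, T (S t) = t) : DomDiffeo I J where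
  toFun p := ((equivTransformation c T α β L α₀ β₀ θ₀).base p.1,
    (amplitude c α β α₀ β₀ θ₀ p.1)⁻¹ * p.2.1,
    (p.2.2 - shift c α β α₀ β₀ θ₀ p.1.1 p.1.2.1 p.1.2.2) / L p.1.1)
  invFun q := (fun z : Base => ((z, amplitude c α β α₀ β₀ θ₀ z * q.2.1,
      L z.1 * q.2.2 + shift c α β α₀ β₀ θ₀ z.1 z.2.1 z.2.2) : Tot))
    (S q.1.1, (q.1.2.1 - α₀ (S q.1.1)) / α (S q.1.1), (q.1.2.2 - β₀ (S q.1.1)) / β (S q.1.1))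
  contDiffOn_toFun p hp := by
    have hp' : p.1.1 ∈ I := hp
    have h1 : ContDiffAt ℝ ∞ (fun p : Tot => p.1) p := contDiffAt_fst
    have h2 := (amplitude_contDiffAt hc h hα₀ hβ₀ hθ₀ hp').comp p h1
    have h3 := (shift_contDiffAt hc h hα₀ hβ₀ hθ₀ hp').comp p h1
    have h4 := (contDiffAt_time (contDiffAt_of_mem h.smooth_L hp')).comp p h1
    exact (((base_contDiffAt (θ₀ := θ₀) h hα₀ hβ₀ hp').comp p h1).prodMk
      (((h2.inv (amplitude_ne_zero h hp')).mul (contDiffAt_fst.comp p contDiffAt_snd)).prodMk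
        (((contDiffAt_snd.comp p contDiffAt_snd).sub h3).div h4
          (h.L_ne_zero _ hp')))).contDiffWithinAt
  contDiffOn_invFun q hq := by
    have hq' : q.1.1 ∈ J := hq
    have hs := hSI _ hq'
    have h1 : ContDiffAt ℝ ∞ (fun q : Tot => q.1.1) q := contDiffAt_fst.comp q contDiffAt_fst
    have hS' : ContDiffAt ℝ ∞ (fun q : Tot => S q.1.1) q := (contDiffAt_of_mem hS hq').comp q h1
    have tm : ∀ {φ : ℝ → ℝ}, ContDiffOn ℝ ∞ φ I → ContDiffAt ℝ ∞ (fun q : Tot => φ (S q.1.1)) q :=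
      fun hφ => ContDiffAt.comp (g := _) q (contDiffAt_of_mem hφ hs) hS'
    have hx : ContDiffAt ℝ ∞ (fun q : Tot => q.1.2.1) q :=
      contDiffAt_fst.comp q (contDiffAt_snd.comp q contDiffAt_fst)
    have hy : ContDiffAt ℝ ∞ (fun q : Tot => q.1.2.2) q :=
      contDiffAt_snd.comp q (contDiffAt_snd.comp q contDiffAt_fst)
    have hb : ContDiffAt ℝ ∞ (fun q : Tot => ((S q.1.1, (q.1.2.1 - α₀ (S q.1.1)) / α (S q.1.1),
        (q.1.2.2 - β₀ (S q.1.1)) / β (S q.1.1)) : Base)) q :=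
      hS'.prodMk (((hx.sub (tm hα₀)).div (tm h.smooth_α) (h.α_pos _ hs).ne').prodMk
        ((hy.sub (tm hβ₀)).div (tm h.smooth_β) (h.β_pos _ hs).ne'))
    have h2 := ContDiffAt.comp (f := fun q : Tot => ((S q.1.1, (q.1.2.1 - α₀ (S q.1.1)) / α (S q.1.1),
        (q.1.2.2 - β₀ (S q.1.1)) / β (S q.1.1)) : Base)) q
        (amplitude_contDiffAt hc h hα₀ hβ₀ hθ₀ hs) hb
    have h3 := ContDiffAt.comp (f := fun q : Tot => ((S q.1.1, (q.1.2.1 - α₀ (S q.1.1)) / α (S q.1.1),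
        (q.1.2.2 - β₀ (S q.1.1)) / β (S q.1.1)) : Base)) q
        (shift_contDiffAt hc h hα₀ hβ₀ hθ₀ hs) hb
    exact (hb.prodMk ((h2.mul (contDiffAt_fst.comp q contDiffAt_snd)).prodMk
      (((tm h.smooth_L).mul (contDiffAt_snd.comp q contDiffAt_snd)).add h3))).contDiffWithinAt
  mapsTo p hp := hTJ _ hp
  mapsTo_inv q hq := hSI _ hq
  left_inv := by
    rintro ⟨⟨t, x, y⟩, a, b⟩ hp
    have hp' : t ∈ I := hp
    have e2 : (α t * x + α₀ t - α₀ t) / α t = x := by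
      rw [add_sub_cancel_right, mul_div_cancel_left₀ _ (h.α_pos _ hp').ne']
    have e3 : (β t * y + β₀ t - β₀ t) / β t = y := by
      rw [add_sub_cancel_right, mul_div_cancel_left₀ _ (h.β_pos _ hp').ne']
    have hm := amplitude_ne_zero (α₀ := α₀) (β₀ := β₀) (θ₀ := θ₀) (z := (t, x, y)) h hp'
    have hL := h.L_ne_zero _ hp'
    simp only [equivTransformation, hST t hp', e2, e3]
    rw [mul_inv_cancel_left₀ hm, mul_div_cancel₀ _ hL, sub_add_cancel]
  right_inv := by
    rintro ⟨⟨t, x, y⟩, a, b⟩ hq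
    have hq' : t ∈ J := hq
    have hs := hSI _ hq'
    have h1 := (h.α_pos _ hs).ne'
    have h2 := (h.β_pos _ hs).ne'
    have hL := h.L_ne_zero _ hs
    have hm := amplitude_ne_zero (α₀ := α₀) (β₀ := β₀) (θ₀ := θ₀)
      (z := (S t, (x - α₀ (S t)) / α (S t), (y - β₀ (S t)) / β (S t))) h hs
    simp only [equivTransformation]
    rw [inv_mul_cancel_left₀ hm, mul_div_cancel₀ _ h1, mul_div_cancel₀ _ h2, sub_add_cancel,
      sub_add_cancel, add_sub_cancel_right, mul_div_cancel_left₀ _ hL, hTS t hq']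

variable (Φ : DomDiffeo I J)

/-- A diffeomorphism of the space of all variables is the graph version of an equivalence
transformation. -/
def Represents (Φ : DomDiffeo I J) (G : FiberMap) : Prop :=
  ∀ p ∈ dom I, (Φ.toFun p).1 = G.base p.1 ∧ G.psi p.1 (Φ.toFun p).2.1 = p.2.1 ∧
    G.w p.1 (Φ.toFun p).2.2 = p.2.2

theorem Admissible.diffeo_represents (hc : c.SmoothNonzeroOn I) (h : Admissible c c' I T α β L)
    (hα₀ : ContDiffOn ℝ ∞ α₀ I) (hβ₀ : ContDiffOn ℝ ∞ β₀ I) (hθ₀ : ContDiffOn ℝ ∞ θ₀ I)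
    (hS : ContDiffOn ℝ ∞ S J) (hTJ : ∀ t ∈ I, T t ∈ J) (hSI : ∀ t ∈ J, S t ∈ I)
    (hST : ∀ t ∈ I, S (T t) = t) (hTS : ∀ t ∈ J, T (S t) = t) :
    Represents (h.diffeo hc hα₀ hβ₀ hθ₀ hS hTJ hSI hST hTS)
      (equivTransformation c T α β L α₀ β₀ θ₀) := by
  intro p hp
  have hm := amplitude_ne_zero (α₀ := α₀) (β₀ := β₀) (θ₀ := θ₀) h hp
  have hL := h.L_ne_zero _ hp
  refine ⟨rfl, mul_inv_cancel_left₀ hm _, ?_⟩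
  change L p.1.1 * ((p.2.2 - shift c α β α₀ β₀ θ₀ p.1.1 p.1.2.1 p.1.2.2) / L p.1.1)
    + shift c α β α₀ β₀ θ₀ p.1.1 p.1.2.1 p.1.2.2 = p.2.2
  rw [mul_div_cancel₀ _ hL, sub_add_cancel]

theorem Represents.graph {Φ : DomDiffeo I J} {G : FiberMap} (hΦ : Represents Φ G)
    (h : Admissible c c' I T α β L) (hG : G = equivTransformation c T α β L α₀ β₀ θ₀)
    (F : Base → Fib) {y : Base} (hy : y.1 ∈ I) :
    Φ.toFun (y, G.pull F y) = (G.base y, F (G.base y)) := by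
  subst hG
  obtain ⟨h1, h2, h3⟩ := hΦ (y, (equivTransformation c T α β L α₀ β₀ θ₀).pull F y) hy
  refine Prod.ext h1 (Prod.ext ?_ ?_)
  · exact mul_left_cancel₀ (amplitude_ne_zero (α₀ := α₀) (β₀ := β₀) (θ₀ := θ₀) h hy) h2
  · exact mul_left_cancel₀ (h.L_ne_zero _ hy) (add_right_cancel h3)

/-- The characteristics of a field and of its pushforward. -/
theorem characteristic_pull {Φ : DomDiffeo I J} (hc : c.SmoothNonzeroOn I)
    (h : Admissible c c' I T α β L)
    (hα₀ : ContDiffOn ℝ ∞ α₀ I) (hβ₀ : ContDiffOn ℝ ∞ β₀ I) (hθ₀ : ContDiffOn ℝ ∞ θ₀ I)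
    (hΦ : Represents Φ (equivTransformation c T α β L α₀ β₀ θ₀)) (V : Tot → Tot)
    {F' : Base → Fib} {z : Base} (hz : z.1 ∈ I)
    (hF' : DifferentiableAt ℝ F' ((equivTransformation c T α β L α₀ β₀ θ₀).base z)) :
    characteristic V ((equivTransformation c T α β L α₀ β₀ θ₀).pull F') z
      = (amplitude c α β α₀ β₀ θ₀ z * (characteristic (Φ.pushFun V) F'
          ((equivTransformation c T α β L α₀ β₀ θ₀).base z)).1,
        L z.1 * (characteristic (Φ.pushFun V) F'
          ((equivTransformation c T α β L α₀ β₀ θ₀).base z)).2) := by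
  set G := equivTransformation c T α β L α₀ β₀ θ₀ with hGdef
  set F := G.pull F' with hFdef
  have hgr : Φ.toFun (z, F z) = (G.base z, F' (G.base z)) := hΦ.graph h hGdef F' hz
  -- `P` gives (ψ, w) from the old base point and (ψ̃, w̃). Differentiating both P(p.1, (Φ p).2) =
  -- p.2 and F = P(·, F' ∘ G) and subtracting removes the base derivatives of `P`. What remains is
  -- its fibre derivative applied to the characteristic of the pushed field.
  let P : Base × Fib → Fib := fun q => (amplitude c α β α₀ β₀ θ₀ q.1 * q.2.1,
    L q.1.1 * q.2.2 + shift c α β α₀ β₀ θ₀ q.1.1 q.1.2.1 q.1.2.2)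
  set u := F' (G.base z)
  have hPsm : ContDiffAt ℝ ∞ P (z, u) := by
    have h1 : ContDiffAt ℝ ∞ (fun p : Tot => p.1) (z, u) := contDiffAt_fst
    have h2 := (amplitude_contDiffAt hc h hα₀ hβ₀ hθ₀ hz).comp (z, u) h1
    have h3 := (shift_contDiffAt hc h hα₀ hβ₀ hθ₀ hz).comp (z, u) h1
    have h4 := (contDiffAt_time (contDiffAt_of_mem h.smooth_L hz)).comp (z, u) h1
    exact (h2.mul (contDiffAt_fst.comp _ contDiffAt_snd)).prodMk
      ((h4.mul (contDiffAt_snd.comp _ contDiffAt_snd)).add h3)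
  have hP : HasFDerivAt P (fderiv ℝ P (z, u)) (z, u) := (hPsm.differentiableAt (by simp)).hasFDerivAt
  have hdomz : ((z, F z) : Tot) ∈ dom I := hz
  have hΦd := (Φ.differentiableAt hdomz).hasFDerivAt
  set D := fderiv ℝ Φ.toFun (z, F z)
  -- the fibre components
  have h1 : HasFDerivAt (fun p : Tot => P (p.1, (Φ.toFun p).2))
      ((fderiv ℝ P (z, u)).comp ((ContinuousLinearMap.fst ℝ Base Fib).prod
        ((ContinuousLinearMap.snd ℝ Base Fib).comp D))) (z, F z) := by
    have hin : HasFDerivAt (fun p : Tot => (p.1, (Φ.toFun p).2))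
        ((ContinuousLinearMap.fst ℝ Base Fib).prod ((ContinuousLinearMap.snd ℝ Base Fib).comp D))
        (z, F z) := hasFDerivAt_fst.prodMk (hasFDerivAt_snd.comp _ hΦd)
    refine HasFDerivAt.comp (g := P) (z, F z) ?_ hin
    simp only [hgr]
    exact hP
  have e1 : (fderiv ℝ P (z, u)).comp ((ContinuousLinearMap.fst ℝ Base Fib).prod
        ((ContinuousLinearMap.snd ℝ Base Fib).comp D)) = ContinuousLinearMap.snd ℝ Base Fib := by
    refine h1.unique (hasFDerivAt_snd.congr_of_eventuallyEq ?_)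
    filter_upwards [(isOpen_dom I).mem_nhds hdomz] with p hp
    exact Prod.ext (hΦ p hp).2.1 (hΦ p hp).2.2
  have hGd : HasFDerivAt G.base (fderiv ℝ G.base z) z :=
    ((base_contDiffAt h hα₀ hβ₀ hz).differentiableAt (by simp)).hasFDerivAt
  have h2 : HasFDerivAt (fun p : Tot => (Φ.toFun p).1) ((ContinuousLinearMap.fst ℝ Base Fib).comp D)
      (z, F z) := hasFDerivAt_fst.comp _ hΦd
  have e2 : (ContinuousLinearMap.fst ℝ Base Fib).comp D
      = (fderiv ℝ G.base z).comp (ContinuousLinearMap.fst ℝ Base Fib) := by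
    refine h2.unique ((HasFDerivAt.comp (g := G.base) (f := Prod.fst) (z, F z) hGd
      hasFDerivAt_fst).congr_of_eventuallyEq ?_)
    filter_upwards [(isOpen_dom I).mem_nhds hdomz] with p hp
    exact (hΦ p hp).1
  have h3 : HasFDerivAt F ((fderiv ℝ P (z, u)).comp ((ContinuousLinearMap.id ℝ Base).prod
      ((fderiv ℝ F' (G.base z)).comp (fderiv ℝ G.base z)))) z :=
    HasFDerivAt.comp (g := P) z hP ((hasFDerivAt_id z).prodMk (hF'.hasFDerivAt.comp z hGd))
  have e3 := h3.fderiv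
  have hV : Φ.pushFun V (G.base z, u) = D (V (z, F z)) := by
    rw [← hgr]; exact Φ.pushFun_toFun V hdomz
  have hvert : ∀ q : Fib, fderiv ℝ P (z, u) (0, q) = (amplitude c α β α₀ β₀ θ₀ z * q.1, L z.1 * q.2) := by
    intro q
    have h4 : HasFDerivAt (fun r : Fib => P (z, r))
        ((fderiv ℝ P (z, u)).comp ((0 : Fib →L[ℝ] Base).prod (ContinuousLinearMap.id ℝ Fib))) u :=
      HasFDerivAt.comp (g := P) u hP ((hasFDerivAt_const z u).prodMk (hasFDerivAt_id u))
    have h5 : HasFDerivAt (fun r : Fib => P (z, r))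
        ((amplitude c α β α₀ β₀ θ₀ z • ContinuousLinearMap.fst ℝ ℂ ℝ).prod
          (L z.1 • ContinuousLinearMap.snd ℝ ℂ ℝ)) u :=
      (hasFDerivAt_fst.const_mul (amplitude c α β α₀ β₀ θ₀ z)).prodMk
        ((hasFDerivAt_snd.const_mul (L z.1)).add_const (shift c α β α₀ β₀ θ₀ z.1 z.2.1 z.2.2))
    have := congrArg (fun A => A q) (h4.unique h5)
    simpa using this
  set v := V (z, F z)
  have k1 : fderiv ℝ P (z, u) (v.1, (D v).2) = v.2 := congrArg (fun A => A v) e1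
  have k2 : (D v).1 = fderiv ℝ G.base z v.1 := congrArg (fun A => A v) e2
  have k3 : fderiv ℝ F z v.1 = fderiv ℝ P (z, u) (v.1, fderiv ℝ F' (G.base z) (D v).1) := by
    rw [e3, k2]; rfl
  rw [← hvert]
  simp only [characteristic]
  rw [hV]
  change v.2 - fderiv ℝ F z v.1 = _
  rw [← k1, k3, ← map_sub]
  simp

/-- With Q and Q' the characteristics of the field and of its pushforward, F + s Q is the pullback
of F' + s Q' for every s, because the transformation is affine in the fibre. `Delta_pull` then
relates the equations along the two families, and the claim is the derivative at s = 0. -/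
theorem fderiv_Delta_prolong {Φ : DomDiffeo I J} (hc : c.SmoothNonzeroOn I)
    (hc' : c'.SmoothNonzeroOn J) (h : Admissible c c' I T α β L)
    (hα₀ : ContDiffOn ℝ ∞ α₀ I) (hβ₀ : ContDiffOn ℝ ∞ β₀ I) (hθ₀ : ContDiffOn ℝ ∞ θ₀ I)
    (hΦ : Represents Φ (equivTransformation c T α β L α₀ β₀ θ₀)) (V : VField I)
    {F F' : Base → Fib} {z : Base} (hz : z.1 ∈ I)
    (hF' : ContDiffAt ℝ ∞ F' ((equivTransformation c T α β L α₀ β₀ θ₀).base z))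
    (hFF' : F =ᶠ[nhds z] (equivTransformation c T α β L α₀ β₀ θ₀).pull F')
    (hsol : Delta c' (jet F' ((equivTransformation c T α β L α₀ β₀ θ₀).base z)) = 0) :
    Delta c (jet F z) = 0 ∧
    (fderiv ℝ (Delta c) (jet F z) (prolong V.1 F z) = 0 ↔
      fderiv ℝ (Delta c') (jet F' ((equivTransformation c T α β L α₀ β₀ θ₀).base z))
        (prolong (Φ.push V).1 F' ((equivTransformation c T α β L α₀ β₀ θ₀).base z)) = 0) := by
  have two : (2 : WithTop ℕ∞) ≤ ∞ := WithTop.coe_le_coe.2 (le_top : (2 : ℕ∞) ≤ ⊤)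
  set G := equivTransformation c T α β L α₀ β₀ θ₀ with hGdef
  have hGz := (base_contDiffAt (θ₀ := θ₀) h hα₀ hβ₀ hz)
  have hF : ContDiffAt ℝ ∞ F z :=
    (contDiffAt_pull hc h hα₀ hβ₀ hθ₀ hz (n := ⊤) hF').congr_of_eventuallyEq hFF'
  have hzJ : (G.base z).1 ∈ J := by
    have := (hΦ (z, 0) hz).1
    rw [← this]; exact Φ.mapsTo hz
  refine ⟨by rw [jet_congr hFF', Delta_pull hc h hα₀ hβ₀ hθ₀ hz (hF'.of_le two), ← hGdef, hsol]; simp, ?_⟩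
  set ξ := (V.1 (z, F z)).1 with hξ
  let γ : ℝ → Base := fun s => z + s • ξ
  have hγ : HasDerivAt γ ξ 0 := by
    simpa [γ] using ((hasDerivAt_id (0 : ℝ)).smul_const ξ).const_add z
  have hγ0 : γ 0 = z := by simp [γ]
  have hgr : Φ.toFun (z, F z) = (G.base z, F' (G.base z)) := by
    rw [hFF'.self_of_nhds]; exact hΦ.graph h hGdef F' hz
  have hγ' : HasDerivAt (fun s => G.base (γ s)) ((Φ.push V).1 (G.base z, F' (G.base z))).1 0 := by
    have hd : HasFDerivAt G.base (fderiv ℝ G.base z) (γ 0) := by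
      rw [hγ0]; exact (hGz.differentiableAt (by simp)).hasFDerivAt
    refine (hd.comp_hasDerivAt 0 hγ).congr_deriv ?_
    have hdomz : ((z, F z) : Tot) ∈ dom I := hz
    have h2 : HasFDerivAt (fun p : Tot => (Φ.toFun p).1)
        ((ContinuousLinearMap.fst ℝ Base Fib).comp (fderiv ℝ Φ.toFun (z, F z))) (z, F z) :=
      hasFDerivAt_fst.comp _ (Φ.differentiableAt hdomz).hasFDerivAt
    have e2 : (ContinuousLinearMap.fst ℝ Base Fib).comp (fderiv ℝ Φ.toFun (z, F z))
        = (fderiv ℝ G.base z).comp (ContinuousLinearMap.fst ℝ Base Fib) := by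
      refine h2.unique ((HasFDerivAt.comp (g := G.base) (f := Prod.fst) (z, F z)
        (hGz.differentiableAt (by simp)).hasFDerivAt hasFDerivAt_fst).congr_of_eventuallyEq ?_)
      filter_upwards [(isOpen_dom I).mem_nhds hdomz] with p hp
      exact (hΦ p hp).1
    have e3 : (Φ.push V).1 (G.base z, F' (G.base z)) = fderiv ℝ Φ.toFun (z, F z) (V.1 (z, F z)) := by
      rw [← hgr]; exact Φ.pushFun_toFun V.1 hdomz
    rw [e3]
    exact (congrArg (fun A => A (V.1 (z, F z))) e2).symm
  have D1 := hasDerivAt_Delta_jet hc V hz hF hγ hγ0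
  have D2 := hasDerivAt_Delta_jet hc' (Φ.push V) hzJ hF' hγ' (by simp [hγ0])
  set Q := characteristic V.1 F with hQdef
  set Q' := characteristic (Φ.push V).1 F' with hQ'def
  have hQ' : ContDiffAt ℝ ∞ Q' (G.base z) := contDiffAt_characteristic (Φ.push V) hzJ hF'
  -- the perturbed functions correspond to each other
  have hpert : ∀ᶠ y in nhds z, ∀ s : ℝ, F y + s • Q y = G.pull (fun y => F' y + s • Q' y) y := by
    have c1 : ∀ᶠ y in nhds z, ContDiffAt ℝ 2 F' (G.base y) :=
      hGz.continuousAt.eventually ((hF'.of_le two).eventually (by simp))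
    filter_upwards [slab_mem_nhds I hz, hFF'.eventuallyEq_nhds, c1] with y hy hFy hcd s
    have hQy : Q y = characteristic V.1 (G.pull F') y := by
      simp only [hQdef, characteristic, hFy.self_of_nhds, hFy.fderiv_eq]
    rw [hQy, characteristic_pull hc h hα₀ hβ₀ hθ₀ hΦ V.1 hy (hcd.differentiableAt (by norm_num)),
      hFy.self_of_nhds]
    change _ = (_, _)
    simp only [hGdef, equivTransformation, FiberMap.pull]
    refine Prod.ext ?_ ?_
    · simp only [Prod.fst_add, Prod.smul_fst, Complex.real_smul, amplitude]
      change _ + s * (_ * (Q' _).1) = _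
      ring
    · simp only [Prod.snd_add, Prod.smul_snd, smul_eq_mul]
      change _ + s * (_ * (Q' _).2) = _
      ring
  have hev : ∀ᶠ s in nhds (0 : ℝ), Delta c (jet (fun y => F y + s • Q y) (γ s))
      = (deriv T (γ s).1 * amplitude c α β α₀ β₀ θ₀ (γ s)
          * (Delta c' (jet (fun y => F' y + s • Q' y) (G.base (γ s)))).1,
        L (γ s).1 * α (γ s).1 ^ 2 * (Delta c' (jet (fun y => F' y + s • Q' y) (G.base (γ s)))).2) := by
    have hcont : Filter.Tendsto γ (nhds 0) (nhds z) := by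
      have := hγ.continuousAt.tendsto
      rwa [hγ0] at this
    have c1 : ∀ᶠ y in nhds z, ContDiffAt ℝ 2 F' (G.base y) ∧ ContDiffAt ℝ 2 Q' (G.base y) :=
      hGz.continuousAt.eventually (((hF'.of_le two).eventually (by simp)).and
        ((hQ'.of_le two).eventually (by simp)))
    filter_upwards [hcont.eventually hpert.eventually_nhds, hcont.eventually (slab_mem_nhds I hz),
      hcont.eventually c1] with s hs hsI hcd
    have e : (fun y => F y + s • Q y) =ᶠ[nhds (γ s)] G.pull (fun y => F' y + s • Q' y) :=
      hs.mono fun y hy => hy s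
    rw [jet_congr e, Delta_pull hc h hα₀ hβ₀ hθ₀ hsI (hcd.1.add (hcd.2.const_smul s))]
  have htime : HasDerivAt (fun s => (γ s).1) ξ.1 0 :=
    (hasFDerivAt_fst (p := γ 0)).comp_hasDerivAt (𝕜 := ℝ) 0 hγ
  have d1 : DifferentiableAt ℝ (fun s => ((deriv T (γ s).1 : ℝ) : ℂ) * amplitude c α β α₀ β₀ θ₀ (γ s)) 0 := by
    have a1 : DifferentiableAt ℝ (deriv T) (γ 0).1 := by
      rw [hγ0]; exact (contDiffAt_deriv_of_mem h.smooth_T hz).differentiableAt (by simp)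
    have a2 : DifferentiableAt ℝ (amplitude c α β α₀ β₀ θ₀) (γ 0) := by
      rw [hγ0]; exact (amplitude_contDiffAt hc h hα₀ hβ₀ hθ₀ hz).differentiableAt (by simp)
    have a3 : DifferentiableAt ℝ (fun s => deriv T (γ s).1) 0 := by
      exact DifferentiableAt.comp (g := deriv T) 0 a1 htime.differentiableAt
    exact (Complex.ofRealCLM.differentiableAt.comp (0 : ℝ) a3).mul (a2.comp 0 hγ.differentiableAt)
  have d2 : DifferentiableAt ℝ (fun s => L (γ s).1 * α (γ s).1 ^ 2) 0 := by
    have a1 : DifferentiableAt ℝ L (γ 0).1 := by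
      rw [hγ0]; exact (contDiffAt_of_mem h.smooth_L hz).differentiableAt (by simp)
    have a2 : DifferentiableAt ℝ α (γ 0).1 := by
      rw [hγ0]; exact (contDiffAt_of_mem h.smooth_α hz).differentiableAt (by simp)
    exact (DifferentiableAt.comp (g := L) 0 a1 htime.differentiableAt).mul
      ((DifferentiableAt.comp (g := α) 0 a2 htime.differentiableAt).pow 2)
  -- The equations hold at s = 0, so the derivatives of the factors do not contribute to the product
  -- rule; only the nonzero values of the factors remain.
  have hzero : Delta c' (jet (fun y => F' y + (0 : ℝ) • Q' y) (G.base (γ 0))) = 0 := by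
    simpa [hγ0] using hsol
  have D2a := hasFDerivAt_fst.comp_hasDerivAt 0 D2
  have D2b := hasFDerivAt_snd.comp_hasDerivAt 0 D2
  have D3 := ((d1.hasDerivAt.mul D2a).prodMk (d2.hasDerivAt.mul D2b)).congr_of_eventuallyEq hev
  have key := D1.unique D3
  simp only [Function.comp_apply, hzero] at key
  rw [key]
  have n1 := amplitude_ne_zero (α₀ := α₀) (β₀ := β₀) (θ₀ := θ₀) h hz
  have n2 := h.deriv_T_ne_zero _ hz
  have n3 := h.L_ne_zero _ hz
  have n4 := (h.α_pos _ hz).ne'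
  simp [Prod.ext_iff, n1, n2, n3, n4, hγ0]

/-- Every local solution jet on one side comes from one on the other. In one direction F is the
pullback of F'; in the other, F' has to be constructed from F and the inverse of the diffeomorphism.
-/
theorem symmetryAlgebra_push {Φ : DomDiffeo I J} (hc : c.SmoothNonzeroOn I)
    (hc' : c'.SmoothNonzeroOn J) (h : Admissible c c' I T α β L)
    (hα₀ : ContDiffOn ℝ ∞ α₀ I) (hβ₀ : ContDiffOn ℝ ∞ β₀ I) (hθ₀ : ContDiffOn ℝ ∞ θ₀ I)
    (hΦ : Represents Φ (equivTransformation c T α β L α₀ β₀ θ₀)) (V : VField I) :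
    V ∈ symmetryAlgebra c I ↔ Φ.push V ∈ symmetryAlgebra c' J := by
  set G := equivTransformation c T α β L α₀ β₀ θ₀ with hGdef
  -- The inverse of the base map is read off from Φ⁻¹ at fibre coordinate 0; the choice is
  -- immaterial, since the base component of Φ depends only on the base point.
  have hinv : ∀ y : Base, y.1 ∈ J → (Φ.invFun (y, 0)).1.1 ∈ I ∧ G.base (Φ.invFun (y, 0)).1 = y := by
    intro y hy
    have hy' : ((y, 0) : Tot) ∈ dom J := hy
    have h1 := Φ.mapsTo_inv hy'
    refine ⟨h1, ?_⟩
    rw [← (hΦ _ h1).1, Φ.right_inv _ hy']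
  constructor
  · intro hV F' y hy hF' hsol
    obtain ⟨hz, hGz⟩ := hinv y hy
    set z := (Φ.invFun (y, 0)).1
    rw [← hGz] at hF' hsol ⊢
    obtain ⟨h1, h2⟩ := fderiv_Delta_prolong hc hc' h hα₀ hβ₀ hθ₀ hΦ V hz hF'
      (Filter.EventuallyEq.refl _ _) hsol
    exact h2.1 (hV _ z hz (contDiffAt_pull hc h hα₀ hβ₀ hθ₀ hz (n := ⊤) hF') h1)
  · intro hV F z hz hF hsol
    -- The function whose graph is the image under Φ of the graph of F.
    let F' : Base → Fib := fun y => (Φ.toFun ((Φ.invFun (y, 0)).1, F (Φ.invFun (y, 0)).1)).2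
    have hGJ : ∀ y : Base, y.1 ∈ I → (G.base y).1 ∈ J := fun y hy => by
      rw [← (hΦ (y, 0) hy).1]; exact Φ.mapsTo hy
    have hleft : ∀ y : Base, y.1 ∈ I → (Φ.invFun (G.base y, 0)).1 = y := fun y hy => by
      obtain ⟨h1, h2⟩ := hinv (G.base y) (hGJ y hy)
      by_contra hne
      have hi : InjOn G.base (slab I) := by
        rintro a ha b hb hab
        have e : ∀ a : Base, a.1 ∈ I → Φ.toFun (a, G.pull 0 a) = (G.base a, 0) := fun a ha =>
          hΦ.graph h hGdef 0 ha
        have := congrArg Φ.invFun ((e a ha).trans ((by rw [hab] : _ = _).trans (e b hb).symm))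
        rw [Φ.left_inv _ ha, Φ.left_inv _ hb] at this
        exact congrArg Prod.fst this
      exact hne (hi h1 hy h2)
    have hF' : ContDiffAt ℝ ∞ F' (G.base z) := by
      have hy' : ((G.base z, 0) : Tot) ∈ dom J := hGJ z hz
      have h1 : ContDiffAt ℝ ∞ (fun y : Base => (Φ.invFun (y, 0)).1) (G.base z) :=
        (ContDiffAt.comp (g := Φ.invFun) (G.base z) (Φ.contDiffAt_inv hy')
          (contDiffAt_id.prodMk contDiffAt_const)).fst
      have h2 : ContDiffAt ℝ ∞ (fun y : Base => F (Φ.invFun (y, 0)).1) (G.base z) := by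
        refine ContDiffAt.comp (g := F) (G.base z) ?_ h1
        rw [hleft z hz]; exact hF
      refine (ContDiffAt.comp (g := Φ.toFun) (G.base z) ?_ (h1.prodMk h2)).snd
      exact Φ.contDiffAt (hinv _ (hGJ z hz)).1
    have hFF' : F =ᶠ[nhds z] G.pull F' := by
      filter_upwards [slab_mem_nhds I hz] with y hy
      have hp := hΦ (y, F y) hy
      simp only [FiberMap.pull, F', hleft y hy]
      exact Prod.ext hp.2.1.symm hp.2.2.symm
    have hsol' : Delta c' (jet F' (G.base z)) = 0 := by
      have two : (2 : WithTop ℕ∞) ≤ ∞ := WithTop.coe_le_coe.2 (le_top : (2 : ℕ∞) ≤ ⊤)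
      have ht := transforms hc h hα₀ hβ₀ hθ₀ z F' (hF'.of_le two) hz
      refine ht.2 ?_
      rw [SolvesAt, ← hGdef, ← jet_congr hFF']; exact hsol
    obtain ⟨h1, h2⟩ := fderiv_Delta_prolong hc hc' h hα₀ hβ₀ hθ₀ hΦ V hz hF' hFF' hsol'
    exact h2.2 (hV F' _ (hGJ z hz) hF' hsol')

end Transport

/-! ### Derivative rules along a fixed direction -/

/-- `f` is differentiable at `z` with directional derivative `f'` along `v`. -/
structure HasPd {E : Type*} [NormedAddCommGroup E] [NormedSpace ℝ E] (v : Base) (f : Base → E)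
    (f' : E) (z : Base) : Prop where
  diff : DifferentiableAt ℝ f z
  eq : pd v f z = f'

namespace HasPd

variable {E : Type*} [NormedAddCommGroup E] [NormedSpace ℝ E]
  {𝔸 : Type*} [NormedCommRing 𝔸] [NormedAlgebra ℝ 𝔸] {v z : Base}

theorem add {f g : Base → E} {f' g' : E} (hf : HasPd v f f' z) (hg : HasPd v g g' z) :
    HasPd v (fun y => f y + g y) (f' + g') z :=
  ⟨hf.diff.add hg.diff, by rw [pd_add hf.diff hg.diff, hf.eq, hg.eq]⟩

theorem sub {f g : Base → E} {f' g' : E} (hf : HasPd v f f' z) (hg : HasPd v g g' z) :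
    HasPd v (fun y => f y - g y) (f' - g') z :=
  ⟨hf.diff.sub hg.diff, by
    rw [← hf.eq, ← hg.eq]; unfold pd; rw [fderiv_fun_sub hf.diff hg.diff]; rfl⟩

theorem neg {f : Base → E} {f' : E} (hf : HasPd v f f' z) : HasPd v (fun y => -f y) (-f') z :=
  ⟨hf.diff.neg, by rw [← hf.eq]; unfold pd; rw [fderiv_fun_neg]; rfl⟩

theorem mul {f g : Base → 𝔸} {f' g' : 𝔸} (hf : HasPd v f f' z) (hg : HasPd v g g' z) :
    HasPd v (fun y => f y * g y) (f' * g z + f z * g') z :=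
  ⟨hf.diff.mul hg.diff, by rw [pd_mul hf.diff hg.diff, hf.eq, hg.eq]⟩

theorem const (e : E) : HasPd v (fun _ => e) 0 z :=
  ⟨differentiableAt_const e, by simp [pd]⟩

theorem const_mul {g : Base → 𝔸} {g' : 𝔸} (e : 𝔸) (hg : HasPd v g g' z) :
    HasPd v (fun y => e * g y) (e * g') z := by
  have := (const (v := v) (z := z) e).mul hg
  rwa [zero_mul, zero_add] at this

theorem sq {f : Base → 𝔸} {f' : 𝔸} (hf : HasPd v f f' z) :
    HasPd v (fun y => f y ^ 2) (2 * f z * f') z := by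
  have := hf.mul hf
  have e : (fun y => f y ^ 2) = fun y => f y * f y := by funext y; ring
  rw [e]
  exact ⟨this.diff, this.eq.trans (by ring)⟩

theorem div {f g : Base → ℝ} {f' g' : ℝ} (hf : HasPd v f f' z) (hg : HasPd v g g' z)
    (h0 : g z ≠ 0) : HasPd v (fun y => f y / g y) ((f' * g z - f z * g') / g z ^ 2) z := by
  have hd : DifferentiableAt ℝ (fun y => f y / g y) z := by
    simp only [div_eq_mul_inv]
    exact hf.diff.mul (hg.diff.inv h0)
  refine ⟨hd, ?_⟩
  have e : f =ᶠ[nhds z] fun y => (f y / g y) * g y := by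
    filter_upwards [hg.diff.continuousAt.eventually_ne h0] with y hy
    rw [div_mul_cancel₀ _ hy]
  have h := pd_congr e v
  rw [pd_mul hd hg.diff, hf.eq, hg.eq] at h
  rw [h]
  field_simp
  ring

theorem ofReal {f : Base → ℝ} {f' : ℝ} (hf : HasPd v f f' z) :
    HasPd v (fun y => (f y : ℂ)) (f' : ℂ) z :=
  ⟨Complex.ofRealCLM.differentiableAt.comp z hf.diff, by
    rw [← hf.eq]; exact pd_clm Complex.ofRealCLM hf.diff v⟩

theorem congr {f g : Base → E} {f' : E} (hf : HasPd v f f' z) (h : g =ᶠ[nhds z] f) :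
    HasPd v g f' z :=
  ⟨hf.diff.congr_of_eventuallyEq h, by rw [pd_congr h, hf.eq]⟩

theorem of_eq {f : Base → E} {f' g' : E} (hf : HasPd v f f' z) (h : f' = g') : HasPd v f g' z :=
  h ▸ hf

theorem unique {f g : Base → E} {f' g' : E} (hf : HasPd v f f' z) (hg : HasPd v g g' z)
    (h : f =ᶠ[nhds z] g) : f' = g' := by
  rw [← hf.eq, ← hg.eq, pd_congr h]

theorem normSq {m : Base → ℂ} {m' : ℂ} (h : HasPd v m m' z) :
    HasPd v (fun y => Complex.normSq (m y)) (2 * (starRingEnd ℂ (m z) * m').re) z := by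
  have h1 : HasPd v (fun y => (m y).re) m'.re z :=
    ⟨Complex.reCLM.differentiableAt.comp z h.diff, by
      rw [← h.eq]; exact pd_clm Complex.reCLM h.diff v⟩
  have h2 : HasPd v (fun y => (m y).im) m'.im z :=
    ⟨Complex.imCLM.differentiableAt.comp z h.diff, by
      rw [← h.eq]; exact pd_clm Complex.imCLM h.diff v⟩
  have e : (fun y => Complex.normSq (m y)) = fun y => (m y).re * (m y).re + (m y).im * (m y).im := by
    funext y; exact Complex.normSq_apply _
  rw [e]
  refine ((h1.mul h1).add (h2.mul h2)).of_eq ?_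
  simp
  ring

theorem time {φ : ℝ → ℝ} (h : DifferentiableAt ℝ φ z.1) :
    HasPd v (fun y => φ y.1) (v.1 * deriv φ z.1) z :=
  ⟨DifferentiableAt.comp (g := φ) z h differentiableAt_fst, pd_time h v⟩

/-- Second derivative of a function with logarithmic derivative `i f`. -/
theorem pd_of_phase {m : Base → ℂ} {f : Base → ℝ} {f' : ℝ} (hm : DifferentiableAt ℝ m z)
    (hf : HasPd v f f' z) (hmv : ∀ᶠ y in nhds z, pd v m y = Complex.I * f y * m y) :
    HasPd v (pd v m) ((Complex.I * f' - f z ^ 2) * m z) z := by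
  have h : HasPd v (fun y => Complex.I * f y * m y) _ z :=
    (hf.ofReal.const_mul Complex.I).mul ⟨hm, hmv.self_of_nhds⟩
  exact (h.congr hmv).of_eq (by linear_combination (f z : ℂ) ^ 2 * m z * Complex.I_sq)

end HasPd

theorem hasPd {E : Type*} [NormedAddCommGroup E] [NormedSpace ℝ E] {f : Base → E} {z : Base}
    (h : ContDiffAt ℝ ∞ f z) (v : Base) : HasPd v f (pd v f z) z :=
  ⟨h.differentiableAt (by simp), rfl⟩

theorem contDiffAt_pd {E : Type*} [NormedAddCommGroup E] [NormedSpace ℝ E] {f : Base → E}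
    {z : Base} (h : ContDiffAt ℝ ∞ f z) (v : Base) : ContDiffAt ℝ ∞ (pd v f) z :=
  ContDiffAt.pd (m := ∞) h (by simp) v

theorem two_le_infty : (2 : WithTop ℕ∞) ≤ ∞ := WithTop.coe_le_coe.2 (le_top : (2 : ℕ∞) ≤ ⊤)

theorem pd_eq_zero_of_const {E : Type*} [NormedAddCommGroup E] [NormedSpace ℝ E]
    {f : Base → E} {z : Base} {e : E} (h : ∀ᶠ y in nhds z, f y = e) (v : Base) :
    pd v f z = 0 :=
  ((HasPd.const e).congr h).eq

/-! ### Schrödinger potentials determined by a phase -/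

section Phase

variable {Z : Set Base} {m : Base → ℂ} {f g S P Q : Base → ℝ} {v w : Base}

/-- If `m` solves a Schrödinger equation with potential `S` and has a phase which is quadratic
in two variables, then the potential is determined by the phase. -/
theorem potential_of_phase (hZ : IsOpen Z) (hm : ∀ z ∈ Z, ContDiffAt ℝ ∞ m z)
    (hf : ∀ z ∈ Z, ContDiffAt ℝ ∞ f z)
    (hg : ∀ z ∈ Z, ContDiffAt ℝ ∞ g z) (hS : ∀ z ∈ Z, ContDiffAt ℝ ∞ S z)
    (hP : ∀ z ∈ Z, ContDiffAt ℝ ∞ P z)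
    (hQ : ∀ z ∈ Z, ContDiffAt ℝ ∞ Q z) (hm0 : ∀ z ∈ Z, m z ≠ 0)
    (hv : ∀ y ∈ Z, pd v m y = Complex.I * f y * m y)
    (hw : ∀ y ∈ Z, pd w m y = Complex.I * g y * m y)
    (hff : ∀ y ∈ Z, pd v (pd v f) y = 0) (hgv : ∀ y ∈ Z, pd v g y = 0)
    (hPv : ∀ y ∈ Z, pd v P y = 0) (hQv : ∀ y ∈ Z, pd v Q y = 0)
    (hE : ∀ y ∈ Z, Complex.I * pd et m y + P y * pd v (pd v m) y + Q y * pd w (pd w m) y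
      = S y * m y) {z : Base} (hz : z ∈ Z) :
    pd v (pd v S) z = -pd et (pd v f) z - 2 * P z * pd v f z ^ 2 ∧
    pd et (fun y => Complex.normSq (m y)) z
      = -2 * (P z * pd v f z + Q z * pd w g z) * Complex.normSq (m z) := by
  have near : ∀ {p : Base → Prop}, (∀ y ∈ Z, p y) → ∀ y ∈ Z, ∀ᶠ x in nhds y, p x := fun h y hy =>
    Filter.eventually_of_mem (hZ.mem_nhds hy) h
  -- The equation solved for i m_t. As S, P, Q, f, g are real, the coefficient of m is split into
  -- its real and imaginary parts.
  have hR : ∀ y ∈ Z, Complex.I * pd et m y = (((S y + P y * f y ^ 2 + Q y * g y ^ 2 : ℝ) : ℂ)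
      - Complex.I * ((P y * pd v f y + Q y * pd w g y : ℝ) : ℂ)) * m y := by
    intro y hy
    have h1 := hE y hy
    rw [(HasPd.pd_of_phase ((hm y hy).differentiableAt (by simp)) (hasPd (hf y hy) v)
      (near hv y hy)).eq, (HasPd.pd_of_phase ((hm y hy).differentiableAt (by simp))
      (hasPd (hg y hy) w) (near hw y hy)).eq] at h1
    push_cast
    linear_combination h1
  constructor
  -- The derivative of `hR` along v is compared with the time derivative of m_v = i f m. One more
  -- derivative along v gives the claim, since f_v does not vary along v.
  · have key : ∀ y ∈ Z, pd v S y = -pd et f y - 2 * P y * f y * pd v f y := by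
      intro y hy
      have F := hasPd (hf y hy) v
      have G : HasPd v g 0 y := (hasPd (hg y hy) v).of_eq (hgv y hy)
      have Ph : HasPd v P 0 y := (hasPd (hP y hy) v).of_eq (hPv y hy)
      have Qh : HasPd v Q 0 y := (hasPd (hQ y hy) v).of_eq (hQv y hy)
      have F1 : HasPd v (pd v f) 0 y := (hasPd (contDiffAt_pd (hf y hy) v) v).of_eq (hff y hy)
      have G1 : HasPd v (pd w g) 0 y := (hasPd (contDiffAt_pd (hg y hy) w) v).of_eq (by
        rw [pd_comm ((hg y hy).of_le two_le_infty), pd_eq_zero_of_const (near hgv y hy)])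
      have M : HasPd v m (Complex.I * f y * m y) y := (hasPd (hm y hy) v).of_eq (hv y hy)
      have M1 : HasPd v (pd et m)
          (Complex.I * ((pd et f y : ℝ) : ℂ) * m y + Complex.I * f y * pd et m y) y := by
        refine (hasPd (contDiffAt_pd (hm y hy) et) v).of_eq ?_
        rw [pd_comm ((hm y hy).of_le two_le_infty)]
        have := ((hasPd (hf y hy) et).ofReal.const_mul Complex.I).mul (hasPd (hm y hy) et)
        exact (this.congr (near hv y hy)).eq
      have R := ((((((hasPd (hS y hy) v).add (Ph.mul F.sq)).add (Qh.mul G.sq)).ofReal).sub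
        ((((Ph.mul F1).add (Qh.mul G1)).ofReal).const_mul Complex.I)).mul M)
      have h := (M1.const_mul Complex.I).unique R (near hR y hy)
      have h0 := hR y hy
      have R' : (((pd v S y + 2 * P y * f y * pd v f y + pd et f y : ℝ) : ℂ)) * m y = 0 := by
        push_cast at h h0 ⊢
        linear_combination -h + ((pd et f y : ℝ) : ℂ) * m y * Complex.I_sq + Complex.I * f y * h0
      have := Complex.ofReal_eq_zero.1 ((mul_eq_zero.1 R').resolve_right (hm0 y hy))
      linarith
    have F := hasPd (hf z hz) v
    have F1 : HasPd v (pd v f) 0 z := (hasPd (contDiffAt_pd (hf z hz) v) v).of_eq (hff z hz)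
    have F2 : HasPd v (pd et f) (pd et (pd v f) z) z :=
      (hasPd (contDiffAt_pd (hf z hz) et) v).of_eq (pd_comm ((hf z hz).of_le two_le_infty) _ _)
    have Ph : HasPd v P 0 z := (hasPd (hP z hz) v).of_eq (hPv z hz)
    have := F2.neg.sub (((Ph.const_mul 2).mul F).mul F1)
    rw [(this.congr (near key z hz)).eq]
    ring
  -- Only the real part of m_t/m changes |m|², and it is -(P f_v + Q g_w).
  · have h := hR z hz
    have h' : pd et m z = -Complex.I * ((((S z + P z * f z ^ 2 + Q z * g z ^ 2 : ℝ) : ℂ)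
      - Complex.I * ((P z * pd v f z + Q z * pd w g z : ℝ) : ℂ)) * m z) := by
      rw [← h]; linear_combination pd et m z * Complex.I_sq
    rw [(hasPd (hm z hz) et).normSq.eq, h', Complex.normSq_apply]
    generalize (S z + P z * f z ^ 2 + Q z * g z ^ 2) = A
    generalize (P z * pd v f z + Q z * pd w g z) = B
    simp
    ring

end Phase

/-- The phase gradient in a direction `v` produced by a time dependent affine change of the
corresponding variable. -/
theorem phase_gradient {Z : Set Base} (hZ : IsOpen Z) {X P : Base → ℝ} {v w : Base}
    (hX : ∀ z ∈ Z, ContDiffAt ℝ ∞ X z) (hP : ∀ z ∈ Z, ContDiffAt ℝ ∞ P z)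
    (hXw : ∀ z ∈ Z, pd w X z = 0) (hXv : ∀ z ∈ Z, pd v (pd v X) z = 0)
    (hX0 : ∀ z ∈ Z, pd v X z ≠ 0) (hP0 : ∀ z ∈ Z, P z ≠ 0) (hPv : ∀ z ∈ Z, pd v P z = 0)
    (hPw : ∀ z ∈ Z, pd w P z = 0) :
    (∀ z ∈ Z, ContDiffAt ℝ ∞ (fun y => -(pd et X y / (2 * P y * pd v X y))) z) ∧
    (∀ z ∈ Z, pd v (fun y => -(pd et X y / (2 * P y * pd v X y))) z
      = -(pd et (pd v X) z / pd v X z / (2 * P z))) ∧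
    (∀ z ∈ Z, pd v (pd v fun y => -(pd et X y / (2 * P y * pd v X y))) z = 0) ∧
    (∀ z ∈ Z, pd w (fun y => -(pd et X y / (2 * P y * pd v X y))) z = 0) ∧
    (∀ z ∈ Z, pd et (pd v fun y => -(pd et X y / (2 * P y * pd v X y))) z
      = -((pd et (fun y => pd et (pd v X) y / pd v X y) z * P z
          - pd et (pd v X) z / pd v X z * pd et P z) / (2 * P z ^ 2))) := by
  have near : ∀ {p : Base → Prop}, (∀ y ∈ Z, p y) → ∀ y ∈ Z, ∀ᶠ x in nhds y, p x := fun h y hy =>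
    Filter.eventually_of_mem (hZ.mem_nhds hy) h
  have c : ∀ {f : Base → ℝ} {y u u' : Base}, ContDiffAt ℝ ∞ f y → pd u (pd u' f) y = pd u' (pd u f) y :=
    fun h => pd_comm (h.of_le two_le_infty) _ _
  have P2 : ∀ u, ∀ z ∈ Z, HasPd u (fun y => 2 * P y) (2 * pd u P z) z := fun u z hz =>
    (hasPd (hP z hz) u).const_mul 2
  have first : ∀ z ∈ Z, pd v (fun y => -(pd et X y / (2 * P y * pd v X y))) z
      = -(pd et (pd v X) z / pd v X z / (2 * P z)) := by
    intro z hz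
    have h := ((hasPd (contDiffAt_pd (hX z hz) et) v).div (((P2 v z hz)).mul
      (hasPd (contDiffAt_pd (hX z hz) v) v)) (mul_ne_zero (mul_ne_zero two_ne_zero (hP0 z hz))
      (hX0 z hz))).neg
    rw [h.eq, hXv z hz, hPv z hz, c (hX z hz)]
    have := hX0 z hz
    have := hP0 z hz
    field_simp
    ring
  have A : ∀ z ∈ Z, ∀ u, HasPd u (fun y => pd et (pd v X) y / pd v X y)
      (pd u (fun y => pd et (pd v X) y / pd v X y) z) z := fun z hz u =>
    hasPd ((contDiffAt_pd (contDiffAt_pd (hX z hz) v) et).div (contDiffAt_pd (hX z hz) v) (hX0 z hz)) u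
  refine ⟨fun z hz => ?_, first, fun z hz => ?_, fun z hz => ?_, fun z hz => ?_⟩
  · exact ((contDiffAt_pd (hX z hz) et).div ((contDiffAt_const.mul (hP z hz)).mul
      (contDiffAt_pd (hX z hz) v)) (mul_ne_zero (mul_ne_zero two_ne_zero (hP0 z hz)) (hX0 z hz))).neg
  · have h1 := (hasPd (contDiffAt_pd (contDiffAt_pd (hX z hz) v) et) v).div
      (hasPd (contDiffAt_pd (hX z hz) v) v) (hX0 z hz)
    have h := ((h1.div (P2 v z hz) (mul_ne_zero two_ne_zero (hP0 z hz))).neg).congr (near first z hz)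
    rw [h.eq, hXv z hz, hPv z hz, c (contDiffAt_pd (hX z hz) v), pd_eq_zero_of_const (near hXv z hz)]
    simp
  · have h := ((hasPd (contDiffAt_pd (hX z hz) et) w).div (((P2 w z hz)).mul
      (hasPd (contDiffAt_pd (hX z hz) v) w)) (mul_ne_zero (mul_ne_zero two_ne_zero (hP0 z hz))
      (hX0 z hz))).neg
    rw [h.eq, hPw z hz, c (hX z hz), c (hX z hz) (u' := v), pd_eq_zero_of_const (near hXw z hz),
      pd_eq_zero_of_const (near hXw z hz)]
    simp
  · have h := (((A z hz et).div (P2 et z hz) (mul_ne_zero two_ne_zero (hP0 z hz))).neg).congr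
      (near first z hz)
    rw [h.eq]
    have := hP0 z hz
    field_simp

/-! ### Necessary relations between the coefficients, and their integration -/

/-- A Davey-Stewartson system on an open set `Z` together with the data of a point
transformation, affine in the dependent variables, to a system with constant coefficients:
`M` is the image of a constant function `ψ̃` and `w` that of a constant function `w̃`. -/
structure AffineReduction (c : Coeffs) (Z : Set Base) (X Y : Base → ℝ) (M : Base → ℂ)
    (w : Base → ℝ) (ρ κ ν ϖ : ℝ) : Prop where
  X_smooth : ∀ z ∈ Z, ContDiffAt ℝ ∞ X z
  Y_smooth : ∀ z ∈ Z, ContDiffAt ℝ ∞ Y z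
  M_smooth : ∀ z ∈ Z, ContDiffAt ℝ ∞ M z
  w_smooth : ∀ z ∈ Z, ContDiffAt ℝ ∞ w z
  X_y : ∀ z ∈ Z, pd ey X z = 0
  Y_x : ∀ z ∈ Z, pd ex Y z = 0
  X_xx : ∀ z ∈ Z, pd ex (pd ex X) z = 0
  Y_yy : ∀ z ∈ Z, pd ey (pd ey Y) z = 0
  X_x : ∀ z ∈ Z, pd ex X z ≠ 0
  Y_y : ∀ z ∈ Z, pd ey Y z ≠ 0
  M_ne : ∀ z ∈ Z, M z ≠ 0
  M_x : ∀ z ∈ Z, 2 * c.p₁ z.1 * pd ex X z * pd ex M z = -(Complex.I * pd et X z * M z)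
  M_y : ∀ z ∈ Z, 2 * c.p₂ z.1 * pd ey Y z * pd ey M z = -(Complex.I * pd et Y z * M z)
  schrodinger : ∀ z ∈ Z, Complex.I * pd et M z + c.p₁ z.1 * pd ex (pd ex M) z
    + c.p₂ z.1 * pd ey (pd ey M) z
      = ((c.q₂ z.1 * w z - κ * (c.p₁ z.1 * pd ex X z ^ 2) : ℝ) : ℂ) * M z
  wave : ∀ z ∈ Z, pd ex (pd ex w) z + c.r₁ z.1 * pd ey (pd ey w) z = 0
  q₁ : ∀ z ∈ Z, c.q₁ z.1 * Complex.normSq (M z) = ν * (c.p₁ z.1 * pd ex X z ^ 2)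
  p₂ : ∀ z ∈ Z, c.p₂ z.1 * pd ey Y z ^ 2 = ρ * (c.p₁ z.1 * pd ex X z ^ 2)
  r₁ : ∀ z ∈ Z, c.r₁ z.1 * pd ey Y z ^ 2 = -ρ * pd ex X z ^ 2
  r₂ : ∀ z ∈ Z, c.q₂ z.1 * c.r₂ z.1 * pd ey Y z ^ 2 * Complex.normSq (M z)
    = ϖ * (c.p₁ z.1 * pd ex X z ^ 2) * pd ex X z ^ 2

/-- The conditions on the coefficients, at one time, for the reduction to an integrable system. -/
structure ReducibleAt (c : Coeffs) (K t : ℝ) : Prop where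
  r₁ : c.p₂ t = -(c.p₁ t * c.r₁ t)
  r₂ : c.q₂ t * c.r₂ t * c.p₁ t = K * (c.q₁ t * c.p₂ t)
  q₁ : 2 * deriv c.q₁ t / c.q₁ t = deriv c.p₁ t / c.p₁ t + deriv c.p₂ t / c.p₂ t
  p : deriv (fun s => deriv c.p₂ s / c.p₂ s - deriv c.p₁ s / c.p₁ s) t
    = ((deriv c.p₂ t / c.p₂ t) ^ 2 - (deriv c.p₁ t / c.p₁ t) ^ 2) / 2

theorem AffineReduction.reducibleAt {I : Opens ℝ} {c : Coeffs} (hc : c.SmoothNonzeroOn I)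
    {Z : Set Base} (hZ : IsOpen Z) (hZI : Z ⊆ slab I) {X Y : Base → ℝ} {M : Base → ℂ}
    {w : Base → ℝ} {ρ κ ν ϖ : ℝ} (hρ : ρ ≠ 0) (hν : ν ≠ 0)
    (h : AffineReduction c Z X Y M w ρ κ ν ϖ) {z : Base} (hz : z ∈ Z) :
    ReducibleAt c (ϖ / (ρ * ν)) z.1 := by
  have near : ∀ {p : Base → Prop}, (∀ y ∈ Z, p y) → ∀ y ∈ Z, ∀ᶠ x in nhds y, p x := fun h y hy =>
    Filter.eventually_of_mem (hZ.mem_nhds hy) h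
  have tm : ∀ {φ : ℝ → ℝ}, ContDiffOn ℝ ∞ φ I → ∀ y ∈ Z, ContDiffAt ℝ ∞ (fun y : Base => φ y.1) y :=
    fun hφ y hy => contDiffAt_time (contDiffAt_of_mem hφ (hZI hy))
  have td : ∀ {φ : ℝ → ℝ}, ContDiffOn ℝ ∞ φ I → ∀ (v : Base), ∀ y ∈ Z,
      HasPd v (fun y : Base => φ y.1) (v.1 * deriv φ y.1) y :=
    fun hφ v y hy => HasPd.time ((contDiffAt_of_mem hφ (hZI hy)).differentiableAt (by simp))
  have tx : ∀ {φ : ℝ → ℝ}, ContDiffOn ℝ ∞ φ I → ∀ y ∈ Z, pd ex (fun y : Base => φ y.1) y = 0 :=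
    fun hφ y hy => (td hφ ex y hy).eq.trans (by simp [ex])
  have ty : ∀ {φ : ℝ → ℝ}, ContDiffOn ℝ ∞ φ I → ∀ y ∈ Z, pd ey (fun y : Base => φ y.1) y = 0 :=
    fun hφ y hy => (td hφ ey y hy).eq.trans (by simp [ey])
  have tt : ∀ {φ : ℝ → ℝ}, ContDiffOn ℝ ∞ φ I → ∀ y ∈ Z,
      pd et (fun y : Base => φ y.1) y = deriv φ y.1 :=
    fun hφ y hy => (td hφ et y hy).eq.trans (by simp [et])
  have comm : ∀ {f : Base → ℝ} {y u u' : Base}, ContDiffAt ℝ ∞ f y →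
      pd u (pd u' f) y = pd u' (pd u f) y := fun h => pd_comm (h.of_le two_le_infty) _ _
  have np₁ : ∀ y ∈ Z, c.p₁ y.1 ≠ 0 := fun y hy => (hc.ne_zero _ (hZI hy)).1
  have np₂ : ∀ y ∈ Z, c.p₂ y.1 ≠ 0 := fun y hy => (hc.ne_zero _ (hZI hy)).2.1
  obtain ⟨f_smooth, f_x, f_xx, f_y, f_xt⟩ := phase_gradient hZ h.X_smooth (tm hc.smooth_p₁) h.X_y
    h.X_xx h.X_x np₁ (tx hc.smooth_p₁) (ty hc.smooth_p₁)
  obtain ⟨g_smooth, g_y, g_yy, g_x, g_yt⟩ := phase_gradient hZ h.Y_smooth (tm hc.smooth_p₂) h.Y_x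
    h.Y_yy h.Y_y np₂ (ty hc.smooth_p₂) (tx hc.smooth_p₂)
  set f : Base → ℝ := fun y => -(pd et X y / (2 * c.p₁ y.1 * pd ex X y))
  set g : Base → ℝ := fun y => -(pd et Y y / (2 * c.p₂ y.1 * pd ey Y y))
  set S : Base → ℝ := fun y => c.q₂ y.1 * w y - κ * (c.p₁ y.1 * pd ex X y ^ 2)
  have S_smooth : ∀ y ∈ Z, ContDiffAt ℝ ∞ S y := fun y hy =>
    ((tm hc.smooth_q₂ y hy).mul (h.w_smooth y hy)).sub (contDiffAt_const.mul
      ((tm hc.smooth_p₁ y hy).mul ((contDiffAt_pd (h.X_smooth y hy) ex).pow 2)))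
  have M_x : ∀ y ∈ Z, pd ex M y = Complex.I * f y * M y := by
    intro y hy
    have h1 := h.M_x y hy
    have n1 : (c.p₁ y.1 : ℂ) ≠ 0 := Complex.ofReal_ne_zero.2 (np₁ y hy)
    have n2 : ((pd ex X y : ℝ) : ℂ) ≠ 0 := Complex.ofReal_ne_zero.2 (h.X_x y hy)
    simp only [f]
    push_cast
    field_simp
    linear_combination h1
  have M_y : ∀ y ∈ Z, pd ey M y = Complex.I * g y * M y := by
    intro y hy
    have h1 := h.M_y y hy
    have n1 : (c.p₂ y.1 : ℂ) ≠ 0 := Complex.ofReal_ne_zero.2 (np₂ y hy)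
    have n2 : ((pd ey Y y : ℝ) : ℂ) ≠ 0 := Complex.ofReal_ne_zero.2 (h.Y_y y hy)
    simp only [g]
    push_cast
    field_simp
    linear_combination h1
  obtain ⟨S_xx, N_t⟩ := potential_of_phase hZ h.M_smooth f_smooth g_smooth S_smooth (tm hc.smooth_p₁)
    (tm hc.smooth_p₂) h.M_ne M_x M_y f_xx g_x (tx hc.smooth_p₁) (tx hc.smooth_p₂)
    (h.schrodinger) hz
  obtain ⟨S_yy, -⟩ := potential_of_phase hZ h.M_smooth g_smooth f_smooth S_smooth (tm hc.smooth_p₂)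
    (tm hc.smooth_p₁) h.M_ne M_y M_x g_yy f_y (ty hc.smooth_p₂) (ty hc.smooth_p₁)
    (fun y hy => by rw [← h.schrodinger y hy]; ring) hz
  have X_xy : ∀ y ∈ Z, pd ey (pd ex X) y = 0 := fun y hy => by
    rw [comm (h.X_smooth y hy), pd_eq_zero_of_const (near h.X_y y hy)]
  -- The space derivatives of X_x vanish on Z, so the term with κ in S disappears and the second
  -- space derivatives of S are those of q₂ w.
  have S_v : ∀ v : Base, v.1 = 0 → (∀ y ∈ Z, pd v (pd ex X) y = 0) → 
      pd v (pd v S) z = c.q₂ z.1 * pd v (pd v w) z := by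
    intro v hv hX
    have t0 : ∀ {φ : ℝ → ℝ}, ContDiffOn ℝ ∞ φ I → ∀ y ∈ Z, HasPd v (fun y : Base => φ y.1) 0 y :=
      fun hφ y hy => (td hφ v y hy).of_eq (by simp [hv])
    have h1 : ∀ y ∈ Z, pd v S y = c.q₂ y.1 * pd v w y := fun y hy => by
      have hx : HasPd v (pd ex X) 0 y := (hasPd (contDiffAt_pd (h.X_smooth y hy) ex) v).of_eq (hX y hy)
      have := ((t0 hc.smooth_q₂ y hy).mul (hasPd (h.w_smooth y hy) v)).sub
        (((t0 hc.smooth_p₁ y hy).mul hx.sq).const_mul κ)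
      rw [this.eq]; ring
    have := (t0 hc.smooth_q₂ z hz).mul (hasPd (contDiffAt_pd (h.w_smooth z hz) v) v)
    rw [(this.congr (near h1 z hz)).eq]; ring
  rw [S_v ex rfl h.X_xx] at S_xx
  rw [S_v ey rfl X_xy] at S_yy
  have A : ∀ y ∈ Z, ContDiffAt ℝ ∞ (fun y => pd et (pd ex X) y / pd ex X y) y := fun y hy =>
    (contDiffAt_pd (contDiffAt_pd (h.X_smooth y hy) ex) et).div (contDiffAt_pd (h.X_smooth y hy) ex)
      (h.X_x y hy)
  have B : ∀ y ∈ Z, ContDiffAt ℝ ∞ (fun y => pd et (pd ey Y) y / pd ey Y y) y := fun y hy =>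
    (contDiffAt_pd (contDiffAt_pd (h.Y_smooth y hy) ey) et).div (contDiffAt_pd (h.Y_smooth y hy) ey)
      (h.Y_y y hy)
  have tT : ∀ {φ : ℝ → ℝ}, ContDiffOn ℝ ∞ φ I → ∀ y ∈ Z,
      HasPd et (fun y : Base => φ y.1) (deriv φ y.1) y := fun hφ y hy =>
    (td hφ et y hy).of_eq (by simp [et])
  -- The logarithmic time derivative of p₂ Y_y² = ρ p₁ X_x².
  have rel : ∀ y ∈ Z, deriv c.p₂ y.1 / c.p₂ y.1 - deriv c.p₁ y.1 / c.p₁ y.1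
      = 2 * (pd et (pd ex X) y / pd ex X y - pd et (pd ey Y) y / pd ey Y y) := by
    intro y hy
    have e1 := (tT hc.smooth_p₂ y hy).mul (hasPd (contDiffAt_pd (h.Y_smooth y hy) ey) et).sq
    have e2 := ((tT hc.smooth_p₁ y hy).mul (hasPd (contDiffAt_pd (h.X_smooth y hy) ex) et).sq).const_mul ρ
    have e := e1.unique e2 (near h.p₂ y hy)
    have e0 := h.p₂ y hy
    have n1 := np₁ y hy
    have n2 := np₂ y hy
    have n3 := h.X_x y hy
    have n4 := h.Y_y y hy
    have e' : c.p₂ y.1 * pd ey Y y ^ 2 * (deriv c.p₂ y.1 / c.p₂ y.1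
          + 2 * (pd et (pd ey Y) y / pd ey Y y))
        = c.p₂ y.1 * pd ey Y y ^ 2 * (deriv c.p₁ y.1 / c.p₁ y.1
          + 2 * (pd et (pd ex X) y / pd ex X y)) := by
      have l : c.p₂ y.1 * pd ey Y y ^ 2 * (deriv c.p₂ y.1 / c.p₂ y.1
          + 2 * (pd et (pd ey Y) y / pd ey Y y)) = deriv c.p₂ y.1 * pd ey Y y ^ 2
            + c.p₂ y.1 * (2 * pd ey Y y * pd et (pd ey Y) y) := by field_simp
      rw [l, e, e0]
      field_simp
    have := mul_left_cancel₀ (mul_ne_zero n2 (pow_ne_zero 2 n4)) e'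
    linarith
  have rel_t : deriv (fun s => deriv c.p₂ s / c.p₂ s - deriv c.p₁ s / c.p₁ s) z.1
      = 2 * (pd et (fun y => pd et (pd ex X) y / pd ex X y) z
        - pd et (fun y => pd et (pd ey Y) y / pd ey Y y) z) := by
    have d : ∀ {φ : ℝ → ℝ}, ContDiffOn ℝ ∞ φ I → (φ z.1 ≠ 0) →
        DifferentiableAt ℝ (fun s => deriv φ s / φ s) z.1 := fun {φ} hφ h0 => by
      exact DifferentiableAt.fun_div ((contDiffAt_deriv_of_mem hφ (hZI hz)).differentiableAt (by simp))
        ((contDiffAt_of_mem hφ (hZI hz)).differentiableAt (by simp)) h0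
    have e1 : HasPd et (fun y : Base => deriv c.p₂ y.1 / c.p₂ y.1 - deriv c.p₁ y.1 / c.p₁ y.1) _ z :=
      HasPd.time (φ := fun s => deriv c.p₂ s / c.p₂ s - deriv c.p₁ s / c.p₁ s)
        ((d hc.smooth_p₂ (np₂ z hz)).fun_sub (d hc.smooth_p₁ (np₁ z hz)))
    have e2 := ((hasPd (A z hz) et).sub (hasPd (B z hz) et)).const_mul 2
    have e := e1.unique e2 (near rel z hz)
    simpa [et] using e
  have hwave := h.wave z hz
  have hrel := rel z hz
  have r1 : c.p₂ z.1 = -(c.p₁ z.1 * c.r₁ z.1) := by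
    have e1 := h.p₂ z hz
    have e2 := h.r₁ z hz
    refine mul_right_cancel₀ (pow_ne_zero 2 (h.Y_y z hz)) ?_
    linear_combination e1 + c.p₁ z.1 * e2
  have n1 := np₁ z hz
  have n2 := np₂ z hz
  have n3 := h.X_x z hz
  have n4 := h.Y_y z hz
  have n5 : c.q₁ z.1 ≠ 0 := (hc.ne_zero _ (hZI hz)).2.2.1
  have n6 : c.q₂ z.1 ≠ 0 := (hc.ne_zero _ (hZI hz)).2.2.2.1
  have n7 : Complex.normSq (M z) ≠ 0 := by simpa using h.M_ne z hz
  refine ⟨r1, ?_, ?_, ?_⟩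
  · have e1 := h.q₁ z hz
    have e2 := h.p₂ z hz
    have e3 := h.r₂ z hz
    have n8 : pd ex X z ^ 2 * pd ex X z ^ 2 * c.p₁ z.1 ≠ 0 := by positivity
    rw [div_mul_eq_mul_div, eq_div_iff (mul_ne_zero hρ hν)]
    refine mul_right_cancel₀ n8 ?_
    have : c.q₂ z.1 * c.r₂ z.1 * (ν * (c.p₁ z.1 * pd ex X z ^ 2)) * (ρ * (c.p₁ z.1 * pd ex X z ^ 2))
        = c.q₁ z.1 * c.p₂ z.1 * (ϖ * (c.p₁ z.1 * pd ex X z ^ 2) * pd ex X z ^ 2) := by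
      rw [← e1, ← e2, ← e3]; ring
    linear_combination this
  -- The logarithmic time derivative of q₁ |M|² = ν p₁ X_x². The phase gives that of |M|² as
  -- X_xt/X_x + Y_yt/Y_y, and `rel` eliminates these quantities.
  · have e1 := (tT hc.smooth_q₁ z hz).mul (hasPd (h.M_smooth z hz) et).normSq
    have e1' := (tT hc.smooth_q₁ z hz).mul ((hasPd (h.M_smooth z hz) et).normSq.of_eq
      ((hasPd (h.M_smooth z hz) et).normSq.eq.symm.trans N_t))
    have e2 := ((tT hc.smooth_p₁ z hz).mul (hasPd (contDiffAt_pd (h.X_smooth z hz) ex) et).sq).const_mul ν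
    have e := e1'.unique e2 (near h.q₁ z hz)
    rw [f_x z hz, g_y z hz] at e
    have e0 := h.q₁ z hz
    have e' : c.q₁ z.1 * Complex.normSq (M z) * (deriv c.q₁ z.1 / c.q₁ z.1
          + (pd et (pd ex X) z / pd ex X z + pd et (pd ey Y) z / pd ey Y z))
        = c.q₁ z.1 * Complex.normSq (M z) * (deriv c.p₁ z.1 / c.p₁ z.1
          + 2 * (pd et (pd ex X) z / pd ex X z)) := by
      have l : c.q₁ z.1 * Complex.normSq (M z) * (deriv c.q₁ z.1 / c.q₁ z.1
          + (pd et (pd ex X) z / pd ex X z + pd et (pd ey Y) z / pd ey Y z))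
          = deriv c.q₁ z.1 * Complex.normSq (M z) + c.q₁ z.1 * (-2 * (c.p₁ z.1 * -(pd et (pd ex X) z / pd ex X z / (2 * c.p₁ z.1))
            + c.p₂ z.1 * -(pd et (pd ey Y) z / pd ey Y z / (2 * c.p₂ z.1))) * Complex.normSq (M z)) := by
        field_simp
        ring
      rw [l, e, e0]
      field_simp
    have := mul_left_cancel₀ (mul_ne_zero n5 n7) e'
    rw [mul_div_assoc]
    linarith
  · rw [f_xt z hz, f_x z hz, tt hc.smooth_p₁ z hz] at S_xx
    rw [g_yt z hz, g_y z hz, tt hc.smooth_p₂ z hz] at S_yy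
    rw [rel_t]
    generalize pd et (fun y => pd et (pd ex X) y / pd ex X y) z = A₁ at *
    generalize pd et (fun y => pd et (pd ey Y) y / pd ey Y y) z = B₁ at *
    generalize pd et (pd ex X) z / pd ex X z = a at *
    generalize pd et (pd ey Y) z / pd ey Y z = b at *
    -- The wave equation multiplied by q₂ and p₁ reads p₁ S_xx = p₂ S_yy; both sides are expressed
    -- by a = X_xt/X_x, b = Y_yt/Y_y and their time derivatives.
    have key : A₁ - deriv c.p₁ z.1 / c.p₁ z.1 * a - a ^ 2
        - (B₁ - deriv c.p₂ z.1 / c.p₂ z.1 * b - b ^ 2) = 0 := by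
      have e : c.q₂ z.1 * (pd ex (pd ex w) z + c.r₁ z.1 * pd ey (pd ey w) z) = 0 := by
        rw [hwave, mul_zero]
      have e' : c.q₂ z.1 * pd ex (pd ex w) z * (2 * c.p₁ z.1) = c.q₂ z.1 * pd ey (pd ey w) z * (2 * c.p₂ z.1) := by
        rw [r1]; linear_combination 2 * c.p₁ z.1 * e
      rw [S_xx, S_yy] at e'
      have l : ∀ (p p' a A : ℝ), p ≠ 0 → (- -((A * p - a * p') / (2 * p ^ 2)) - 2 * p * (-(a / (2 * p))) ^ 2) * (2 * p)
          = A - p' / p * a - a ^ 2 := by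
        intro p p' a A hp
        field_simp
      rw [l _ _ _ _ n1, l _ _ _ _ n2] at e'
      linarith
    -- Once b is eliminated, a cancels too, and a relation between p₁ and p₂ alone remains.
    have hb : b = a - (deriv c.p₂ z.1 / c.p₂ z.1 - deriv c.p₁ z.1 / c.p₁ z.1) / 2 := by linarith
    rw [hb] at key
    linear_combination 2 * key

theorem exists_eq_of_hasDerivAt_zero {I : Opens ℝ} (hI : IsPreconnected (I : Set ℝ)) {f : ℝ → ℝ}
    (h : ∀ t ∈ I, HasDerivAt f 0 t) : ∃ C, ∀ t ∈ I, f t = C :=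
  I.isOpen.exists_is_const_of_deriv_eq_zero hI
    (fun t ht => (h t ht).differentiableAt.differentiableWithinAt) fun t ht => (h t ht).deriv

theorem exists_antiderivative {I : Opens ℝ} (hI : IsPreconnected (I : Set ℝ)) {q : ℝ → ℝ}
    (hne : (I : Set ℝ).Nonempty) (hq : ContDiffOn ℝ ∞ q I) :
    ∃ Q : ℝ → ℝ, ∀ t ∈ I, HasDerivAt Q (q t) t := by
  obtain ⟨s, hs⟩ := hne
  refine ⟨fun t => ∫ x in s..t, q x, fun t ht => ?_⟩
  have hc : ContinuousOn q I := hq.continuousOn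
  exact intervalIntegral.integral_hasDerivAt_right
    ((hc.mono (hI.ordConnected.uIcc_subset hs ht)).intervalIntegrable)
    (hc.stronglyMeasurableAtFilter I.isOpen t ht) (hc.continuousAt (I.isOpen.mem_nhds ht))

/-- Let D = p₂'/p₂ - p₁'/p₁. The hypotheses give D' = D (p₁'/p₁ + p₂'/p₂)/2 = D q₁'/q₁, so D = C q₁
with C constant. Then p₁'/p₁ = q₁'/q₁ - C q₁/2 and p₂'/p₂ = q₁'/q₁ + C q₁/2, which integrate to
Table 1 with k₀ = -C/2. -/
theorem Table1.of_reducibleAt {I : Opens ℝ} {c : Coeffs} (hI : IsPreconnected (I : Set ℝ))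
    (hne : (I : Set ℝ).Nonempty) (hc : c.SmoothNonzeroOn I) {K : ℝ}
    (h : ∀ t ∈ I, ReducibleAt c K t) : Table1 c I := by
  have d : ∀ {φ : ℝ → ℝ}, ContDiffOn ℝ ∞ φ I → ∀ t ∈ I, HasDerivAt φ (deriv φ t) t :=
    fun hφ t ht => ((contDiffAt_of_mem hφ ht).differentiableAt (by simp)).hasDerivAt
  have d2 : ∀ {φ : ℝ → ℝ}, ContDiffOn ℝ ∞ φ I → ∀ t ∈ I, DifferentiableAt ℝ (deriv φ) t :=
    fun hφ t ht => (contDiffAt_deriv_of_mem hφ ht).differentiableAt (by simp)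
  have n₁ : ∀ t ∈ I, c.p₁ t ≠ 0 := fun t ht => (hc.ne_zero t ht).1
  have n₂ : ∀ t ∈ I, c.p₂ t ≠ 0 := fun t ht => (hc.ne_zero t ht).2.1
  have m₁ : ∀ t ∈ I, c.q₁ t ≠ 0 := fun t ht => (hc.ne_zero t ht).2.2.1
  have m₂ : ∀ t ∈ I, c.q₂ t ≠ 0 := fun t ht => (hc.ne_zero t ht).2.2.2.1
  obtain ⟨C, hC⟩ := exists_eq_of_hasDerivAt_zero (f := fun s =>
      (deriv c.p₂ s / c.p₂ s - deriv c.p₁ s / c.p₁ s) / c.q₁ s) hI fun t ht => by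
    have h1 : DifferentiableAt ℝ (fun s => deriv c.p₂ s / c.p₂ s - deriv c.p₁ s / c.p₁ s) t :=
      ((d2 hc.smooth_p₂ t ht).fun_div (d hc.smooth_p₂ t ht).differentiableAt (n₂ t ht)).fun_sub
        ((d2 hc.smooth_p₁ t ht).fun_div (d hc.smooth_p₁ t ht).differentiableAt (n₁ t ht))
    have h2 := h1.hasDerivAt
    rw [(h t ht).p] at h2
    refine (h2.fun_div (d hc.smooth_q₁ t ht) (m₁ t ht)).congr_deriv ?_
    have e := (h t ht).q₁
    have m := m₁ t ht
    have e' : deriv c.q₁ t = c.q₁ t * (deriv c.p₁ t / c.p₁ t + deriv c.p₂ t / c.p₂ t) / 2 := by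
      rw [← e]; field_simp
    rw [e', div_eq_zero_iff]
    left; ring
  obtain ⟨Q, hQ⟩ := exists_antiderivative hI hne hc.smooth_q₁
  have main : ∀ {p : ℝ → ℝ} {k : ℝ}, ContDiffOn ℝ ∞ p I → (∀ t ∈ I, p t ≠ 0) →
      (∀ t ∈ I, deriv p t / p t = deriv c.q₁ t / c.q₁ t + k * c.q₁ t) →
      ∃ C, ∀ t ∈ I, p t = C * c.q₁ t * Real.exp (k * Q t) := by
    intro p k hp hp0 hlog
    obtain ⟨C, hC⟩ := exists_eq_of_hasDerivAt_zero (f := fun s =>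
        p s / (c.q₁ s * Real.exp (k * Q s))) hI fun t ht => by
      have m := m₁ t ht
      have n := hp0 t ht
      have h1 := (d hc.smooth_q₁ t ht).fun_mul ((hQ t ht).const_mul k).exp
      refine ((d hp t ht).fun_div h1 (mul_ne_zero m (Real.exp_ne_zero _))).congr_deriv ?_
      have e : deriv p t = p t * (deriv c.q₁ t / c.q₁ t + k * c.q₁ t) := by
        rw [← hlog t ht]; field_simp
      rw [e, div_eq_zero_iff]
      left
      field_simp
      ring
    refine ⟨C, fun t ht => ?_⟩
    have m := m₁ t ht
    rw [← hC t ht]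
    have := Real.exp_ne_zero (k * Q t)
    field_simp
  have lin : ∀ t ∈ I, deriv c.p₂ t / c.p₂ t - deriv c.p₁ t / c.p₁ t = C * c.q₁ t := fun t ht => by
    rw [← hC t ht, div_mul_cancel₀ _ (m₁ t ht)]
  obtain ⟨k₁, h₁⟩ := main (k := -C / 2) hc.smooth_p₁ n₁ fun t ht => by
    have := (h t ht).q₁
    have := lin t ht
    rw [mul_div_assoc] at *
    linarith
  obtain ⟨k₂, h₂⟩ := main (k := -(-C / 2)) hc.smooth_p₂ n₂ fun t ht => by
    have := (h t ht).q₁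
    have := lin t ht
    rw [mul_div_assoc] at *
    linarith
  have hk₁ : k₁ ≠ 0 := by
    obtain ⟨s, hs⟩ := hne
    rintro rfl
    exact n₁ s hs (by rw [h₁ s hs]; simp)
  -- The constants are read off from p₂/p₁ = (k₂/k₁) exp(-2 k₀ Q), r₁ = -p₂/p₁ and q₂ r₂ = K q₁
  -- p₂/p₁.
  refine ⟨-C / 2, k₁, -(k₂ / k₁), K * (k₂ / k₁), Q, hQ, fun t ht => ?_⟩
  have quot : c.p₂ t / c.p₁ t = k₂ / k₁ * Real.exp (-(2 * (-C / 2) * Q t)) := by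
    have m := m₁ t ht
    have e : Real.exp (-(-C / 2) * Q t) = Real.exp (-(2 * (-C / 2) * Q t)) * Real.exp (-C / 2 * Q t) := by
      rw [← Real.exp_add]; ring_nf
    have := Real.exp_ne_zero (-C / 2 * Q t)
    rw [h₁ t ht, h₂ t ht, e]
    field_simp
  have n := n₁ t ht
  refine ⟨h₁ t ht, ?_, ?_, ?_⟩
  · rw [h₂ t ht, neg_mul (-C / 2) (Q t)]
    field_simp
  · rw [neg_mul, ← quot]
    have := (h t ht).r₁
    field_simp
    linarith
  · rw [mul_right_comm, mul_assoc K, ← quot]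
    have := (h t ht).r₂
    have := m₂ t ht
    field_simp
    linarith

/-! ### Second order chain rules and quadratic functions -/

/-- The second order chain rule along a direction. -/
theorem pd_pd_comp {E F : Type*} [NormedAddCommGroup E] [NormedSpace ℝ E]
    [NormedAddCommGroup F] [NormedSpace ℝ F] {h : E → F} {k : Base → E} {z : Base}
    (hh : ContDiffAt ℝ 2 h (k z)) (hk : ContDiffAt ℝ 2 k z) (v : Base) :
    pd v (fun y => h (k y)) z = fderiv ℝ h (k z) (pd v k z) ∧
    pd v (pd v fun y => h (k y)) z = fderiv ℝ (fderiv ℝ h) (k z) (pd v k z) (pd v k z)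
      + fderiv ℝ h (k z) (pd v (pd v k) z) := by
  have h1 : (pd v fun y => h (k y)) =ᶠ[nhds z] fun y => fderiv ℝ h (k y) (pd v k y) := by
    filter_upwards [hk.continuousAt.eventually (hh.eventually (by simp)), hk.eventually (by simp)]
      with y hy hy'
    have := (hy.differentiableAt (by norm_num)).hasFDerivAt.comp y
      (hy'.differentiableAt (by norm_num)).hasFDerivAt
    exact congrArg (fun A => A v) this.fderiv
  refine ⟨h1.self_of_nhds, ?_⟩
  rw [pd_congr h1]
  have a1 := ((hh.fderiv_right (m := 1) (by norm_num)).differentiableAt (by norm_num)).hasFDerivAt.comp z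
    (hk.differentiableAt (by norm_num)).hasFDerivAt
  have a2 := ((ContDiffAt.pd (m := 1) hk (by norm_num) v).differentiableAt (by norm_num)).hasFDerivAt
  have := (a1.clm_apply a2).fderiv
  refine (congrArg (fun A => A v) this).trans ?_
  simp [pd, add_comm]

theorem pd_pd_clm {E F : Type*} [NormedAddCommGroup E] [NormedSpace ℝ E]
    [NormedAddCommGroup F] [NormedSpace ℝ F] (ℓ : E →L[ℝ] F) {f : Base → E} {z : Base}
    (h : ContDiffAt ℝ 2 f z) (v : Base) :
    pd v (fun y => ℓ (f y)) z = ℓ (pd v f z) ∧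
    pd v (pd v fun y => ℓ (f y)) z = ℓ (pd v (pd v f) z) := by
  have h1 : (pd v fun y => ℓ (f y)) =ᶠ[nhds z] fun y => ℓ (pd v f y) :=
    (h.eventually (by simp)).mono fun y hy => pd_clm ℓ (hy.differentiableAt (by norm_num)) v
  exact ⟨h1.self_of_nhds, by
    rw [pd_congr h1, pd_clm ℓ ((ContDiffAt.pd (m := 1) h (by norm_num) v).differentiableAt (by norm_num))]⟩

/-- Derivatives along a section `κ` of a function on a product. -/
theorem pd_pd_section {V W : Type*} [NormedAddCommGroup V] [NormedSpace ℝ V]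
    [NormedAddCommGroup W] [NormedSpace ℝ W] {Φ : Base × V → W} {κ : Base → V} {z : Base} {a : V}
    (hκ : κ z = a) (hΦ : ContDiffAt ℝ 2 Φ (z, a)) (sκ : ContDiffAt ℝ 2 κ z) (v : Base) :
    pd v (fun y => Φ (y, κ y)) z = pd v (fun y => Φ (y, a)) z + fderiv ℝ Φ (z, a) (0, pd v κ z) ∧
    pd v (pd v fun y => Φ (y, κ y)) z = pd v (pd v fun y => Φ (y, a)) z
      + (2 : ℝ) • fderiv ℝ (fderiv ℝ Φ) (z, a) (v, 0) (0, pd v κ z)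
      + fderiv ℝ (fderiv ℝ Φ) (z, a) (0, pd v κ z) (0, pd v κ z)
      + fderiv ℝ Φ (z, a) (0, pd v (pd v κ) z) := by
  have graph : ∀ {μ : Base → V}, ContDiffAt ℝ 2 μ z → pd v (fun y => (y, μ y)) z = (v, pd v μ z) ∧
      pd v (pd v fun y => (y, μ y)) z = (0, pd v (pd v μ) z) := by
    intro μ sμ
    have s : ContDiffAt ℝ 2 (fun y => (y, μ y)) z := contDiffAt_id.prodMk sμ
    obtain ⟨a1, a2⟩ := pd_pd_clm (ContinuousLinearMap.fst ℝ Base V) s v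
    obtain ⟨b1, b2⟩ := pd_pd_clm (ContinuousLinearMap.snd ℝ Base V) s v
    have i1 : pd v (fun y : Base => y) = fun _ => v := funext fun y => by simp [pd]
    refine ⟨Prod.ext (a1.symm.trans ?_) b1.symm, Prod.ext (a2.symm.trans ?_) b2.symm⟩
    · exact congrFun i1 z
    · change pd v (pd v (fun y : Base => y)) z = 0
      rw [i1]; simp [pd]
  obtain ⟨k1, k2⟩ := graph sκ
  obtain ⟨c1, c2⟩ := graph (μ := fun _ => a) contDiffAt_const
  have z1 : pd v (fun _ : Base => a) = fun _ => 0 := funext fun y => by simp [pd]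
  have z2 : pd v (fun _ : Base => (0 : V)) z = 0 := by simp [pd]
  obtain ⟨d1, d2⟩ := pd_pd_comp (h := Φ) (k := fun y => (y, κ y)) (z := z) (by rwa [hκ])
    (contDiffAt_id.prodMk sκ) v
  obtain ⟨e1, e2⟩ := pd_pd_comp (h := Φ) (k := fun y => (y, a)) (z := z) hΦ
    (contDiffAt_id.prodMk contDiffAt_const) v
  rw [k1, hκ] at d1
  rw [k1, k2, hκ] at d2
  rw [c1, z1] at e1
  rw [c1, c2, z1, z2] at e2
  have split : ∀ r : V, ((v, r) : Base × V) = (v, 0) + (0, r) := fun r => by simp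
  have sym := (hΦ.isSymmSndFDerivAt (by simp)) (0, pd v κ z) (v, 0)
  refine ⟨?_, ?_⟩
  · rw [d1, e1, split (pd v κ z), map_add]
  · rw [d2, e2, split (pd v κ z), map_add, map_add, add_apply, add_apply, sym, two_smul,
      show ((0 : Base), (0 : V)) = 0 from rfl, map_zero]
    abel

/-- Quadratic functions with a prescribed second order jet. -/
theorem exists_quadratic {E : Type*} [NormedAddCommGroup E] [NormedSpace ℝ E] (ζ : Base) (e : E)
    (ℓ : Base →L[ℝ] E) (q : Base →L[ℝ] Base →L[ℝ] E) (hq : ∀ v w, q v w = q w v) :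
    ∃ F : Base → E, ContDiff ℝ ∞ F ∧ F ζ = e ∧ fderiv ℝ F ζ = ℓ ∧ fderiv ℝ (fderiv ℝ F) ζ = q := by
  have d : ∀ y, HasFDerivAt (fun y => e + ℓ (y - ζ) + (1 / 2 : ℝ) • q (y - ζ) (y - ζ))
      (ℓ + q (y - ζ)) y := by
    intro y
    have h0 : HasFDerivAt (fun y : Base => y - ζ) (ContinuousLinearMap.id ℝ Base) y :=
      (hasFDerivAt_id y).sub_const ζ
    have h1 := ℓ.hasFDerivAt.comp y h0
    have h2 := (q.hasFDerivAt.comp y h0).clm_apply h0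
    refine ((h1.const_add e).add (h2.const_smul (1 / 2 : ℝ))).congr_fderiv ?_
    refine ContinuousLinearMap.ext fun v => ?_
    simp [hq v y, hq v ζ]
    module
  refine ⟨fun y => e + ℓ (y - ζ) + (1 / 2 : ℝ) • q (y - ζ) (y - ζ), ?_, ?_, ?_, ?_⟩
  · fun_prop
  · simp
  · rw [(d ζ).fderiv]; simp
  · have : fderiv ℝ (fun y => e + ℓ (y - ζ) + (1 / 2 : ℝ) • q (y - ζ) (y - ζ)) = fun y => ℓ + q (y - ζ) :=
      funext fun y => (d y).fderiv
    rw [this]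
    have h0 : HasFDerivAt (fun y : Base => y - ζ) (ContinuousLinearMap.id ℝ Base) ζ :=
      (hasFDerivAt_id ζ).sub_const ζ
    have h2 := (q.hasFDerivAt.comp ζ h0).const_add ℓ
    exact h2.fderiv

/-! ### Test equations for an arbitrary fibre-preserving transformation -/

namespace FiberMap

variable (G : FiberMap)

/-- The components of the base map. -/
def time (z : Base) : ℝ := (G.base z).1
def xcoord (z : Base) : ℝ := (G.base z).2.1
def ycoord (z : Base) : ℝ := (G.base z).2.2

/-- The derivative of the first fibre map along the fibre. -/
noncomputable def fibD (z : Base) (a : ℂ) : ℂ →L[ℝ] ℂ :=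
  (fderiv ℝ (fun q : Base × ℂ => G.psi q.1 q.2) (z, a)).comp (ContinuousLinearMap.inr ℝ Base ℂ)

/-- Second derivatives of the first fibre map, in a base and a fibre direction. -/
noncomputable def mixed (v z : Base) (a : ℂ) : ℂ →L[ℝ] ℂ :=
  (fderiv ℝ (fderiv ℝ (fun q : Base × ℂ => G.psi q.1 q.2)) (z, a) (v, 0)).comp
    (ContinuousLinearMap.inr ℝ Base ℂ)

/-- Second derivatives of the first fibre map along the fibre. -/
noncomputable def fibH (z : Base) (a : ℂ) (r s : ℂ) : ℂ :=
  fderiv ℝ (fderiv ℝ (fun q : Base × ℂ => G.psi q.1 q.2)) (z, a) (0, r) (0, s)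

end FiberMap

/-- Only the diagonal of the Hessian form is recorded, since the system contains only pure second
derivatives. Mixed derivatives with t are set to zero: the tests never need them. -/
theorem quadratic_of_coefficients {E : Type*} [NormedAddCommGroup E] [NormedSpace ℝ E] (ζ : Base)
    (e ℓt ℓx ℓy qtt qxx qyy qxy : E) :
    ∃ F : Base → E, ContDiff ℝ ∞ F ∧ F ζ = e ∧
      (∀ v, fderiv ℝ F ζ v = v.1 • ℓt + v.2.1 • ℓx + v.2.2 • ℓy) ∧
      ∀ v, fderiv ℝ (fderiv ℝ F) ζ v v = v.1 ^ 2 • qtt + v.2.1 ^ 2 • qxx + v.2.2 ^ 2 • qyy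
        + (2 * v.2.1 * v.2.2) • qxy := by
  let τ : Base →L[ℝ] ℝ := ContinuousLinearMap.fst ℝ ℝ (ℝ × ℝ)
  let ξ : Base →L[ℝ] ℝ := (ContinuousLinearMap.fst ℝ ℝ ℝ).comp (ContinuousLinearMap.snd ℝ ℝ (ℝ × ℝ))
  let η : Base →L[ℝ] ℝ := (ContinuousLinearMap.snd ℝ ℝ ℝ).comp (ContinuousLinearMap.snd ℝ ℝ (ℝ × ℝ))
  obtain ⟨F, h1, h2, h3, h4⟩ := exists_quadratic ζ e
    (τ.smulRight ℓt + ξ.smulRight ℓx + η.smulRight ℓy)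
    (τ.smulRight (τ.smulRight qtt) + ξ.smulRight (ξ.smulRight qxx) + η.smulRight (η.smulRight qyy)
      + (ξ.smulRight (η.smulRight qxy) + η.smulRight (ξ.smulRight qxy))) (fun v w => by
      simp only [add_apply, ContinuousLinearMap.smulRight_apply,
        smul_apply, smul_smul]
      rw [mul_comm (τ v), mul_comm (ξ v) (ξ w), mul_comm (η v) (η w), mul_comm (ξ v) (η w),
        mul_comm (η v) (ξ w), add_comm ((η w * ξ v) • qxy)])
  refine ⟨F, h1, h2, fun v => by rw [h3]; simp [τ, ξ, η], fun v => ?_⟩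
  rw [h4]
  simp only [τ, ξ, η, add_apply, ContinuousLinearMap.smulRight_apply,
        smul_apply, smul_smul, ContinuousLinearMap.comp_apply,
        ContinuousLinearMap.coe_fst', ContinuousLinearMap.coe_snd']
  module

/-- The transformed system evaluated on quadratic test functions. -/
theorem FiberMap.Transforms.test {G : FiberMap} {N : Set Tot} {c : Coeffs}
    {p₁ p₂ q₁ q₂ r₁ r₂ : ℝ} (hG : G.IsLocallyInvertibleOn N)
    (hT : G.Transforms N c (Coeffs.const p₁ p₂ q₁ q₂ r₁ r₂)) {z : Base} {a : ℂ} {b : ℝ}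
    (hp : (z, (a, b)) ∈ N) (ℓt ℓx ℓy qtt qxx qyy qxy : ℂ) (nxx nyy : ℝ)
    (h1 : Complex.I * ℓt + p₁ * qxx + p₂ * qyy = q₁ * Complex.normSq a * a + q₂ * a * b)
    (h2 : nxx + r₁ * nyy = r₂ * (2 * (starRingEnd ℂ a * qyy).re + 2 * Complex.normSq ℓy))
    {l k : Base → ℂ} {n : Base → ℝ}
    (hl : l = fun v => pd v G.time z • ℓt + pd v G.xcoord z • ℓx + pd v G.ycoord z • ℓy)
    (hk : k = fun v => pd v G.time z ^ 2 • qtt + pd v G.xcoord z ^ 2 • qxx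
      + pd v G.ycoord z ^ 2 • qyy + (2 * pd v G.xcoord z * pd v G.ycoord z) • qxy
      + (pd v (pd v G.time) z • ℓt + pd v (pd v G.xcoord) z • ℓx + pd v (pd v G.ycoord) z • ℓy))
    (hn : n = fun v => pd v G.xcoord z ^ 2 * nxx + pd v G.ycoord z ^ 2 * nyy) :
    Complex.I * (pd et (fun y => G.psi y a) z + G.fibD z a (l et))
      + c.p₁ z.1 * (pd ex (pd ex fun y => G.psi y a) z + 2 * G.mixed ex z a (l ex)
        + G.fibH z a (l ex) (l ex) + G.fibD z a (k ex))
      + c.p₂ z.1 * (pd ey (pd ey fun y => G.psi y a) z + 2 * G.mixed ey z a (l ey)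
        + G.fibH z a (l ey) (l ey) + G.fibD z a (k ey))
      = c.q₁ z.1 * Complex.normSq (G.psi z a) * G.psi z a + c.q₂ z.1 * G.psi z a * G.w z b ∧
    (pd ex (pd ex fun y => G.w y b) z + deriv (G.w z) b * n ex)
      + c.r₁ z.1 * (pd ey (pd ey fun y => G.w y b) z + deriv (G.w z) b * n ey)
      = c.r₂ z.1 * (2 * (starRingEnd ℂ (G.psi z a) * (pd ey (pd ey fun y => G.psi y a) z
          + 2 * G.mixed ey z a (l ey) + G.fibH z a (l ey) (l ey) + G.fibD z a (k ey))).re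
        + 2 * Complex.normSq (pd ey (fun y => G.psi y a) z + G.fibD z a (l ey))) := by
  obtain ⟨sΓ, -, sψ, -, sw, -⟩ := hG _ hp
  dsimp only at sΓ sψ sw
  have sΓ2 := sΓ.of_le two_le_infty
  have sψ2 := sψ.of_le two_le_infty
  have sw2 := sw.of_le two_le_infty
  set ζ := G.base z with hζ
  obtain ⟨F₁, F1, F2, F3, F4⟩ := quadratic_of_coefficients ζ a ℓt ℓx ℓy qtt qxx qyy qxy
  obtain ⟨F₂, K1, K2, K3, K4⟩ := quadratic_of_coefficients ζ b 0 0 0 0 nxx nyy 0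
  have s1 : ContDiffAt ℝ 2 F₁ ζ := F1.contDiffAt.of_le two_le_infty
  have s2 : ContDiffAt ℝ 2 F₂ ζ := K1.contDiffAt.of_le two_le_infty
  have sF : ContDiffAt ℝ 2 (fun y => (F₁ y, F₂ y)) ζ := s1.prodMk s2
  have hsol : SolvesAt (Coeffs.const p₁ p₂ q₁ q₂ r₁ r₂) (fun y => (F₁ y, F₂ y)) ζ := by
    rw [SolvesAt, Delta_jet _ sF]
    refine Prod.ext ?_ ?_
    · simp only [sys₁, Coeffs.const, Prod.fst_zero]
      rw [pd_pd_eq_fderiv s1, pd_pd_eq_fderiv s1, F4, F4, F2, K2, pd, F3]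
      simp only [et, ex, ey]
      simp
      linear_combination h1
    · simp only [sys₂, Coeffs.const, Prod.snd_zero]
      rw [pd_pd_eq_fderiv s1, pd_pd_eq_fderiv s2, pd_pd_eq_fderiv s2, F4, F2, K4, K4, pd, F3]
      simp only [ex, ey]
      simp only [Complex.mul_re, Complex.conj_re, Complex.conj_im] at h2
      simp
      linear_combination h2
  -- Only this implication of the equivalence, from the new system to the old one, enters the proof
  -- of necessity.
  have hpull := (hT z _ sF (by simpa [← hζ, F2, K2] using hp)).1 hsol
  -- first and second derivatives of the components of the base map
  have cT := pd_pd_clm (ContinuousLinearMap.fst ℝ ℝ (ℝ × ℝ)) sΓ2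
  have cX := pd_pd_clm ((ContinuousLinearMap.fst ℝ ℝ ℝ).comp (ContinuousLinearMap.snd ℝ ℝ (ℝ × ℝ))) sΓ2
  have cY := pd_pd_clm ((ContinuousLinearMap.snd ℝ ℝ ℝ).comp (ContinuousLinearMap.snd ℝ ℝ (ℝ × ℝ))) sΓ2
  change ∀ v, pd v G.time z = (pd v G.base z).1 ∧ pd v (pd v G.time) z = (pd v (pd v G.base) z).1 at cT
  change ∀ v, pd v G.xcoord z = (pd v G.base z).2.1 ∧
    pd v (pd v G.xcoord) z = (pd v (pd v G.base) z).2.1 at cX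
  change ∀ v, pd v G.ycoord z = (pd v G.base z).2.2 ∧
    pd v (pd v G.ycoord) z = (pd v (pd v G.base) z).2.2 at cY
  have sκ : ContDiffAt ℝ 2 (fun y => F₁ (G.base y)) z := ContDiffAt.comp (g := F₁) z s1 sΓ2
  have sμ : ContDiffAt ℝ 2 (fun y => F₂ (G.base y)) z := ContDiffAt.comp (g := F₂) z s2 sΓ2
  have κ1 : ∀ v, pd v (fun y => F₁ (G.base y)) z = l v := fun v => by
    rw [(pd_pd_comp (h := F₁) (k := G.base) s1 sΓ2 v).1, F3, hl]
    simp only [(cT v).1, (cX v).1, (cY v).1]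
  have κ2 : ∀ v, pd v (pd v fun y => F₁ (G.base y)) z = k v := fun v => by
    rw [(pd_pd_comp (h := F₁) (k := G.base) s1 sΓ2 v).2, F3, F4, hk]
    simp only [(cT v).1, (cX v).1, (cY v).1, (cT v).2, (cX v).2, (cY v).2]
  have μ1 : ∀ v, pd v (fun y => F₂ (G.base y)) z = 0 := fun v => by
    rw [(pd_pd_comp (h := F₂) (k := G.base) s2 sΓ2 v).1, K3]; simp
  have μ2 : ∀ v, pd v (pd v fun y => F₂ (G.base y)) z = n v := fun v => by
    rw [(pd_pd_comp (h := F₂) (k := G.base) s2 sΓ2 v).2, K3, K4, hn]; simp [(cX v).1, (cY v).1]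
  have D₁ := pd_pd_section (Φ := fun q : Base × ℂ => G.psi q.1 q.2)
    (κ := fun y => F₁ (G.base y)) F2 sψ2 sκ
  have D₂ := pd_pd_section (Φ := fun q : Base × ℝ => G.w q.1 q.2)
    (κ := fun y => F₂ (G.base y)) K2 sw2 sμ
  have D₁' : ∀ v, pd v (fun y => G.psi y (F₁ (G.base y))) z
        = pd v (fun y => G.psi y a) z + G.fibD z a (l v) ∧
      pd v (pd v fun y => G.psi y (F₁ (G.base y))) z = pd v (pd v fun y => G.psi y a) z
        + 2 * G.mixed v z a (l v) + G.fibH z a (l v) (l v) + G.fibD z a (k v) := fun v => by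
    have h := D₁ v
    rw [κ1, κ2] at h
    refine ⟨h.1, h.2.trans ?_⟩
    rw [Complex.real_smul, Complex.ofReal_ofNat]
    rfl
  have dw : ∀ r : ℝ, fderiv ℝ (fun q : Base × ℝ => G.w q.1 q.2) (z, b) (0, r) = deriv (G.w z) b * r := by
    intro r
    have h := ((sw2.differentiableAt (by norm_num)).hasFDerivAt).comp_hasDerivAt b
      ((hasDerivAt_const b z).prodMk (hasDerivAt_id b))
    rw [show deriv (G.w z) b = _ from h.deriv]
    have : ((0 : Base), r) = r • ((0 : Base), (1 : ℝ)) := by simp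
    rw [this, map_smul, smul_eq_mul, mul_comm]
  have D₂' : ∀ v, pd v (pd v fun y => G.w y (F₂ (G.base y))) z
      = pd v (pd v fun y => G.w y b) z + deriv (G.w z) b * n v := fun v => by
    have h := (D₂ v).2
    have h0 : ((0 : Base), (0 : ℝ)) = 0 := rfl
    rw [μ1, μ2, dw, h0, map_zero, map_zero, smul_zero, add_zero, add_zero] at h
    exact h
  have sP : ContDiffAt ℝ 2 (G.pull fun y => (F₁ y, F₂ y)) z := by
    refine ContDiffAt.prodMk ?_ ?_
    · exact ContDiffAt.comp (g := fun q : Base × ℂ => G.psi q.1 q.2) (f := fun y => (y, F₁ (G.base y))) z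
        (by simpa [← hζ, F2] using sψ2) (contDiffAt_id.prodMk sκ)
    · exact ContDiffAt.comp (g := fun q : Base × ℝ => G.w q.1 q.2) (f := fun y => (y, F₂ (G.base y))) z
        (by simpa [← hζ, K2] using sw2) (contDiffAt_id.prodMk sμ)
  rw [SolvesAt, Delta_jet _ sP] at hpull
  obtain ⟨E1, E2⟩ := Prod.mk.inj hpull
  simp only [sys₁, sys₂, FiberMap.pull] at E1 E2
  rw [(D₁' et).1, (D₁' ex).2, (D₁' ey).2, ← hζ, F2, K2] at E1
  rw [D₂' ex, D₂' ey, (D₁' ey).1, (D₁' ey).2, ← hζ, F2] at E2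
  exact ⟨sub_eq_zero.1 E1, sub_eq_zero.1 E2⟩

theorem FiberMap.fibH_zero (G : FiberMap) (z : Base) (a : ℂ) : G.fibH z a 0 0 = 0 := by
  unfold fibH
  rw [show ((0 : Base), (0 : ℂ)) = 0 from rfl, map_zero]

theorem FiberMap.fibH_smul (G : FiberMap) (z : Base) (a r : ℂ) (t : ℝ) :
    G.fibH z a (t • r) (t • r) = t ^ 2 * G.fibH z a r r := by
  unfold fibH
  have : ((0 : Base), t • r) = t • ((0 : Base), r) := by simp
  rw [this, map_smul, map_smul, smul_apply, smul_smul, Complex.real_smul]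
  push_cast; ring

/-- A fibre-preserving transformation to a system with constant non-zero coefficients, on an open
set on which it does not produce the value `ψ = 0`. -/
structure FiberMap.Reduces (G : FiberMap) (N : Set Tot) (c : Coeffs) (I : Opens ℝ)
    (p₁ p₂ q₁ q₂ r₁ r₂ : ℝ) : Prop where
  coeffs : c.SmoothNonzeroOn I
  isOpen : IsOpen N
  subset : N ⊆ dom I
  invertible : G.IsLocallyInvertibleOn N
  transforms : G.Transforms N c (Coeffs.const p₁ p₂ q₁ q₂ r₁ r₂)
  p₁_ne : p₁ ≠ 0
  p₂_ne : p₂ ≠ 0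
  q₁_ne : q₁ ≠ 0
  q₂_ne : q₂ ≠ 0
  r₁_ne : r₁ ≠ 0
  r₂_ne : r₂ ≠ 0
  psi_ne : ∀ p ∈ N, G.psi p.1 p.2.1 ≠ 0

/-! ### Determining equations for the transformation -/

namespace FiberMap.Reduces

variable {G : FiberMap} {N : Set Tot} {c : Coeffs} {I : Opens ℝ} {p₁ p₂ q₁ q₂ r₁ r₂ : ℝ}
  {z : Base} {a : ℂ} {b : ℝ}

/-- The reference test: all first derivatives vanish, and ψ̃_xx alone balances the nonlinear terms.
`perturb` compares every other test with it. -/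
theorem base (h : G.Reduces N c I p₁ p₂ q₁ q₂ r₁ r₂) (hp : (z, (a, b)) ∈ N) :
    Complex.I * pd et (fun y => G.psi y a) z
      + c.p₁ z.1 * (pd ex (pd ex fun y => G.psi y a) z
        + G.fibD z a (pd ex G.xcoord z ^ 2 • ((q₁ * Complex.normSq a * a + q₂ * a * b) / p₁)))
      + c.p₂ z.1 * (pd ey (pd ey fun y => G.psi y a) z
        + G.fibD z a (pd ey G.xcoord z ^ 2 • ((q₁ * Complex.normSq a * a + q₂ * a * b) / p₁)))
      = c.q₁ z.1 * Complex.normSq (G.psi z a) * G.psi z a + c.q₂ z.1 * G.psi z a * G.w z b ∧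
    pd ex (pd ex fun y => G.w y b) z + c.r₁ z.1 * pd ey (pd ey fun y => G.w y b) z
      = c.r₂ z.1 * (2 * (starRingEnd ℂ (G.psi z a) * (pd ey (pd ey fun y => G.psi y a) z
          + G.fibD z a (pd ey G.xcoord z ^ 2 • ((q₁ * Complex.normSq a * a + q₂ * a * b) / p₁)))).re
        + 2 * Complex.normSq (pd ey (fun y => G.psi y a) z)) := by
  have hp₁ : (p₁ : ℂ) ≠ 0 := Complex.ofReal_ne_zero.2 h.p₁_ne
  have t := h.transforms.test h.invertible hp 0 0 0 0
    ((q₁ * Complex.normSq a * a + q₂ * a * b) / p₁) 0 0 0 0 (by field_simp; ring) (by simp) rfl rfl rfl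
  have h0 := G.fibH_zero z a
  simpa only [smul_zero, add_zero, zero_add, mul_zero, map_zero, h0] using t

/-- The effect of a perturbation of quadratic test functions. -/
theorem perturb (h : G.Reduces N c I p₁ p₂ q₁ q₂ r₁ r₂) (hp : (z, (a, b)) ∈ N)
    (ℓt ℓx ℓy qtt qxx qyy qxy : ℂ) (nxx nyy : ℝ)
    (h1 : Complex.I * ℓt + p₁ * qxx + p₂ * qyy = 0)
    (h2 : nxx + r₁ * nyy = r₂ * (2 * (starRingEnd ℂ a * qyy).re + 2 * Complex.normSq ℓy))
    {l k : Base → ℂ} {n : Base → ℝ}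
    (hl : l = fun v => pd v G.time z • ℓt + pd v G.xcoord z • ℓx + pd v G.ycoord z • ℓy)
    (hk : k = fun v => pd v G.time z ^ 2 • qtt + pd v G.xcoord z ^ 2 • qxx
      + pd v G.ycoord z ^ 2 • qyy + (2 * pd v G.xcoord z * pd v G.ycoord z) • qxy
      + (pd v (pd v G.time) z • ℓt + pd v (pd v G.xcoord) z • ℓx + pd v (pd v G.ycoord) z • ℓy))
    (hn : n = fun v => pd v G.xcoord z ^ 2 * nxx + pd v G.ycoord z ^ 2 * nyy) :
    Complex.I * G.fibD z a (l et)
      + c.p₁ z.1 * (2 * G.mixed ex z a (l ex) + G.fibH z a (l ex) (l ex) + G.fibD z a (k ex))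
      + c.p₂ z.1 * (2 * G.mixed ey z a (l ey) + G.fibH z a (l ey) (l ey) + G.fibD z a (k ey)) = 0 ∧
    deriv (G.w z) b * (n ex + c.r₁ z.1 * n ey)
      = c.r₂ z.1 * (2 * (starRingEnd ℂ (G.psi z a) *
          (2 * G.mixed ey z a (l ey) + G.fibH z a (l ey) (l ey) + G.fibD z a (k ey))).re
        + 2 * Complex.normSq (pd ey (fun y => G.psi y a) z + G.fibD z a (l ey))
        - 2 * Complex.normSq (pd ey (fun y => G.psi y a) z)) := by
  have hp₁ : (p₁ : ℂ) ≠ 0 := Complex.ofReal_ne_zero.2 h.p₁_ne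
  obtain ⟨B1, B2⟩ := h.base hp
  set s := (q₁ * Complex.normSq a * a + q₂ * a * b) / p₁ with hs
  -- Adding the reference value `s` to ψ̃_xx turns the homogeneous condition `h1` into the first
  -- equation of the new system. Subtracting `base` then removes everything that does not depend on
  -- the perturbation.
  obtain ⟨T1, T2⟩ := h.transforms.test h.invertible hp ℓt ℓx ℓy qtt (qxx + s) qyy qxy nxx nyy
    (by rw [hs]; field_simp; linear_combination h1) h2 hl (k := fun v => k v + pd v G.xcoord z ^ 2 • s)
    (by rw [hk]; funext v; simp only [smul_add]; ring) hn
  simp only [map_add] at T1 T2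
  constructor
  · linear_combination T1 - B1
  · have e : ∀ A U V W : ℂ, (A * (U + V + W + (G.fibD z a (k ey) + G.fibD z a (pd ey G.xcoord z ^ 2 • s)))).re
        = (A * (V + W + G.fibD z a (k ey))).re + (A * (U + G.fibD z a (pd ey G.xcoord z ^ 2 • s))).re := by
      intro A U V W
      rw [← Complex.add_re]
      congr 1
      ring
    rw [e] at T2
    linear_combination T2 - B2

theorem fiber (h : G.Reduces N c I p₁ p₂ q₁ q₂ r₁ r₂) (hp : (z, (a, b)) ∈ N) :
    HasFDerivAt (G.psi z) (G.fibD z a) a ∧ Function.Bijective (G.fibD z a) := by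
  obtain ⟨-, -, s, hb, -, -⟩ := h.invertible _ hp
  have d : HasFDerivAt (G.psi z) (G.fibD z a) a :=
    HasFDerivAt.comp (g := fun q : Base × ℂ => G.psi q.1 q.2) a
      (s.differentiableAt (by simp)).hasFDerivAt (hasFDerivAt_prodMk_right z a)
  refine ⟨d, ?_⟩
  have := d.fderiv
  dsimp only at hb
  rwa [this] at hb

theorem near (h : G.Reduces N c I p₁ p₂ q₁ q₂ r₁ r₂) (hp : (z, (a, b)) ∈ N) :
    ∀ᶠ y in nhds z, (y, (a, b)) ∈ N :=
  (Continuous.prodMk_left ((a, b) : Fib)).continuousAt.eventually (h.isOpen.mem_nhds hp)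

theorem time_smooth (h : G.Reduces N c I p₁ p₂ q₁ q₂ r₁ r₂) (hp : (z, (a, b)) ∈ N) :
    ContDiffAt ℝ ∞ G.time z ∧ ContDiffAt ℝ ∞ G.xcoord z ∧ ContDiffAt ℝ ∞ G.ycoord z :=
  have s := (h.invertible _ hp).1
  ⟨s.fst, s.snd.fst, s.snd.snd⟩

theorem re_conj_mul_smul (ψ : ℂ) (t : ℝ) : (starRingEnd ℂ ψ * (t • ψ)).re = t * Complex.normSq ψ := by
  simp [Complex.normSq_apply]; ring

/-- ψ̃_tt does not occur in the new system, so it may be perturbed freely. In the old system it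
enters with T_y² and T_x², which must vanish: the second equation gives T_y = 0, then the first T_x
= 0. -/
theorem time_space (h : G.Reduces N c I p₁ p₂ q₁ q₂ r₁ r₂) (hp : (z, (a, b)) ∈ N) :
    pd ex G.time z = 0 ∧ pd ey G.time z = 0 := by
  have hψ := h.psi_ne _ hp
  obtain ⟨-, -, -, -, -, hr₂⟩ := h.coeffs.ne_zero z.1 (h.subset hp)
  have hp₁ := (h.coeffs.ne_zero z.1 (h.subset hp)).1
  -- The fibre derivative takes δ to ψ itself, so that Re(ψ̄ · Dψ δ) becomes |ψ|² ≠ 0.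
  obtain ⟨δ, hδ⟩ := (h.fiber hp).2.2 (G.psi z a)
  have h0 := G.fibH_zero z a
  obtain ⟨t1, t2⟩ := h.perturb hp 0 0 0 δ 0 0 0 0 0 (by simp) (by simp) rfl rfl rfl
  simp only [smul_zero, add_zero, zero_add, mul_zero, map_zero, h0, map_smul, hδ,
    re_conj_mul_smul] at t1 t2
  have hN : Complex.normSq (G.psi z a) ≠ 0 := by simpa using hψ
  have hy : pd ey G.time z = 0 := by
    have := mul_eq_zero.1 t2.symm
    rcases this with h' | h'
    · exact absurd h' hr₂
    · have : pd ey G.time z ^ 2 * Complex.normSq (G.psi z a) = 0 := by linarith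
      exact pow_eq_zero_iff two_ne_zero |>.1 ((mul_eq_zero.1 this).resolve_right hN)
  refine ⟨?_, hy⟩
  rw [hy] at t1
  simp only [ne_eq, OfNat.ofNat_ne_zero, not_false_eq_true, zero_pow, zero_smul, mul_zero, add_zero,
    mul_eq_zero, Complex.ofReal_eq_zero, smul_eq_zero, pow_eq_zero_iff] at t1
  exact (t1.resolve_left hp₁).resolve_right hψ

/-- The equations satisfied by the first derivatives of the transformation. -/
structure FirstOrder (G : FiberMap) (c : Coeffs) (p₁ p₂ r₁ r₂ : ℝ) (z : Base) (a : ℂ) (b : ℝ) :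
    Prop where
  X_y : pd ey G.xcoord z = 0
  Y_x : pd ex G.ycoord z = 0
  X_x : pd ex G.xcoord z ≠ 0
  Y_y : pd ey G.ycoord z ≠ 0
  T_t : pd et G.time z ≠ 0
  p₁ : ∀ δ, Complex.I * G.fibD z a (Complex.I * δ) * (pd et G.time z * p₁)
    + c.p₁ z.1 * pd ex G.xcoord z ^ 2 * G.fibD z a δ = 0
  p₂ : ∀ δ, Complex.I * G.fibD z a (Complex.I * δ) * (pd et G.time z * p₂)
    + c.p₂ z.1 * pd ey G.ycoord z ^ 2 * G.fibD z a δ = 0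
  r₁ : c.r₁ z.1 * pd ey G.ycoord z ^ 2 = r₁ * pd ex G.xcoord z ^ 2
  r₂ : ∀ δ, deriv (G.w z) b * pd ex G.xcoord z ^ 2 * r₂ * (starRingEnd ℂ a * δ).re
    = c.r₂ z.1 * pd ey G.ycoord z ^ 2 * (starRingEnd ℂ (G.psi z a) * G.fibD z a δ).re

/-- Each relation comes from a perturbation whose effects cancel in the new system: ψ̃_xx or ψ̃_yy
against ψ̃_t, ψ̃_xy alone, and w̃_xx against w̃_yy. Invertibility of the base map supplies the
non-vanishing derivatives. -/
theorem firstOrder (h : G.Reduces N c I p₁ p₂ q₁ q₂ r₁ r₂) (hp : (z, (a, b)) ∈ N) :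
    FirstOrder G c p₁ p₂ r₁ r₂ z a b := by
  have hψ := h.psi_ne _ hp
  dsimp only at hψ
  have hr₂ := (h.coeffs.ne_zero z.1 (h.subset hp)).2.2.2.2.2
  have hp₁ := (h.coeffs.ne_zero z.1 (h.subset hp)).1
  have hN : Complex.normSq (G.psi z a) ≠ 0 := by simpa using hψ
  obtain ⟨tx, ty⟩ := h.time_space hp
  have txx : pd ex (pd ex G.time) z = 0 :=
    pd_eq_zero_of_const ((h.near hp).mono fun y hy => (h.time_space hy).1) ex
  have tyy : pd ey (pd ey G.time) z = 0 :=
    pd_eq_zero_of_const ((h.near hp).mono fun y hy => (h.time_space hy).2) ey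
  obtain ⟨δ₀, hδ₀⟩ := (h.fiber hp).2.2 (G.psi z a)
  have h0 := G.fibH_zero z a
  have ex1 := fun δ => h.perturb hp (Complex.I * (p₁ * δ)) 0 0 0 δ 0 0 0 0
    (by linear_combination p₁ * δ * Complex.I_sq) (by simp) rfl rfl rfl
  have two0 : (2 : ℝ) ≠ 0 := two_ne_zero
  have X_y : pd ey G.xcoord z = 0 := by
    have t2 := (ex1 δ₀).2
    simp only [tx, ty, txx, tyy, zero_smul, smul_zero, add_zero, zero_add, mul_zero, map_zero, h0,
      map_smul, hδ₀, re_conj_mul_smul] at t2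
    have : pd ey G.xcoord z ^ 2 * Complex.normSq (G.psi z a) = 0 := by
      have := (mul_eq_zero.1 t2.symm).resolve_left hr₂
      linarith
    exact pow_eq_zero_iff two_ne_zero |>.1 ((mul_eq_zero.1 this).resolve_right hN)
  -- ψ̃_xy is absent from the new system, while its coefficient in ψ_xx is 2 X_x Y_x Dψ.
  have XY : pd ex G.xcoord z * pd ex G.ycoord z = 0 := by
    have t1 := (h.perturb hp 0 0 0 0 0 0 δ₀ 0 0 (by simp) (by simp) rfl rfl rfl).1
    simp only [X_y, zero_smul, smul_zero, add_zero, zero_add, mul_zero, zero_mul, map_zero, h0,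
      map_smul, hδ₀, mul_eq_zero, Complex.ofReal_eq_zero, smul_eq_zero, hp₁, hψ, or_false, false_or,
      two0] at t1
    exact mul_eq_zero.2 t1
  -- invertibility of the base map
  obtain ⟨sΓ, hb, -⟩ := h.invertible _ hp
  dsimp only at sΓ hb
  have cT := fun v => (pd_pd_clm (ContinuousLinearMap.fst ℝ ℝ (ℝ × ℝ)) (sΓ.of_le two_le_infty) v).1
  have cX := fun v => (pd_pd_clm ((ContinuousLinearMap.fst ℝ ℝ ℝ).comp
    (ContinuousLinearMap.snd ℝ ℝ (ℝ × ℝ))) (sΓ.of_le two_le_infty) v).1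
  have cY := fun v => (pd_pd_clm ((ContinuousLinearMap.snd ℝ ℝ ℝ).comp
    (ContinuousLinearMap.snd ℝ ℝ (ℝ × ℝ))) (sΓ.of_le two_le_infty) v).1
  change ∀ v, pd v G.time z = (fderiv ℝ G.base z v).1 at cT
  change ∀ v, pd v G.xcoord z = (fderiv ℝ G.base z v).2.1 at cX
  change ∀ v, pd v G.ycoord z = (fderiv ℝ G.base z v).2.2 at cY
  have inj : ∀ v, fderiv ℝ G.base z v = 0 → v = 0 := fun v hv => hb.1 (hv.trans (map_zero _).symm)
  have dy : fderiv ℝ G.base z ey = (0, 0, pd ey G.ycoord z) :=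
    Prod.ext ((cT ey).symm.trans ty) (Prod.ext ((cX ey).symm.trans X_y) (cY ey).symm)
  have dx : fderiv ℝ G.base z ex = (0, pd ex G.xcoord z, pd ex G.ycoord z) :=
    Prod.ext ((cT ex).symm.trans tx) (Prod.ext (cX ex).symm (cY ex).symm)
  have Y_y : pd ey G.ycoord z ≠ 0 := fun h0 => by
    rw [h0] at dy
    have := inj ey dy
    simp [ey, Prod.ext_iff] at this
  have X_x : pd ex G.xcoord z ≠ 0 := fun h0 => by
    have := inj (pd ey G.ycoord z • ex - pd ex G.ycoord z • ey) (by
      rw [map_sub, map_smul, map_smul, dx, dy, h0]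
      simp [mul_comm])
    have := congrArg (fun v : Base => v.2.1) this
    change pd ey G.ycoord z * 1 - pd ex G.ycoord z * 0 = 0 at this
    exact Y_y (by linarith)
  have Y_x := (mul_eq_zero.1 XY).resolve_left X_x
  have T_t : pd et G.time z ≠ 0 := fun h0 => by
    obtain ⟨v, hv⟩ := hb.2 (1, 0, 0)
    have e : v = v.1 • et + v.2.1 • ex + v.2.2 • ey := by simp [et, ex, ey]
    have h1 := congrArg Prod.fst hv
    rw [e, map_add, map_add, map_smul, map_smul, map_smul, dx, dy] at h1
    have h2 := cT et
    rw [h0] at h2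
    simp [← h2] at h1
  refine ⟨X_y, Y_x, X_x, Y_y, T_t, fun δ => ?_, fun δ => ?_, ?_, fun δ => ?_⟩
  · have t1 := (ex1 δ).1
    have e : Complex.I * (p₁ * δ) = p₁ • (Complex.I * δ) := by rw [Complex.real_smul]; ring
    simp only [tx, ty, txx, tyy, X_y, zero_smul, smul_zero, add_zero, zero_add, mul_zero, map_zero, h0,
      map_smul, e, ne_eq, OfNat.ofNat_ne_zero, not_false_eq_true, zero_pow] at t1
    simp only [Complex.real_smul] at t1
    push_cast at t1
    linear_combination t1
  -- ψ̃_yy = δ is compensated by ψ̃_t in the first equation and by w̃_xx in the second.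
  · have t1 := (h.perturb hp (Complex.I * (p₂ * δ)) 0 0 0 0 δ 0
      (2 * r₂ * (starRingEnd ℂ a * δ).re) 0 (by linear_combination p₂ * δ * Complex.I_sq)
      (by rw [map_zero]; ring) rfl rfl rfl).1
    have e : Complex.I * (p₂ * δ) = p₂ • (Complex.I * δ) := by rw [Complex.real_smul]; ring
    simp only [tx, ty, txx, tyy, Y_x, zero_smul, smul_zero, add_zero, zero_add, mul_zero, map_zero, h0,
      map_smul, e, ne_eq, OfNat.ofNat_ne_zero, not_false_eq_true, zero_pow] at t1
    simp only [Complex.real_smul] at t1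
    push_cast at t1
    linear_combination t1
  · have t2 := (h.perturb hp 0 0 0 0 0 0 0 r₁ (-1) (by simp) (by simp) rfl rfl rfl).2
    have hw : deriv (G.w z) b ≠ 0 := (h.invertible _ hp).2.2.2.2.2
    simp only [X_y, Y_x, zero_smul, smul_zero, add_zero, zero_add, mul_zero, map_zero, h0,
      Complex.zero_re, sub_self, mul_eq_zero, hw, false_or] at t2
    linear_combination -t2
  · have t2 := (h.perturb hp (Complex.I * (p₂ * δ)) 0 0 0 0 δ 0
      (2 * r₂ * (starRingEnd ℂ a * δ).re) 0 (by linear_combination p₂ * δ * Complex.I_sq)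
      (by rw [map_zero]; ring) rfl rfl rfl).2
    simp only [tx, ty, txx, tyy, X_y, Y_x, zero_smul, smul_zero, add_zero, zero_add, mul_zero,
      map_zero, h0, ne_eq, OfNat.ofNat_ne_zero, not_false_eq_true, zero_pow, zero_mul] at t2
    have e : (starRingEnd ℂ (G.psi z a) * G.fibD z a (pd ey G.ycoord z ^ 2 • δ)).re
        = pd ey G.ycoord z ^ 2 * (starRingEnd ℂ (G.psi z a) * G.fibD z a δ).re := by
      rw [map_smul, mul_smul_comm, Complex.smul_re, smul_eq_mul]
    rw [e] at t2
    linarith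

/-- With λ = p₁ X_x²/(p̃₁ T_t), `FirstOrder.p₁` says i Dψ(iδ) = -λ Dψ(δ). Used for δ and for iδ it
gives λ² = 1. The sign of λ stays open because Dψ may be complex linear or antilinear, hence the
squares. -/
theorem rotation (h : G.Reduces N c I p₁ p₂ q₁ q₂ r₁ r₂) (hp : (z, (a, b)) ∈ N) :
    (c.p₁ z.1 * pd ex G.xcoord z ^ 2) ^ 2 = (p₁ * pd et G.time z) ^ 2 ∧
    p₁ * (c.p₂ z.1 * pd ey G.ycoord z ^ 2) = p₂ * (c.p₁ z.1 * pd ex G.xcoord z ^ 2) := by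
  have F := h.firstOrder hp
  obtain ⟨δ, hδ⟩ := (h.fiber hp).2.2 (G.psi z a)
  have hψ := h.psi_ne _ hp
  dsimp only at hψ
  have e1 := F.p₁ δ
  have e2 := F.p₁ (Complex.I * δ)
  have e3 := F.p₂ δ
  have eI : Complex.I * (Complex.I * δ) = -δ := by linear_combination δ * Complex.I_sq
  have hT : ((pd et G.time z : ℝ) : ℂ) ≠ 0 := Complex.ofReal_ne_zero.2 F.T_t
  rw [eI, map_neg, hδ] at e2
  rw [hδ] at e1 e3
  constructor
  · have : ((((c.p₁ z.1 * pd ex G.xcoord z ^ 2) ^ 2 - (p₁ * pd et G.time z) ^ 2 : ℝ) : ℂ)) * G.psi z a = 0 := by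
      push_cast
      linear_combination (c.p₁ z.1 * ((pd ex G.xcoord z : ℝ) : ℂ) ^ 2 : ℂ) * e1 - Complex.I * (((pd et G.time z : ℝ) : ℂ) * p₁) * e2
        - (((pd et G.time z : ℝ) : ℂ) * p₁) ^ 2 * G.psi z a * Complex.I_sq
    have := Complex.ofReal_eq_zero.1 ((mul_eq_zero.1 this).resolve_right hψ)
    linarith
  · have : ((((p₁ * (c.p₂ z.1 * pd ey G.ycoord z ^ 2) - p₂ * (c.p₁ z.1 * pd ex G.xcoord z ^ 2) : ℝ) : ℂ)))
        * G.psi z a = 0 := by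
      push_cast
      linear_combination p₁ * e3 - p₂ * e1
    have := Complex.ofReal_eq_zero.1 ((mul_eq_zero.1 this).resolve_right hψ)
    linarith

/-- The second derivatives of the base map in the space variables vanish. -/
theorem secondOrder (h : G.Reduces N c I p₁ p₂ q₁ q₂ r₁ r₂) (hp : (z, (a, b)) ∈ N) :
    pd ex (pd ex G.xcoord) z = 0 ∧ pd ey (pd ey G.xcoord) z = 0 ∧
    pd ex (pd ex G.ycoord) z = 0 ∧ pd ey (pd ey G.ycoord) z = 0 := by
  have F := h.firstOrder hp
  obtain ⟨sT, sX, sY⟩ := h.time_smooth hp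
  obtain ⟨n₁, n₂, -⟩ := h.coeffs.ne_zero z.1 (h.subset hp)
  have tm : ∀ {φ : ℝ → ℝ} {v : Base}, v.1 = 0 → ContDiffOn ℝ ∞ φ I →
      HasPd v (fun y : Base => φ y.1) 0 z := fun hv hφ =>
    (HasPd.time ((contDiffAt_of_mem hφ (h.subset hp)).differentiableAt (by simp))).of_eq (by simp [hv])
  have Xy : ∀ v, pd v (pd ey G.xcoord) z = 0 :=
    pd_eq_zero_of_const ((h.near hp).mono fun y hy => (h.firstOrder hy).X_y)
  have Yx : ∀ v, pd v (pd ex G.ycoord) z = 0 :=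
    pd_eq_zero_of_const ((h.near hp).mono fun y hy => (h.firstOrder hy).Y_x)
  have Tx : ∀ v, pd v (pd ex G.time) z = 0 :=
    pd_eq_zero_of_const ((h.near hp).mono fun y hy => (h.time_space hy).1)
  have X2 : ∀ v, v.1 = 0 → HasPd v (fun y => c.p₁ y.1 * pd ex G.xcoord y ^ 2)
      (c.p₁ z.1 * (2 * pd ex G.xcoord z * pd v (pd ex G.xcoord) z)) z := fun v hv =>
    ((tm hv h.coeffs.smooth_p₁).mul (hasPd (contDiffAt_pd sX ex) v).sq).of_eq (by ring)
  -- The x derivative of the first identity in `rotation`; its right hand side depends on x only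
  -- through T_t, and T_tx = 0.
  have xx : pd ex (pd ex G.xcoord) z = 0 := by
    have l := (X2 ex rfl).sq
    have r := ((hasPd (contDiffAt_pd sT et) ex).const_mul p₁).sq
    have e := l.unique r ((h.near hp).mono fun y hy => (h.rotation hy).1)
    rw [pd_comm (sT.of_le two_le_infty), Tx, mul_zero, mul_zero] at e
    have := F.X_x
    simpa [this, n₁] using e
  refine ⟨xx, Xy ey, Yx ex, ?_⟩
  have l := ((tm (v := ey) rfl h.coeffs.smooth_p₂).mul (hasPd (contDiffAt_pd sY ey) ey).sq).const_mul p₁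
  have e := l.unique ((X2 ey rfl).const_mul p₂) ((h.near hp).mono fun y hy => (h.rotation hy).2)
  rw [pd_comm (sX.of_le two_le_infty) ey ex, Xy] at e
  have := F.Y_y
  simpa [this, n₂, h.p₁_ne] using e

/-- The transformation is affine along the fibres, and its phase is determined by the base map. -/
theorem fiber_affine (h : G.Reduces N c I p₁ p₂ q₁ q₂ r₁ r₂) (hp : (z, (a, b)) ∈ N) (r : ℂ) :
    G.fibH z a r r = 0 ∧
    Complex.I * pd et G.xcoord z * G.fibD z a r
      + 2 * c.p₁ z.1 * pd ex G.xcoord z * G.mixed ex z a r = 0 ∧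
    Complex.I * pd et G.ycoord z * G.fibD z a r
      + 2 * c.p₂ z.1 * pd ey G.ycoord z * G.mixed ey z a r = 0 := by
  have F := h.firstOrder hp
  obtain ⟨xx, Xyy, Yxx, yy⟩ := h.secondOrder hp
  obtain ⟨tx, ty⟩ := h.time_space hp
  have n₁ : (c.p₁ z.1 : ℂ) ≠ 0 := Complex.ofReal_ne_zero.2 (h.coeffs.ne_zero z.1 (h.subset hp)).1
  have hX : ((pd ex G.xcoord z : ℝ) : ℂ) ≠ 0 := Complex.ofReal_ne_zero.2 F.X_x
  have h0 := G.fibH_zero z a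
  -- ψ̃_x = r alone, and in `t3` ψ̃_y = r compensated by w̃_xx. Replacing r by -r separates the
  -- quadratic term `fibH` from the linear ones.
  have t := fun r => (h.perturb hp 0 r 0 0 0 0 0 0 0 (by simp) (by simp) rfl rfl rfl).1
  have neg : G.fibH z a (-r) (-r) = G.fibH z a r r := by
    have := G.fibH_smul z a r (-1)
    simpa using this
  have t1 := t r
  have t2 := t (-r)
  have t3 := (h.perturb hp 0 0 r 0 0 0 0 (2 * r₂ * Complex.normSq r) 0 (by simp)
    (by rw [mul_zero]; simp; ring) rfl rfl rfl).1
  simp only [tx, ty, xx, Xyy, Yxx, yy, F.X_y, F.Y_x, zero_smul, smul_zero, add_zero, zero_add, mul_zero,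
    map_zero, h0, G.fibH_smul, map_smul, map_neg, neg] at t1 t2 t3
  simp only [Complex.real_smul] at t1 t2 t3
  have C : G.fibH z a r r = 0 := by
    have : (c.p₁ z.1 : ℂ) * ((pd ex G.xcoord z : ℝ) : ℂ) ^ 2 * G.fibH z a r r = 0 := by
      linear_combination (t1 + t2) / 2
    exact (mul_eq_zero.1 this).resolve_left (mul_ne_zero n₁ (pow_ne_zero 2 hX))
  refine ⟨C, ?_, ?_⟩
  · rw [C] at t1
    linear_combination t1
  · rw [C] at t3
    linear_combination t3

/-- The derivative of the second fibre map. -/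
theorem deriv_w (h : G.Reduces N c I p₁ p₂ q₁ q₂ r₁ r₂) (hp : (z, (a, b)) ∈ N) :
    c.q₂ z.1 * deriv (G.w z) b * G.psi z a
      = (c.p₁ z.1 * pd ex G.xcoord z ^ 2 / p₁ * q₂ : ℝ) * G.fibD z a a := by
  have F := h.firstOrder hp
  have hp₁ : (p₁ : ℂ) ≠ 0 := Complex.ofReal_ne_zero.2 h.p₁_ne
  -- In the reference equation b' enters only linearly and through `G.w z b'`; the claim is its
  -- derivative at b.
  have B : ∀ b', (z, (a, b')) ∈ N → 
      Complex.I * pd et (fun y => G.psi y a) z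
        + c.p₁ z.1 * pd ex (pd ex fun y => G.psi y a) z
        + c.p₂ z.1 * pd ey (pd ey fun y => G.psi y a) z
        + (c.p₁ z.1 * pd ex G.xcoord z ^ 2 / p₁ * (q₁ * Complex.normSq a) : ℝ) * G.fibD z a a
        + ((c.p₁ z.1 * pd ex G.xcoord z ^ 2 / p₁ * q₂ : ℝ) * G.fibD z a a) * b'
      = c.q₁ z.1 * Complex.normSq (G.psi z a) * G.psi z a + c.q₂ z.1 * G.psi z a * G.w z b' := by
    intro b' hp'
    have e := (h.base hp').1
    have e' : (q₁ * Complex.normSq a * a + q₂ * a * b') / p₁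
        = ((q₁ * Complex.normSq a + q₂ * b') / p₁ : ℝ) • a := by
      rw [Complex.real_smul]; push_cast; field_simp
    rw [F.X_y, e', smul_smul, smul_smul, map_smul, map_smul, Complex.real_smul, Complex.real_smul] at e
    rw [← e]
    push_cast
    field_simp
    ring
  have near : ∀ᶠ b' in nhds b, (z, (a, b')) ∈ N :=
    (Continuous.prodMk_right z |>.comp (Continuous.prodMk_right a)).continuousAt.eventually
      (h.isOpen.mem_nhds hp)
  obtain ⟨-, -, -, -, sw, -⟩ := h.invertible _ hp
  have dw : DifferentiableAt ℝ (G.w z) b :=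
    DifferentiableAt.comp (g := fun q : Base × ℝ => G.w q.1 q.2) b (sw.differentiableAt (by simp))
      ((differentiableAt_const z).prodMk differentiableAt_id)
  have D1 := ((dw.hasDerivAt.ofReal_comp).const_mul (c.q₂ z.1 * G.psi z a : ℂ)).const_add
    (c.q₁ z.1 * Complex.normSq (G.psi z a) * G.psi z a : ℂ)
  have D2 := (((hasDerivAt_id b).ofReal_comp).const_mul
    ((c.p₁ z.1 * pd ex G.xcoord z ^ 2 / p₁ * q₂ : ℝ) * G.fibD z a a : ℂ)).const_add
    (Complex.I * pd et (fun y => G.psi y a) z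
        + c.p₁ z.1 * pd ex (pd ex fun y => G.psi y a) z
        + c.p₂ z.1 * pd ey (pd ey fun y => G.psi y a) z
        + (c.p₁ z.1 * pd ex G.xcoord z ^ 2 / p₁ * (q₁ * Complex.normSq a) : ℝ) * G.fibD z a a)
  have e := D1.unique (D2.congr_of_eventuallyEq (near.mono fun b' hb' => (B b' hb').symm))
  rw [Complex.ofReal_one, mul_one] at e
  linear_combination e

end FiberMap.Reduces

namespace FiberMap.Reduces

variable {G : FiberMap} {N : Set Tot} {c : Coeffs} {I : Opens ℝ} {p₁ p₂ q₁ q₂ r₁ r₂ : ℝ}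
  {z : Base} {a : ℂ} {b : ℝ}

/-- Polarization: the second fibre derivative is symmetric and vanishes on the diagonal. -/
theorem fibD_hasFDerivAt (h : G.Reduces N c I p₁ p₂ q₁ q₂ r₁ r₂) (hp : (z, (a, b)) ∈ N) (r : ℂ) :
    HasFDerivAt (fun a => G.fibD z a r) (0 : ℂ →L[ℝ] ℂ) a := by
  obtain ⟨-, -, s, -, -, -⟩ := h.invertible _ hp
  have s2 : ContDiffAt ℝ 2 (fun q : Base × ℂ => G.psi q.1 q.2) (z, a) := s.of_le two_le_infty
  have d := (((s2.fderiv_right (m := 1) (by norm_num)).differentiableAt (by norm_num)).hasFDerivAt.comp a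
    (hasFDerivAt_prodMk_right z a)).clm_apply (hasFDerivAt_const ((0 : Base), r) a)
  refine d.congr_fderiv (ContinuousLinearMap.ext fun t => ?_)
  have sym : ∀ u v, G.fibH z a u v = G.fibH z a v u := fun u v =>
    (s2.isSymmSndFDerivAt (by simp)) (0, u) (0, v)
  have add : G.fibH z a (t + r) (t + r) = G.fibH z a t t + G.fibH z a t r + (G.fibH z a r t
      + G.fibH z a r r) := by
    have e : ((0 : Base), t + r) = (0, t) + (0, r) := by simp
    unfold fibH
    simp only [e, map_add, add_apply]
    ring
  rw [(h.fiber_affine hp _).1, (h.fiber_affine hp _).1, (h.fiber_affine hp _).1, sym r t] at add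
  have : G.fibH z a t r = 0 := by linear_combination -add / 2
  simpa [fibH] using this

/-! ### Linearity in `ψ̃` and the images of constants -/

/-- A box on which the transformation is linear in `ψ̃`. -/
theorem exists_box (h : G.Reduces N c I p₁ p₂ q₁ q₂ r₁ r₂) (hp : (z, (a, b)) ∈ N) :
    ∃ Z : Set Base, ∃ ε > 0, IsOpen Z ∧ z ∈ Z ∧ ∀ y ∈ Z, ∀ s ∈ Metric.ball a ε, (y, (s, b)) ∈ N ∧
      G.psi y s = G.fibD y a s ∧ G.fibD y s = G.fibD y a := by
  have hc : Continuous fun q : Base × ℂ => ((q.1, (q.2, b)) : Tot) := by fun_prop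
  obtain ⟨Z, U, hZ, hz, hU, ha, hsub⟩ := mem_nhds_prod_iff'.1
    (hc.continuousAt.preimage_mem_nhds (x := (z, a)) (h.isOpen.mem_nhds hp))
  obtain ⟨ε, hε, hball⟩ := Metric.isOpen_iff.1 hU a ha
  have hN : ∀ y ∈ Z, ∀ s ∈ Metric.ball a ε, (y, (s, b)) ∈ N := fun y hy s hs =>
    hsub (mk_mem_prod hy (hball hs))
  have haε : a ∈ Metric.ball a ε := Metric.mem_ball_self hε
  have const : ∀ y ∈ Z, ∀ s ∈ Metric.ball a ε, G.fibD y s = G.fibD y a := fun y hy s hs =>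
    ContinuousLinearMap.ext fun r =>
      Metric.isOpen_ball.is_const_of_fderiv_eq_zero (𝕜 := ℝ) (f := fun s => G.fibD y s r)
        (convex_ball a ε).isPreconnected
        (fun s hs => (h.fibD_hasFDerivAt (hN y hy s hs) r).differentiableAt.differentiableWithinAt)
        (fun s hs => (h.fibD_hasFDerivAt (hN y hy s hs) r).fderiv) hs haε
  refine ⟨Z, ε, hε, hZ, hz, fun y hy s hs => ⟨hN y hy s hs, ?_, const y hy s hs⟩⟩
  have hya := hN y hy a haε
  have hw : deriv (G.w y) b ≠ 0 := (h.invertible _ hya).2.2.2.2.2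
  have hq : c.q₂ y.1 ≠ 0 := (h.coeffs.ne_zero y.1 (h.subset hya)).2.2.2.1
  -- `deriv_w` makes ψ(s) equal to C Dψ(s), with C independent of s. Comparing derivatives in a
  -- direction where Dψ does not vanish gives C = 1; hence ψ is linear, with no inhomogeneous term.
  set C : ℝ := c.p₁ y.1 * pd ex G.xcoord y ^ 2 / p₁ * q₂ / (c.q₂ y.1 * deriv (G.w y) b) with hC
  have psi : ∀ s ∈ Metric.ball a ε, G.psi y s = C • G.fibD y a s := fun s hs => by
    have e := h.deriv_w (hN y hy s hs)
    rw [const y hy s hs] at e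
    have n : ((c.q₂ y.1 * deriv (G.w y) b : ℝ) : ℂ) ≠ 0 := Complex.ofReal_ne_zero.2 (mul_ne_zero hq hw)
    refine mul_left_cancel₀ n ?_
    rw [Complex.real_smul, ← mul_assoc, ← Complex.ofReal_mul, hC, mul_div_cancel₀ _ (mul_ne_zero hq hw), ← e]
    push_cast; ring
  have d1 := (h.fiber hya).1
  have d2 : HasFDerivAt (G.psi y) (C • G.fibD y a) a :=
    ((G.fibD y a).hasFDerivAt.const_smul C).congr_of_eventuallyEq
      (Filter.eventually_of_mem (Metric.isOpen_ball.mem_nhds haε) psi)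
  obtain ⟨δ, hδ⟩ := (h.fiber hya).2.2 (G.psi y a)
  have e := congrArg (fun A => A δ) (d1.unique d2)
  simp only [smul_apply, hδ, Complex.real_smul] at e
  have hψ := h.psi_ne _ hya
  dsimp only at hψ
  have C1 : (C : ℂ) = 1 := mul_right_cancel₀ hψ (by rw [← e, one_mul])
  rw [psi s hs, Complex.real_smul, C1, one_mul]

/-- On a box where ψ is linear in ψ̃, the determining equations evaluated at the constant values ψ̃
= a and w̃ = b become the fields of the structure. Here a ≠ 0 is needed to scale ψ̃ in `amp`. -/
theorem affineReduction (h : G.Reduces N c I p₁ p₂ q₁ q₂ r₁ r₂) (hr : p₂ + p₁ * r₁ = 0)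
    (hp : (z, (a, b)) ∈ N) (ha : a ≠ 0) :
    ∃ Z : Set Base, IsOpen Z ∧ z ∈ Z ∧ Z ⊆ slab I ∧
      AffineReduction c Z G.xcoord G.ycoord (fun y => G.psi y a) (fun y => G.w y b) (p₂ / p₁)
        (q₂ * b / p₁) (q₁ * Complex.normSq a / p₁) (q₂ * r₂ * Complex.normSq a / p₁) := by
  obtain ⟨Z, ε, hε, hZ, hz, box⟩ := h.exists_box hp
  have near : ∀ {p : Base → Prop}, (∀ y ∈ Z, p y) → ∀ y ∈ Z, ∀ᶠ x in nhds y, p x := fun h y hy =>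
    Filter.eventually_of_mem (hZ.mem_nhds hy) h
  have haε : a ∈ Metric.ball a ε := Metric.mem_ball_self hε
  have hN : ∀ y ∈ Z, (y, (a, b)) ∈ N := fun y hy => (box y hy a haε).1
  have lin : ∀ y ∈ Z, G.fibD y a a = G.psi y a := fun y hy => (box y hy a haε).2.1.symm
  have hp₁ : (p₁ : ℂ) ≠ 0 := Complex.ofReal_ne_zero.2 h.p₁_ne
  have sψ : ∀ y ∈ Z, ContDiffAt ℝ ∞ (fun y => G.psi y a) y := fun y hy =>
    ContDiffAt.comp (g := fun q : Base × ℂ => G.psi q.1 q.2) (f := fun y => (y, a)) y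
      (h.invertible _ (hN y hy)).2.2.1 (contDiffAt_id.prodMk contDiffAt_const)
  have sw : ∀ y ∈ Z, ContDiffAt ℝ ∞ (fun y => G.w y b) y := fun y hy =>
    ContDiffAt.comp (g := fun q : Base × ℝ => G.w q.1 q.2) (f := fun y => (y, b)) y
      (h.invertible _ (hN y hy)).2.2.2.2.1 (contDiffAt_id.prodMk contDiffAt_const)
  -- the mixed derivatives
  have mixed : ∀ y ∈ Z, ∀ v, G.mixed v y a a = pd v (fun y => G.psi y a) y := by
    intro y hy v
    have s2 : ContDiffAt ℝ 2 (fun q : Base × ℂ => G.psi q.1 q.2) (y, a) :=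
      (h.invertible _ (hN y hy)).2.2.1.of_le two_le_infty
    have d0 := ((s2.fderiv_right (m := 1) (by norm_num)).differentiableAt (by norm_num)).hasFDerivAt
    have d1 : HasFDerivAt (fun y => fderiv ℝ (fun q : Base × ℂ => G.psi q.1 q.2) (y, a))
        ((fderiv ℝ (fderiv ℝ fun q : Base × ℂ => G.psi q.1 q.2) (y, a)).comp
          (ContinuousLinearMap.inl ℝ Base ℂ)) y :=
      HasFDerivAt.comp (f := fun y => (y, a)) y d0 (hasFDerivAt_prodMk_left y a)
    have d := d1.clm_apply (hasFDerivAt_const ((0 : Base), a) y)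
    have e : (fun y => G.psi y a) =ᶠ[nhds y]
        fun y => fderiv ℝ (fun q : Base × ℂ => G.psi q.1 q.2) (y, a) (0, a) :=
      near (fun y hy => (lin y hy).symm) y hy
    rw [pd_congr e]
    refine Eq.trans ?_ (congrArg (fun A => A v) d.fderiv).symm
    simp [FiberMap.mixed]
  have M_x : ∀ y ∈ Z, 2 * c.p₁ y.1 * pd ex G.xcoord y * pd ex (fun y => G.psi y a) y
      = -(Complex.I * pd et G.xcoord y * G.psi y a) := fun y hy => by
    have := (h.fiber_affine (hN y hy) a).2.1
    rw [mixed y hy, lin y hy] at this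
    linear_combination this
  have M_y : ∀ y ∈ Z, 2 * c.p₂ y.1 * pd ey G.ycoord y * pd ey (fun y => G.psi y a) y
      = -(Complex.I * pd et G.ycoord y * G.psi y a) := fun y hy => by
    have := (h.fiber_affine (hN y hy) a).2.2
    rw [mixed y hy, lin y hy] at this
    linear_combination this
  have base : ∀ y ∈ Z, ∀ s ∈ Metric.ball a ε,
      Complex.I * pd et (fun y => G.psi y s) y + c.p₁ y.1 * pd ex (pd ex fun y => G.psi y s) y
        + c.p₂ y.1 * pd ey (pd ey fun y => G.psi y s) y
        + (c.p₁ y.1 * pd ex G.xcoord y ^ 2 * ((q₁ * Complex.normSq s + q₂ * b) / p₁) : ℝ) * G.psi y s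
      = c.q₁ y.1 * Complex.normSq (G.psi y s) * G.psi y s + c.q₂ y.1 * G.psi y s * G.w y b := by
    intro y hy s hs
    obtain ⟨hp', e1, e2⟩ := box y hy s hs
    have e := (h.base hp').1
    have e' : (q₁ * Complex.normSq s * s + q₂ * s * b) / p₁
        = ((q₁ * Complex.normSq s + q₂ * b) / p₁ : ℝ) • s := by
      rw [Complex.real_smul]; push_cast; field_simp
    rw [(h.firstOrder hp').X_y, e', smul_smul, smul_smul, map_smul, map_smul, e2, ← e1,
      Complex.real_smul, Complex.real_smul] at e
    rw [← e]
    push_cast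
    ring
  -- The reference equation at a and at (1 + η) a: the linear terms scale by 1 + η and the cubic
  -- ones by its cube, so the cubic terms balance separately.
  have amp : ∀ y ∈ Z, c.q₁ y.1 * Complex.normSq (G.psi y a)
      = q₁ * Complex.normSq a / p₁ * (c.p₁ y.1 * pd ex G.xcoord y ^ 2) := by
    intro y hy
    obtain ⟨η, hη, hηε⟩ : ∃ η : ℝ, 0 < η ∧ (1 + η) • a ∈ Metric.ball a ε := by
      refine ⟨ε / (2 * ‖a‖), by positivity, ?_⟩
      have : ‖a‖ ≠ 0 := norm_ne_zero_iff.2 ha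
      rw [Metric.mem_ball, dist_eq_norm, add_smul, one_smul, add_sub_cancel_left, norm_smul,
        Real.norm_of_nonneg (by positivity)]
      field_simp
      norm_num
    have sc : ∀ y ∈ Z, G.psi y ((1 + η) • a) = ((1 + η : ℝ) : ℂ) * G.psi y a := fun y hy => by
      rw [(box y hy _ hηε).2.1, map_smul, lin y hy, Complex.real_smul]
    have p1 : ∀ y ∈ Z, ∀ v, pd v (fun y => G.psi y ((1 + η) • a)) y
        = ((1 + η : ℝ) : ℂ) * pd v (fun y => G.psi y a) y := fun y hy v =>
      (((hasPd (sψ y hy) v).const_mul _).congr (near sc y hy)).eq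
    have p2 : ∀ v, pd v (pd v fun y => G.psi y ((1 + η) • a)) y
        = ((1 + η : ℝ) : ℂ) * pd v (pd v fun y => G.psi y a) y := fun v =>
      (((hasPd (contDiffAt_pd (sψ y hy) v) v).const_mul _).congr (near (fun y hy => p1 y hy v) y hy)).eq
    have E1 := base y hy a haε
    have E2 := base y hy _ hηε
    rw [sc y hy, p1 y hy, p2, p2, Complex.normSq_mul, Complex.normSq_ofReal, Complex.real_smul,
      Complex.normSq_mul, Complex.normSq_ofReal] at E2
    have hψ : G.psi y a ≠ 0 := h.psi_ne _ (hN y hy)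
    have : (((1 + η) * ((1 + η) * (1 + η) - 1) * (c.q₁ y.1 * Complex.normSq (G.psi y a)
        - q₁ * Complex.normSq a / p₁ * (c.p₁ y.1 * pd ex G.xcoord y ^ 2)) : ℝ) : ℂ) * G.psi y a = 0 := by
      push_cast at E1 E2 ⊢
      linear_combination (1 + η : ℂ) * E1 - E2
    have := Complex.ofReal_eq_zero.1 ((mul_eq_zero.1 this).resolve_right hψ)
    have n : (1 + η) * ((1 + η) * (1 + η) - 1) ≠ 0 := by
      have : (1 + η) * ((1 + η) * (1 + η) - 1) = (1 + η) * (η * (2 + η)) := by ring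
      rw [this]; positivity
    exact sub_eq_zero.1 ((mul_eq_zero.1 this).resolve_left n)
  refine ⟨Z, hZ, hz, fun y hy => h.subset (hN y hy), ?_⟩
  refine
    { X_smooth := fun y hy => (h.time_smooth (hN y hy)).2.1
      Y_smooth := fun y hy => (h.time_smooth (hN y hy)).2.2
      M_smooth := sψ
      w_smooth := sw
      X_y := fun y hy => (h.firstOrder (hN y hy)).X_y
      Y_x := fun y hy => (h.firstOrder (hN y hy)).Y_x
      X_xx := fun y hy => (h.secondOrder (hN y hy)).1
      Y_yy := fun y hy => (h.secondOrder (hN y hy)).2.2.2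
      X_x := fun y hy => (h.firstOrder (hN y hy)).X_x
      Y_y := fun y hy => (h.firstOrder (hN y hy)).Y_y
      M_ne := fun y hy => h.psi_ne _ (hN y hy)
      M_x := M_x
      M_y := M_y
      schrodinger := fun y hy => ?_
      wave := fun y hy => ?_
      q₁ := amp
      p₂ := fun y hy => ?_
      r₁ := fun y hy => ?_
      r₂ := fun y hy => ?_ }
  · have e := base y hy a haε
    have e' := congrArg (fun x : ℝ => (x : ℂ)) (amp y hy)
    push_cast at e e' ⊢
    linear_combination e + G.psi y a * e'
  -- The right hand side is r₂ (|ψ|²)_yy, which is zero since ψ_y = i g ψ with g real.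
  · have e := (h.base (hN y hy)).2
    have F := h.firstOrder (hN y hy)
    rw [F.X_y, zero_pow two_ne_zero, zero_smul, map_zero, add_zero] at e
    have n : ∀ y ∈ Z, c.p₂ y.1 ≠ 0 := fun y hy =>
      (h.coeffs.ne_zero y.1 (h.subset (hN y hy))).2.1
    have nY : ∀ y ∈ Z, pd ey G.ycoord y ≠ 0 := fun y hy => (h.firstOrder (hN y hy)).Y_y
    have sY := (h.time_smooth (hN y hy)).2.2
    have sg : ContDiffAt ℝ ∞ (fun y => -(pd et G.ycoord y / (2 * c.p₂ y.1 * pd ey G.ycoord y))) y :=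
      ((contDiffAt_pd sY et).div ((contDiffAt_const.mul
        (contDiffAt_time (contDiffAt_of_mem h.coeffs.smooth_p₂ (h.subset (hN y hy))))).mul
        (contDiffAt_pd sY ey)) (mul_ne_zero (mul_ne_zero two_ne_zero (n y hy)) (nY y hy))).neg
    have M_y' : ∀ y ∈ Z, pd ey (fun y => G.psi y a) y
        = Complex.I * ((-(pd et G.ycoord y / (2 * c.p₂ y.1 * pd ey G.ycoord y)) : ℝ) : ℂ) * G.psi y a := by
      intro y hy
      have h1 := M_y y hy
      have n1 : (c.p₂ y.1 : ℂ) ≠ 0 := Complex.ofReal_ne_zero.2 (n y hy)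
      have n2 : ((pd ey G.ycoord y : ℝ) : ℂ) ≠ 0 := Complex.ofReal_ne_zero.2 (nY y hy)
      push_cast
      field_simp
      linear_combination h1
    have e2 := (HasPd.pd_of_phase ((sψ y hy).differentiableAt (by simp)) (hasPd sg ey)
      (near M_y' y hy)).eq
    rw [e, e2, M_y' y hy]
    generalize pd ey (fun y => -(pd et G.ycoord y / (2 * c.p₂ y.1 * pd ey G.ycoord y))) y = g'
    generalize -(pd et G.ycoord y / (2 * c.p₂ y.1 * pd ey G.ycoord y)) = g
    generalize G.psi y a = m
    rw [mul_eq_zero]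
    right
    simp [Complex.normSq_apply, ← Complex.ofReal_pow]
    ring
  · have := (h.rotation (hN y hy)).2
    have := h.p₁_ne
    field_simp
    linarith
  · rw [(h.firstOrder (hN y hy)).r₁]
    have := h.p₁_ne
    have e : r₁ = -(p₂ / p₁) := by field_simp; linarith
    rw [← e]
  · have e1 := (h.firstOrder (hN y hy)).r₂ a
    have e2 := h.deriv_w (hN y hy)
    have hψ : G.psi y a ≠ 0 := h.psi_ne _ (hN y hy)
    have n := h.p₁_ne
    rw [lin y hy] at e1 e2
    have e3 : c.q₂ y.1 * deriv (G.w y) b = c.p₁ y.1 * pd ex G.xcoord y ^ 2 / p₁ * q₂ := by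
      have := mul_right_cancel₀ hψ e2
      exact_mod_cast this
    have nn : ∀ x : ℂ, (starRingEnd ℂ x * x).re = Complex.normSq x := fun x => by
      simp [Complex.normSq_apply]
    rw [nn, nn] at e1
    have : c.q₂ y.1 * c.r₂ y.1 * pd ey G.ycoord y ^ 2 * Complex.normSq (G.psi y a)
        = (c.q₂ y.1 * deriv (G.w y) b) * pd ex G.xcoord y ^ 2 * r₂ * Complex.normSq a := by
      linear_combination -c.q₂ y.1 * e1
    rw [this, e3]
    ring

/-- The value |a|² cancels in ϖ/(ρν). The constant therefore depends only on the coefficients of the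
new system and is the same at all times, although the transformation varies with the time. -/
theorem reducibleAt (h : G.Reduces N c I p₁ p₂ q₁ q₂ r₁ r₂) (hr : p₂ + p₁ * r₁ = 0)
    (hp : (z, (a, b)) ∈ N) (ha : a ≠ 0) : ReducibleAt c (q₂ * r₂ * p₁ / (p₂ * q₁)) z.1 := by
  obtain ⟨Z, hZ, hz, hZI, H⟩ := h.affineReduction hr hp ha
  have hn : Complex.normSq a ≠ 0 := by simpa using ha
  have n₁ := h.p₁_ne
  have n₂ := h.p₂_ne
  have m₁ := h.q₁_ne
  have := H.reducibleAt h.coeffs hZ hZI (div_ne_zero n₂ n₁) (div_ne_zero (mul_ne_zero m₁ hn) n₁) hz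
  convert this using 1
  field_simp

end FiberMap.Reduces

/-! ### Necessity of the tables -/

theorem PointEquivalentToIntegrable.table1 {I : Opens ℝ} (hI : IsPreconnected (I : Set ℝ))
    (hne : (I : Set ℝ).Nonempty) {c : Coeffs} (hc : c.SmoothNonzeroOn I)
    (h : PointEquivalentToIntegrable c I) : Table1 c I := by
  obtain ⟨p₁, p₂, q₁, q₂, r₁, r₂, hp₁, hp₂, hq₁, hq₂, hr₁, hr₂, hr, h⟩ := h
  refine Table1.of_reducibleAt hI hne hc (K := q₂ * r₂ * p₁ / (p₂ * q₁)) fun t ht => ?_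
  obtain ⟨N, G, hN, hNI, ⟨⟨z, a, b⟩, hp, rfl⟩, hG, hT⟩ := h t ht
  obtain ⟨-, -, s, hb, -, -⟩ := hG _ hp
  dsimp only at s hb
  -- points of the fibre at which neither `ψ̃` nor `ψ` vanishes
  have d : DifferentiableAt ℝ (G.psi z) a :=
    DifferentiableAt.comp (g := fun q : Base × ℂ => G.psi q.1 q.2) a (s.differentiableAt (by simp))
      ((differentiableAt_const z).prodMk differentiableAt_id)
  have e1 : ∀ᶠ a' in nhdsWithin a {a}ᶜ, G.psi z a' ≠ 0 :=
    d.hasFDerivAt.eventually_ne ⟨_, (ContinuousLinearEquiv.ofBijective (fderiv ℝ (G.psi z) a)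
      (LinearMap.ker_eq_bot.2 hb.1) (LinearMap.range_eq_top.2 hb.2)).antilipschitz⟩
  have e2 : ∀ᶠ a' in nhdsWithin a {a}ᶜ, a' ≠ 0 := by
    by_cases ha : a = 0
    · subst ha; exact self_mem_nhdsWithin
    · exact nhdsWithin_le_nhds (isOpen_ne.mem_nhds ha)
  have e3 : ∀ᶠ a' in nhdsWithin a {a}ᶜ, (z, (a', b)) ∈ N := by
    have hcont : Continuous fun a' : ℂ => ((z, (a', b)) : Tot) := by fun_prop
    exact nhdsWithin_le_nhds (hcont.continuousAt.eventually (hN.mem_nhds hp))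
  obtain ⟨a', ha', ha0, haN⟩ := (e1.and (e2.and e3)).exists
  have cont : ContinuousOn (fun p : Tot => G.psi p.1 p.2.1) N := fun p hp' =>
    (ContinuousAt.comp (g := fun q : Base × ℂ => G.psi q.1 q.2) (f := fun p : Tot => (p.1, p.2.1))
      (hG p hp').2.2.1.continuousAt (by fun_prop)).continuousWithinAt
  -- Removing the zeros of ψ keeps the set open, and changing a inside the fibre keeps the time
  -- coordinate.
  have red : G.Reduces (N ∩ (fun p : Tot => G.psi p.1 p.2.1) ⁻¹' {0}ᶜ) c I p₁ p₂ q₁ q₂ r₁ r₂ :=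
    { coeffs := hc
      isOpen := cont.isOpen_inter_preimage hN isOpen_compl_singleton
      subset := inter_subset_left.trans hNI
      invertible := fun p hp' => hG p hp'.1
      transforms := fun z F hF hz => hT z F hF hz.1
      p₁_ne := hp₁
      p₂_ne := hp₂
      q₁_ne := hq₁
      q₂_ne := hq₂
      r₁_ne := hr₁
      r₂_ne := hr₂
      psi_ne := fun p hp' => hp'.2 }
  exact red.reducibleAt hr ⟨haN, ha'⟩ ha0

/-! ### Sufficiency of the tables -/

section Reduction

variable {I : Opens ℝ} {c : Coeffs} {ε A B : ℝ}

theorem Coeffs.smoothNonzeroOn_const {p₁ p₂ q₁ q₂ r₁ r₂ : ℝ} (hp₁ : p₁ ≠ 0) (hp₂ : p₂ ≠ 0)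
    (hq₁ : q₁ ≠ 0) (hq₂ : q₂ ≠ 0) (hr₁ : r₁ ≠ 0) (hr₂ : r₂ ≠ 0) (J : Set ℝ) :
    (Coeffs.const p₁ p₂ q₁ q₂ r₁ r₂).SmoothNonzeroOn J where
  smooth_p₁ := contDiffOn_const
  smooth_p₂ := contDiffOn_const
  smooth_q₁ := contDiffOn_const
  smooth_q₂ := contDiffOn_const
  smooth_r₁ := contDiffOn_const
  smooth_r₂ := contDiffOn_const
  ne_zero _ _ := ⟨hp₁, hp₂, hq₁, hq₂, hr₁, hr₂⟩

theorem exists_sign_p₁ (hI : IsPreconnected (I : Set ℝ)) (hc : c.SmoothNonzeroOn I) :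
    ∃ σ : ℝ, (σ = 1 ∨ σ = -1) ∧ ∀ t ∈ I, 0 < σ * c.p₁ t := by
  rcases pos_or_neg_of_ne_zero hI hc.smooth_p₁.continuousOn fun t ht => (hc.ne_zero t ht).1 with h | h
  · exact ⟨1, Or.inl rfl, fun t ht => by simpa using h t ht⟩
  · exact ⟨-1, Or.inr rfl, fun t ht => by simpa using h t ht⟩

theorem exists_time_change (hI : IsPreconnected (I : Set ℝ)) (hc : c.SmoothNonzeroOn I) :
    ∃ T : ℝ → ℝ, ContDiffOn ℝ ∞ T I ∧ ∀ t ∈ I, 0 < deriv T t * c.p₁ t := by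
  obtain ⟨σ, -, h⟩ := exists_sign_p₁ hI hc
  refine ⟨fun t => σ * t, contDiffOn_const.mul contDiffOn_id, fun t ht => ?_⟩
  have : deriv (fun t : ℝ => σ * t) t = σ := by simp
  rw [this]; exact h t ht

/-- T is taken to be a diffeomorphism of I onto the given J whose orientation is the sign of p₁,
with α₀ = β₀ = θ₀ = 0; any admissible choice would do. -/
theorem Reducible.exists_lieEquiv (hI : IsPreconnected (I : Set ℝ))
    (hne : (I : Set ℝ).Nonempty) (hc : c.SmoothNonzeroOn I) (hε : ε = 1 ∨ ε = -1) (hA : A ≠ 0)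
    (hB : B ≠ 0) (h : Reducible c I ε A B) (J : Opens ℝ) (hJ : IsPreconnected (J : Set ℝ))
    (hJne : (J : Set ℝ).Nonempty) :
    ∃ e : VField I ≃ₗ⁅ℝ⁆ VField J, ∀ V : VField I, V ∈ symmetryAlgebra c I ↔
      e V ∈ symmetryAlgebra (Coeffs.const 1 ε A 1 (-ε) B) J := by
  have hε0 : ε ≠ 0 := by rcases hε with rfl | rfl <;> norm_num
  obtain ⟨σ, hσ, hp⟩ := exists_sign_p₁ hI hc
  obtain ⟨T, S, hT, hS, hTJ, hSI, hST, hTS, hpos⟩ := exists_interval_diffeo I J hI hne hJ hJne hσ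
  have hσ2 : σ * σ = 1 := by rcases hσ with rfl | rfl <;> norm_num
  have hTp : ∀ t ∈ I, 0 < deriv T t * c.p₁ t := fun t ht => by
    have := mul_pos (hpos t ht) (hp t ht)
    calc (0 : ℝ) < σ * deriv T t * (σ * c.p₁ t) := this
      _ = σ * σ * (deriv T t * c.p₁ t) := by ring
      _ = deriv T t * c.p₁ t := by rw [hσ2, one_mul]
  have hadm := h.admissible hc hε hT hTp
  have h0 : ContDiffOn ℝ ∞ (fun _ : ℝ => (0 : ℝ)) I := contDiffOn_const
  exact ⟨(hadm.diffeo hc h0 h0 h0 hS hTJ hSI hST hTS).lieEquiv, symmetryAlgebra_push hc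
    (Coeffs.smoothNonzeroOn_const one_ne_zero hε0 hA one_ne_zero (neg_ne_zero.2 hε0) hB J) hadm
    h0 h0 h0 (hadm.diffeo_represents hc h0 h0 h0 hS hTJ hSI hST hTS)⟩

theorem Reducible.pointEquivalent (hI : IsPreconnected (I : Set ℝ)) (hc : c.SmoothNonzeroOn I)
    (hε : ε = 1 ∨ ε = -1) (hA : A ≠ 0) (hB : B ≠ 0) (h : Reducible c I ε A B) :
    PointEquivalentToIntegrable c I := by
  have hε0 : ε ≠ 0 := by rcases hε with rfl | rfl <;> norm_num
  obtain ⟨T, hT, hTp⟩ := exists_time_change hI hc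
  have hadm := h.admissible hc hε hT hTp
  have h0 : ContDiffOn ℝ ∞ (fun _ : ℝ => (0 : ℝ)) I := contDiffOn_const
  exact ⟨1, ε, A, 1, -ε, B, one_ne_zero, hε0, hA, one_ne_zero, neg_ne_zero.2 hε0, hB, by ring,
    fun t₀ ht₀ => ⟨dom I, _, isOpen_dom I, Subset.rfl, ⟨((t₀, 0, 0), 0), ht₀, rfl⟩,
      isLocallyInvertibleOn hc hadm h0 h0 h0, transforms hc hadm h0 h0 h0⟩⟩

end Reduction

end DaveyStewartson

open DaveyStewartson
theorem theorem2 (I : Opens ℝ) (hI : IsPreconnected (I : Set ℝ)) (hne : (I : Set ℝ).Nonempty)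
    (c : Coeffs) (hc : c.SmoothNonzeroOn I) :
    -- under the conditions of one of the tables
    (Table1 c I ∨ Table2 c I →
      ∃ ε A B : ℝ, (ε = 1 ∨ ε = -1) ∧ A ≠ 0 ∧ B ≠ 0 ∧
        (∀ t ∈ I, 0 < ε * (c.p₁ t * c.p₂ t) ∧
          c.q₁ t = A * (Real.sign (c.p₁ t) * Real.sqrt |c.p₁ t * c.p₂ t|) ∧
          c.q₂ t * c.r₂ t * |c.p₁ t|
            = B * (Real.sign (c.p₁ t) * |c.p₂ t| * Real.sqrt |c.p₁ t * c.p₂ t|)) ∧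
        -- the symmetry algebra is isomorphic to that of the integrable standard system
        (∀ J : Opens ℝ, IsPreconnected (J : Set ℝ) → (J : Set ℝ).Nonempty →
          ∃ e : VField I ≃ₗ⁅ℝ⁆ VField J,
            ∀ V : VField I, V ∈ symmetryAlgebra c I ↔
              e V ∈ symmetryAlgebra (Coeffs.const 1 ε A 1 (-ε) B) J) ∧
        -- explicit point transformations exist
        (∃ T : ℝ → ℝ, ContDiffOn ℝ ∞ T I ∧ ∀ t ∈ I, 0 < deriv T t * c.p₁ t) ∧
        (∀ T α₀ β₀ θ₀ : ℝ → ℝ,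
          ContDiffOn ℝ ∞ T I → (∀ t ∈ I, 0 < deriv T t * c.p₁ t) →
          ContDiffOn ℝ ∞ α₀ I → ContDiffOn ℝ ∞ β₀ I → ContDiffOn ℝ ∞ θ₀ I →
          BijOn (canonicalTransformation c ε T α₀ β₀ θ₀).base (slab I) (slab (T '' I)) ∧
          (canonicalTransformation c ε T α₀ β₀ θ₀).IsLocallyInvertibleOn (dom I) ∧
          (canonicalTransformation c ε T α₀ β₀ θ₀).Transforms (dom I) c
            (Coeffs.const 1 ε A 1 (-ε) B))) ∧
    -- the conditions are those for point equivalence to an integrable system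
    (Table1 c I ∨ Table2 c I ↔ PointEquivalentToIntegrable c I) := by
  have htab : Table1 c I ∨ Table2 c I → Table1 c I := fun h => h.elim id (Table2.table1 hI hne)
  refine ⟨fun h => ?_, fun h => ?_, fun h => Or.inl (h.table1 hI hne hc)⟩
  · obtain ⟨ε, A, B, hε, hA, hB, hr⟩ := (htab h).reducible hne hc
    refine ⟨ε, A, B, hε, hA, hB, fun t ht => ⟨hr.sign t ht, hr.q₁ t ht, hr.r₂ t ht⟩,
      hr.exists_lieEquiv hI hne hc hε hA hB, exists_time_change hI hc, ?_⟩
    intro T α₀ β₀ θ₀ hT hTp hα₀ hβ₀ hθ₀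
    have hadm := hr.admissible hc hε hT hTp
    exact ⟨base_bijOn hI hadm, isLocallyInvertibleOn hc hadm hα₀ hβ₀ hθ₀,
      transforms hc hadm hα₀ hβ₀ hθ₀⟩
  · obtain ⟨ε, A, B, hε, hA, hB, hr⟩ := (htab h).reducible hne hc
    exact hr.pointEquivalent hI hc hε hA hB
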